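/- Let $F$ be a non-archimedean local field with ring of integers $\mathcal O$, uniformizer $\varpi$ and residue field of cardinality $q_F$; let $I\subset \mathrm{SL}_2(\mathcal O)$ be the Iwahori subgroup of matrices that are upper triangular modulo $\varpi$. Let $\tilde W=\langle s_0,s_1\mid s_0^2=s_1^2=1\rangle$ be the affine Weyl group of $\mathrm{SL}_2$, with length $\ell$ and Bruhat order $\le$, where $s_0$ is represented by $\begin{pmatrix}0&-1\\1&0\end{pmatrix}$ and $s_0s_1$ by $\mathrm{diag}(\varpi,\varpi^{-1})$. Let $H$ be the Iwahori–Hecke algebra of $\tilde W$ over $\mathbb Z[q^{1/2},q^{-1/2}]$, with standard basis $(T_w)$, with $C'_w=q^{-\ell(w)/2}\sum_{y\le w}T_y$ and $C_w=(-1)^{\ell(w)}j(C'_w)$, where $j(\sum a_wT_w)=\sum\bar a_w(-1)^{\ell(w)}q^{-\ell(w)}T_w$ and the bar is $q^{1/2}\mapsto q^{-1/2}$. Write $C_xC_y=\sum_z h_{x,y,z}C_z$; let $a(z)$ be the least integer $n\ge0$ with $(-q^{1/2})^{n}h_{x,y,z}\in\mathbb Z[q^{1/2}]$ for all $x,y$,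 and let $\gamma_{x,y,z}\in\mathbb Z$ be the constant term of $(-q^{1/2})^{a(z)}h_{x,y,z^{-1}}$. Lusztig's asymptotic Hecke algebra $J$ is the free abelian group on symbols $t_w$ $(w\in\tilde W)$ with product $t_xt_y=\sum_z\gamma_{x,y,z}t_{z^{-1}}$ and unit $\sum_{d\in\mathcal D}t_d$, $\mathcal D=\{1,s_0,s_1\}$. Let $\phi(C_x)=\sum_{z\in\tilde W,\,d\in\mathcal D,\,a(d)=a(z)}h_{x,d,z}t_z$, and extend $\phi\circ j$ to the completion of $H$ that consists of the sums $\sum_x b_xC'_x$ with $b_x\in\mathbb Z((q^{-1/2}))$ and $b_x\to0$ as $\ell(x)\to\infty$. Then for every $w\in\tilde W$ there is exactly one element $\sum_x\tau_{w,x}C'_x=(\phi\circ j)^{-1}(t_w)$ of this completion. When $q$ is specialized to $q_F$, $q^{1/2}$ to $\sqrt{q_F}$, and $T_y$ is read as the characteristic function of $IyI$, the series $\tau_{w,x}$ and the sum over $x$ converge absolutely and define an $I$-bi-invariant function, again denoted $t_w$, on $\mathrm{SL}_2(F)$. Let $C_c^\infty(F^2)^I$ be the space of locally constant, compactly supported,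 $I$-invariant functions $f\colon F^2\to\mathbb C$, regarded as functions on $\mathrm{SL}_2(F)/N=F^2\setminus\{0\}$. For every $f\in C_c^\infty(F^2)^I$ the convolution $$(t_w\star f)(x)=\sum_{gI\in \mathrm{SL}_2(F)/I}t_w(g)\,f(g^{-1}x)\qquad(x\in F^2\setminus\{0\})$$ converges absolutely and extends to a function $t_w\star f\in C_c^\infty(F^2)^I$, and $t_w\mapsto(t_w\star-)$ extends to a homomorphism of unital rings $J\to\mathrm{End}_{\mathbb C}\bigl(C_c^\infty(F^2)^I\bigr)$. That is, $J$ acts on $C_c^\infty(F^2)^I$. -/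

import Mathlib

noncomputable section

namespace AffineSL2

open scoped ValuativeRel

/-! ### The affine Weyl group of `SL₂` -/

/-- The affine Weyl group of `SL₂`: the infinite dihedral group, i.e. the semidirect product of
`{1, s₀}` with the group of translations `r n`, `n ∈ ℤ` (the coweight `n α^∨`). -/
abbrev W : Type := DihedralGroup 0

/-- The two simple reflections: `s 0` generates the finite Weyl group, `s 1` is the affine
reflection, and `s 0 * s 1 = r 1` is the translation by `α^∨`. -/
def s : Fin 2 → W := ![DihedralGroup.sr 0, DihedralGroup.sr 1]

/-- The length function of the affine Weyl group (see `isLeast_len`). -/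
def len : W → ℕ
  | .r n => 2 * Int.natAbs n
  | .sr n => Int.natAbs (2 * (show ℤ from n) - 1)

/-- The alternating word with `n` letters and first letter `i`. -/
def alt : Fin 2 → ℕ → List (Fin 2)
  | _, 0 => []
  | i, n + 1 => i :: alt (i + 1) n

/-- The first letter of the reduced expression of a nontrivial element. -/
def start : W → Fin 2
  | .r n => if 0 < (show ℤ from n) then 0 else 1
  | .sr n => if 0 < (show ℤ from n) then 1 else 0

/-- The reduced expression of an element (see `prod_word` and `length_word`); in this group it is
unique. -/
def word (w : W) : List (Fin 2) := alt (start w) (len w)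

theorem length_alt (i : Fin 2) (n : ℕ) : (alt i n).length = n := by
  induction n generalizing i with
  | zero => rfl
  | succ n ih => simp [alt, ih]

theorem length_word (w : W) : (word w).length = len w := length_alt _ _

theorem s_mul_s (i : Fin 2) : s i * s i = 1 := by
  fin_cases i <;> rfl

theorem s_mul_cancel (i : Fin 2) (w : W) : s i * (s i * w) = w := by
  rw [← mul_assoc, s_mul_s, one_mul]

theorem s_mul_r (i : Fin 2) (n : ℤ) :
    s i * (.r n : W) = .sr (if i = 0 then n else 1 + n : ℤ) := by
  fin_cases i
  · exact congrArg DihedralGroup.sr (zero_add (n : ZMod 0))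
  · rfl

theorem s_mul_sr (i : Fin 2) (n : ℤ) :
    s i * (.sr n : W) = .r (if i = 0 then n else n - 1 : ℤ) := by
  fin_cases i
  · exact congrArg DihedralGroup.r (sub_zero (n : ZMod 0))
  · rfl

theorem len_r (n : ℤ) : len (.r n : W) = 2 * n.natAbs := rfl
theorem len_sr (n : ℤ) : len (.sr n : W) = (2 * n - 1).natAbs := rfl
theorem start_r (n : ℤ) : start (.r n : W) = if 0 < n then 0 else 1 := rfl
theorem start_sr (n : ℤ) : start (.sr n : W) = if 0 < n then 1 else 0 := rfl

theorem len_one : len 1 = 0 := rfl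

theorem len_eq_zero {w : W} (h : len w = 0) : w = 1 := by
  rcases w with (n | n)
  · change ℤ at n
    have h' : 2 * n.natAbs = 0 := h
    have : n = 0 := by omega
    subst this; rfl
  · change ℤ at n
    have h' : (2 * n - 1).natAbs = 0 := h
    omega

/-- Left multiplication by a simple reflection changes the length by one, and decreases it exactly
when the reflection is the first letter of the reduced expression. -/
theorem len_s_mul (i : Fin 2) (w : W) :
    (len (s i * w) + 1 = len w ∧ i = start w) ∨
      (len (s i * w) = len w + 1 ∧ (len w = 0 ∨ i ≠ start w) ∧ start (s i * w) = i) := by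
  rcases w with (n | n)
  · change ℤ at n
    change (len (s i * (.r n : W)) + 1 = _ ∧ _) ∨ _
    rw [s_mul_r, len_sr, len_r, start_r, start_sr]
    fin_cases i <;> simp <;> omega
  · change ℤ at n
    change (len (s i * (.sr n : W)) + 1 = _ ∧ _) ∨ _
    rw [s_mul_sr, len_r, len_sr, start_r, start_sr]
    fin_cases i <;> simp <;> omega

theorem word_s_mul (i : Fin 2) (w : W) (h : len (s i * w) = len w + 1) :
    word (s i * w) = i :: word w := by
  rcases len_s_mul i w with h1 | ⟨-, h2, h3⟩
  · omega
  · unfold word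
    rw [h, h3, alt]
    rcases h2 with h2 | h2
    · rw [h2]; rfl
    · congr 2
      revert h2
      generalize start w = j
      revert i j
      intro i _ _ j
      fin_cases i <;> fin_cases j <;> simp

/-- Induction on the length. -/
theorem len_induction {P : W → Prop} (h1 : P 1)
    (h2 : ∀ i w, len (s i * w) = len w + 1 → P w → P (s i * w)) (w : W) : P w := by
  induction hn : len w generalizing w with
  | zero => rw [len_eq_zero hn]; exact h1
  | succ n ih =>
    rcases len_s_mul (start w) w with ⟨h, -⟩ | ⟨-, h, -⟩
    · have := h2 (start w) (s (start w) * w) (by rw [s_mul_cancel]; omega) (ih _ (by omega))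
      rwa [s_mul_cancel] at this
    · rcases h with h | h
      · omega
      · exact absurd rfl h

theorem prod_word (w : W) : ((word w).map s).prod = w := by
  induction w using len_induction with
  | h1 => rfl
  | h2 i w h ih => rw [word_s_mul i w h, List.map_cons, List.prod_cons, ih]

theorem len_prod_le (l : List (Fin 2)) : len (l.map s).prod ≤ l.length := by
  induction l with
  | nil => exact le_of_eq len_one
  | cons i l ih =>
    rw [List.map_cons, List.prod_cons, List.length_cons]
    rcases len_s_mul i (l.map s).prod with h | h <;> omega

/-- `len w` is the least number of letters of an expression of `w` in the simple reflections. -/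
theorem isLeast_len (w : W) :
    IsLeast {n | ∃ l : List (Fin 2), l.length = n ∧ (l.map s).prod = w} (len w) :=
  ⟨⟨word w, length_word w, prod_word w⟩, by
    rintro n ⟨l, rfl, rfl⟩
    exact len_prod_le l⟩

theorem len_mul_le (x y : W) : len (x * y) ≤ len x + len y := by
  have := len_prod_le (word x ++ word y)
  rwa [List.map_append, List.prod_append, prod_word, prod_word, List.length_append, length_word,
    length_word] at this

/-- The set of all `y ≤ w` in the strong Bruhat order: the elements that are obtained by deleting
letters of the reduced expression of `w`. -/
def lower (w : W) : Finset W :=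
  ((word w).sublists.map fun l => (l.map s).prod).toFinset

theorem mem_lower {y w : W} :
    y ∈ lower w ↔ ∃ l : List (Fin 2), l.Sublist (word w) ∧ (l.map s).prod = y := by
  simp [lower]

theorem self_mem_lower (w : W) : w ∈ lower w :=
  mem_lower.2 ⟨word w, List.Sublist.refl _, prod_word w⟩

theorem eq_or_len_lt {y w : W} (h : y ∈ lower w) : y = w ∨ len y < len w := by
  obtain ⟨l, hl, rfl⟩ := mem_lower.1 h
  have h1 := hl.length_le
  rcases h1.lt_or_eq with h2 | h2
  · right
    exact (len_prod_le l).trans_lt (by rwa [length_word] at h2)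
  · left
    rw [hl.eq_of_length h2, prod_word]

/-! ### The generic Iwahori-Hecke algebra -/

/-- The ring `ℤ[v, v⁻¹]`, where `v = q^{1/2}`. -/
abbrev A : Type := LaurentPolynomial ℤ

/-- The power `v ^ n`. -/
def v (n : ℤ) : A := LaurentPolynomial.T n

/-- The parameter `q = v ^ 2`. -/
def q : A := v 2

theorem v_mul_v (m n : ℤ) : v m * v n = v (m + n) := (LaurentPolynomial.T_add m n).symm
theorem v_zero : v 0 = 1 := LaurentPolynomial.T_zero

/-- The defining relations of the Hecke algebra. -/
inductive HeckeRel : FreeAlgebra A W → FreeAlgebra A W → Prop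
  | one : HeckeRel (FreeAlgebra.ι A 1) 1
  | mul (x y : W) (h : len (x * y) = len x + len y) :
      HeckeRel (FreeAlgebra.ι A x * FreeAlgebra.ι A y) (FreeAlgebra.ι A (x * y))
  | quad (i : Fin 2) :
      HeckeRel ((FreeAlgebra.ι A (s i) + 1) * (FreeAlgebra.ι A (s i) - algebraMap A _ q)) 0

/-- The Iwahori-Hecke algebra of the affine Weyl group, over `ℤ[v, v⁻¹]`. -/
def H : Type := RingQuot HeckeRel

instance : Ring H := inferInstanceAs (Ring (RingQuot HeckeRel))

instance : Algebra A H := inferInstanceAs (Algebra A (RingQuot HeckeRel))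

/-- The quotient map onto the Hecke algebra. -/
def mkH : FreeAlgebra A W →ₐ[A] H := RingQuot.mkAlgHom A HeckeRel

theorem mkH_rel {x y : FreeAlgebra A W} (h : HeckeRel x y) : mkH x = mkH y :=
  RingQuot.mkAlgHom_rel A h

/-- The standard generator `T_w`. -/
def T (w : W) : H := mkH (FreeAlgebra.ι A w)

theorem T_one : T 1 = 1 := by
  unfold T
  rw [mkH_rel HeckeRel.one, map_one]

theorem T_mul_T {x y : W} (h : len (x * y) = len x + len y) : T x * T y = T (x * y) := by
  unfold T
  rw [← map_mul, mkH_rel (HeckeRel.mul x y h)]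

theorem T_quad (i : Fin 2) : (T (s i) + 1) * (T (s i) - algebraMap A H q) = 0 := by
  have := mkH_rel (HeckeRel.quad i)
  simpa [T] using this

theorem len_s (i : Fin 2) : len (s i) = 1 := by fin_cases i <;> rfl

theorem T_sq (i : Fin 2) : T (s i) * T (s i) = (q - 1) • T (s i) + q • 1 := by
  have h := T_quad i
  have h2 : (T (s i) + 1) * (T (s i) - algebraMap A H q) =
      T (s i) * T (s i) - T (s i) * algebraMap A H q + T (s i) - algebraMap A H q := by
    noncomm_ring
  rw [h2, ← Algebra.commutes, ← Algebra.smul_def, Algebra.algebraMap_eq_smul_one] at h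
  rw [sub_smul, one_smul]
  have h3 : T (s i) * T (s i) = T (s i) * T (s i) - q • T (s i) + T (s i) - q • (1 : H) +
      (q • T (s i) - T (s i) + q • (1 : H)) := by abel
  rw [h3, h, zero_add]

theorem T_s_mul_T (i : Fin 2) (w : W) :
    T (s i) * T w =
      if len w < len (s i * w) then T (s i * w) else (q - 1) • T w + q • T (s i * w) := by
  split_ifs with h
  · rcases len_s_mul i w with h' | h'
    · omega
    · exact T_mul_T (by rw [len_s]; omega)
  · rcases len_s_mul i w with h' | h'
    · have e : T (s i) * T (s i * w) = T w := by
        rw [T_mul_T (by rw [s_mul_cancel, len_s]; omega), s_mul_cancel]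
      rw [← e, ← mul_assoc, T_sq, add_mul, smul_mul_assoc, smul_mul_assoc, one_mul]
    · omega

/-- The regular representation, in coordinates: left multiplication by `T_{s i}`. -/
def L (i : Fin 2) : Module.End A (W →₀ A) :=
  Finsupp.linearCombination A fun w : W =>
    if len w < len (s i * w) then Finsupp.single (s i * w) (1 : A)
    else (q - 1) • Finsupp.single w (1 : A) + q • Finsupp.single (s i * w) (1 : A)

theorem L_single (i : Fin 2) (w : W) :
    L i (Finsupp.single w 1) =
      if len w < len (s i * w) then Finsupp.single (s i * w) (1 : A)
      else (q - 1) • Finsupp.single w (1 : A) + q • Finsupp.single (s i * w) (1 : A) := by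
  rw [L, Finsupp.linearCombination_single, one_smul]

theorem L_sq (i : Fin 2) : L i * L i = (q - 1) • L i + q • 1 := by
  refine Finsupp.lhom_ext' fun w => LinearMap.ext_ring ?_
  change L i (L i (Finsupp.single w 1)) =
    (q - 1) • L i (Finsupp.single w 1) + q • Finsupp.single w 1
  rw [L_single]
  rcases len_s_mul i w with h | h
  · rw [if_neg (by omega), map_add, map_smul, map_smul, L_single, L_single, if_neg (by omega),
      if_pos (by rw [s_mul_cancel]; omega), s_mul_cancel]
  · rw [if_pos (by omega), L_single, if_neg (by rw [s_mul_cancel]; omega), s_mul_cancel]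

/-- Left multiplication by `T_w`, in coordinates. -/
def op (w : W) : Module.End A (W →₀ A) := ((word w).map L).prod

theorem op_s_mul (i : Fin 2) (w : W) (h : len (s i * w) = len w + 1) :
    op (s i * w) = L i * op w := by
  rw [op, word_s_mul i w h, List.map_cons, List.prod_cons, op]

theorem op_one : op 1 = 1 := rfl

theorem op_s (i : Fin 2) : op (s i) = L i := by
  have := op_s_mul i 1 (by rw [mul_one, len_s, len_one])
  rwa [mul_one, op_one, mul_one] at this

theorem op_mul (x y : W) (h : len (x * y) = len x + len y) : op x * op y = op (x * y) := by
  induction x using len_induction with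
  | h1 => rw [op_one, one_mul, one_mul]
  | h2 i x hx ih =>
    have h1 := len_mul_le x y
    have h2 : len (s i * (x * y)) = len x + 1 + len y := by rw [← mul_assoc, h, hx]
    have h3 : len (x * y) = len x + len y := by
      rcases len_s_mul i (x * y) with h | h <;> omega
    rw [op_s_mul i x hx, mul_assoc, ih h3, mul_assoc, op_s_mul i (x * y) (by omega)]

theorem op_single (w : W) : op w (Finsupp.single 1 1) = Finsupp.single w 1 := by
  induction w using len_induction with
  | h1 => rfl
  | h2 i w h ih =>
    rw [op_s_mul i w h]
    change L i (op w _) = _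
    rw [ih, L_single, if_pos (by omega)]

/-- The regular representation, in coordinates. -/
def regular : H →ₐ[A] Module.End A (W →₀ A) :=
  RingQuot.liftAlgHom A ⟨FreeAlgebra.lift A op, by
    intro x y hxy
    cases hxy with
    | one => rw [FreeAlgebra.lift_ι_apply, op_one, map_one]
    | mul x y h => rw [map_mul, FreeAlgebra.lift_ι_apply, FreeAlgebra.lift_ι_apply,
        FreeAlgebra.lift_ι_apply, op_mul x y h]
    | quad i =>
      rw [map_mul, map_add, map_sub, map_one, map_zero, FreeAlgebra.lift_ι_apply, op_s,
        AlgHom.commutes, Algebra.algebraMap_eq_smul_one]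
      refine LinearMap.ext fun m => ?_
      have e : L i (L i m) = (q - 1) • L i m + q • m := LinearMap.congr_fun (L_sq i) m
      change L i (L i m - q • m) + (L i m - q • m) = 0
      rw [map_sub, map_smul, e, sub_smul, one_smul]
      abel⟩

theorem regular_T (w : W) : regular (T w) = op w := by
  refine (RingQuot.liftAlgHom_mkAlgHom_apply A _ _ _).trans ?_
  rw [FreeAlgebra.lift_ι_apply]

theorem linearIndependent_T : LinearIndependent A T := by
  let f : H →ₗ[A] (W →₀ A) :=
    (LinearMap.applyₗ (Finsupp.single (1 : W) (1 : A))).comp regular.toLinearMap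
  have hf : f ∘ T = fun w => Finsupp.single w (1 : A) := by
    funext w
    change regular (T w) _ = _
    rw [regular_T, op_single]
  refine LinearIndependent.of_comp f ?_
  rw [hf]
  exact Finsupp.linearIndependent_single_one A W

theorem span_T : ⊤ ≤ Submodule.span A (Set.range T) := by
  have key : ∀ (w : W) (m : H), m ∈ Submodule.span A (Set.range T) →
      T w * m ∈ Submodule.span A (Set.range T) := by
    intro w
    induction w using len_induction with
    | h1 => intro m hm; rwa [T_one, one_mul]
    | h2 i w h ih =>
      intro m hm
      rw [← T_mul_T (by rw [len_s]; omega), mul_assoc]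
      refine Submodule.span_induction (p := fun m _ => T (s i) * m ∈ _) ?_ ?_ ?_ ?_ (ih m hm)
      · rintro _ ⟨x, rfl⟩
        rw [T_s_mul_T]
        have hT : ∀ z, T z ∈ Submodule.span A (Set.range T) :=
          fun z => Submodule.subset_span ⟨z, rfl⟩
        split_ifs
        · exact hT _
        · exact add_mem (Submodule.smul_mem _ _ (hT _)) (Submodule.smul_mem _ _ (hT _))
      · rw [mul_zero]; exact zero_mem _
      · intro a b _ _ ha hb; rw [mul_add]; exact add_mem ha hb
      · intro c a _ ha; rw [mul_smul_comm]; exact Submodule.smul_mem _ _ ha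
  have key2 : ∀ (a : FreeAlgebra A W) (m : H), m ∈ Submodule.span A (Set.range T) →
      mkH a * m ∈ Submodule.span A (Set.range T) := by
    intro a
    induction a using FreeAlgebra.induction with
    | grade0 r =>
      intro m hm
      rw [AlgHom.commutes, ← Algebra.smul_def]
      exact Submodule.smul_mem _ _ hm
    | grade1 w => exact key w
    | mul a b ha hb =>
      intro m hm
      rw [map_mul, mul_assoc]
      exact ha _ (hb m hm)
    | add a b ha hb =>
      intro m hm
      rw [map_add, add_mul]
      exact add_mem (ha m hm) (hb m hm)
  intro x _
  obtain ⟨a, rfl⟩ : ∃ a, mkH a = x := RingQuot.mkAlgHom_surjective A HeckeRel x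
  have := key2 a 1 (Submodule.subset_span ⟨1, T_one⟩)
  rwa [mul_one] at this

/-- The basis `(T_w)` of the Hecke algebra. -/
def basisT : Module.Basis W A H := Module.Basis.mk linearIndependent_T span_T

theorem basisT_apply (w : W) : basisT w = T w := by rw [basisT, Module.Basis.mk_apply]

/-! ### The Kazhdan-Lusztig bases -/

/-- The Kazhdan-Lusztig element `C'_w = q^{-ℓ(w)/2} ∑_{y ≤ w} T_y`; in an infinite dihedral group
all Kazhdan-Lusztig polynomials `P_{y,w}` with `y ≤ w` are equal to `1`. -/
def C' (w : W) : H := ∑ y ∈ lower w, v (-len w) • T y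

/-- The Kazhdan-Lusztig element
`C_w = ∑_{y ≤ w} (-1)^{ℓ(w)-ℓ(y)} q^{(ℓ(w)-ℓ(y))/2} q^{-ℓ(y)/2} T_y`. -/
def C (w : W) : H :=
  ∑ y ∈ lower w, ((-1) ^ (len w - len y) * v ((len w - len y : ℤ) - len y)) • T y

/-- The involution `j (∑ a_w T_w) = ∑ \bar a_w (-1)^{ℓ(w)} q^{-ℓ(w)} T_w` of the Hecke algebra,
where the bar is the ring automorphism `v ↦ v⁻¹`. -/
def j : H →+ H :=
  AddMonoidHom.mk'
    (fun x => (basisT.repr x).sum fun w c =>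
      (LaurentPolynomial.invert c * ((-1) ^ len w * v (-2 * len w))) • T w) (by
    intro x y
    rw [map_add, Finsupp.sum_add_index']
    · intro w; rw [map_zero, zero_mul, zero_smul]
    · intro w c d; rw [map_add, add_mul, add_smul])

theorem j_smul_T (c : A) (w : W) :
    j (c • T w) = (LaurentPolynomial.invert c * ((-1) ^ len w * v (-2 * len w))) • T w := by
  have h : basisT.repr (c • T w) = Finsupp.single w c := by
    rw [← basisT_apply, map_smul, Module.Basis.repr_self, Finsupp.smul_single, smul_eq_mul,
      mul_one]
  change (basisT.repr (c • T w)).sum (fun w c =>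
      (LaurentPolynomial.invert c * ((-1) ^ len w * v (-2 * len w))) • T w) = _
  rw [h, Finsupp.sum_single_index (by rw [map_zero, zero_mul, zero_smul])]

/-- The relation `C'_w = (-1)^{ℓ(w)} j(C_w)` between the two bases. -/
theorem C'_eq (w : W) : C' w = (-1 : A) ^ len w • j (C w) := by
  rw [C, map_sum, Finset.smul_sum, C']
  refine Finset.sum_congr rfl fun y hy => ?_
  have hle : len y ≤ len w := by
    rcases eq_or_len_lt hy with h | h
    · rw [h]
    · exact h.le
  rw [j_smul_T, smul_smul, map_mul, map_pow, map_neg, map_one]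
  congr 1
  obtain ⟨k, hk⟩ := Nat.exists_eq_add_of_le hle
  have e : (LaurentPolynomial.invert (v ((len w - len y : ℤ) - len y)) : A) =
      v (-((len w - len y : ℤ) - len y)) := LaurentPolynomial.invert_T _
  have e2 : v (-(len w : ℤ)) = v (-((len w - len y : ℤ) - len y)) * v (-2 * len y) := by
    rw [v_mul_v]; congr 1; ring
  have e3 : ((-1 : A) ^ len w) * ((-1) ^ (len w - len y) * (-1) ^ len y) = 1 := by
    rw [← pow_add, ← pow_add, show len w + (len w - len y + len y) = 2 * len w by omega, pow_mul]
    simp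
  rw [e, e2]
  linear_combination -(v (-((len w - len y : ℤ) - len y)) * v (-2 * len y)) * e3

/-- A family that is triangular with respect to the length, with invertible diagonal coefficients,
is a basis. -/
theorem triangular (c : W → W → A)
    (hc : ∀ w, IsUnit (c w w)) :
    LinearIndependent A (fun w => ∑ y ∈ lower w, c w y • T y) ∧
      ⊤ ≤ Submodule.span A (Set.range fun w => ∑ y ∈ lower w, c w y • T y) := by
  classical
  constructor
  · rw [linearIndependent_iff]
    intro f hf
    by_contra hne
    obtain ⟨w, hw, hmax⟩ := f.support.exists_max_image len (Finsupp.support_nonempty_iff.2 hne)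
    have h1 := congrArg (fun h => basisT.repr h w) hf
    have h2 : ∀ x, basisT.repr (∑ y ∈ lower x, c x y • T y) w = if w ∈ lower x then c x w else 0 := by
      intro x
      rw [map_sum, Finsupp.finsetSum_apply, ← Finset.sum_ite_eq (lower x) w (c x)]
      refine Finset.sum_congr rfl fun y _ => ?_
      rw [← basisT_apply, map_smul, Module.Basis.repr_self, Finsupp.smul_single, smul_eq_mul,
        mul_one, Finsupp.single_apply]
      by_cases h : y = w
      · subst h; simp
      · rw [if_neg h, if_neg (Ne.symm h)]
    simp only [Finsupp.linearCombination_apply, Finsupp.sum] at h1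
    rw [map_sum, Finsupp.finsetSum_apply, map_zero, Finsupp.zero_apply] at h1
    simp only [map_smul basisT.repr (f _), Finsupp.smul_apply, h2] at h1
    rw [Finset.sum_eq_single_of_mem w hw, if_pos (self_mem_lower w), smul_eq_mul] at h1
    · exact (Finsupp.mem_support_iff.1 hw) ((hc w).mul_left_eq_zero.1 h1)
    · intro x hx hxw
      rw [if_neg, smul_zero]
      intro hm
      rcases eq_or_len_lt hm with h | h
      · exact hxw h.symm
      · exact absurd (hmax x hx) (by omega)
  · have key : ∀ n w, len w < n →
        T w ∈ Submodule.span A (Set.range fun w => ∑ y ∈ lower w, c w y • T y) := by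
      intro n
      induction n with
      | zero => intro w h; omega
      | succ n ih =>
        intro w hw
        have h1 : (∑ y ∈ lower w, c w y • T y) ∈
            Submodule.span A (Set.range fun w => ∑ y ∈ lower w, c w y • T y) :=
          Submodule.subset_span ⟨w, rfl⟩
        rw [← Finset.add_sum_erase _ _ (self_mem_lower w)] at h1
        have h2 : (∑ y ∈ (lower w).erase w, c w y • T y) ∈
            Submodule.span A (Set.range fun w => ∑ y ∈ lower w, c w y • T y) := by
          refine Submodule.sum_mem _ fun y hy => Submodule.smul_mem _ _ (ih y ?_)
          rw [Finset.mem_erase] at hy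
          rcases eq_or_len_lt hy.2 with h | h
          · exact absurd h hy.1
          · omega
        have h3 := (Submodule.add_mem_iff_left _ h2).1 h1
        obtain ⟨u, hu⟩ := hc w
        have h4 := Submodule.smul_mem _ (↑u⁻¹ : A) h3
        rwa [smul_smul, ← hu, Units.inv_mul, one_smul] at h4
    refine span_T.trans (Submodule.span_le.2 ?_)
    rintro _ ⟨w, rfl⟩
    exact key _ w (Nat.lt_succ_self _)

theorem isUnit_v (n : ℤ) : IsUnit (v n) := LaurentPolynomial.isUnit_T n

theorem triangular_C : LinearIndependent A C ∧ ⊤ ≤ Submodule.span A (Set.range C) :=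
  triangular _ fun _ => ((isUnit_one.neg).pow _).mul (isUnit_v _)

/-- The basis `(C_w)` of the Hecke algebra. -/
def basisC : Module.Basis W A H := Module.Basis.mk triangular_C.1 triangular_C.2

theorem basisC_apply (w : W) : basisC w = C w := by rw [basisC, Module.Basis.mk_apply]

/-- The structure constants: `C_x C_y = ∑_z h_{x,y,z} C_z`. -/
def h (x y z : W) : A := basisC.repr (C x * C y) z

/-! ### Lusztig's asymptotic algebra -/

/-- The subring `ℤ[v]` of `ℤ[v, v⁻¹]`. -/
def Aplus : Set A := Set.range (Polynomial.toLaurent (R := ℤ))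

/-- Lusztig's `a`-function: `a(z)` is the smallest integer `n ≥ 0` such that
`(-v)^n h_{x,y,z} ∈ ℤ[v]` for all `x`, `y`. -/
def a (z : W) : ℕ := sInf {n : ℕ | ∀ x y : W, (-v 1) ^ n * h x y z ∈ Aplus}

/-- The integer `γ_{x,y,z}`, the constant term of `(-v)^{a(z)} h_{x,y,z⁻¹}`. -/
def gamma (x y z : W) : ℤ := ((-v 1) ^ a z * h x y z⁻¹).coeff 0

/-- The asymptotic Hecke algebra, as an abelian group: free with basis `(t_w)`. -/
def J : Type := W →₀ ℤ

instance : AddCommGroup J := inferInstanceAs (AddCommGroup (W →₀ ℤ))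

/-- The basis element `t_w`. -/
def t (w : W) : J := (Finsupp.single w 1 : W →₀ ℤ)

/-- The product `t_x t_y = ∑_z γ_{x,y,z} t_{z⁻¹}`; here `u = z⁻¹` runs through the finitely many
elements with `h_{x,y,u} ≠ 0`. -/
def mulBasis (x y : W) : J :=
  ∑ u ∈ (basisC.repr (C x * C y)).support, gamma x y u⁻¹ • t u

instance : Mul J :=
  ⟨fun f g => (f : W →₀ ℤ).sum fun x m => (g : W →₀ ℤ).sum fun y n => (m * n) • mulBasis x y⟩

/-- The distinguished involutions. -/
def distinguished : Finset W := {1, s 0, s 1}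

/-- The unit element is the sum of the `t_d` over the distinguished involutions `d`. -/
instance : One J := ⟨∑ d ∈ distinguished, t d⟩

/-! ### The completions and the map `φ ∘ j` -/

/-- The coefficient of `t_z` in
`φ(C_x) = ∑_{z, d ∈ 𝒟, a(d) = a(z)} h_{x,d,z} t_z`. -/
def phiCoeff (x z : W) : A := ∑ d ∈ distinguished with a d = a z, h x d z

/-- Laurent polynomials as Laurent series. -/
def toSeries (p : A) : LaurentSeries ℤ := HahnSeries.ofFinsupp p.coeff

/-- A family `b` of Laurent series over `ℤ` belongs to the completion if `b_x → 0` as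
`ℓ(x) → ∞`. The series are in the variable `q^{-1/2}` when `b` stands for the element
`∑ b_x C'_x` of the completed Hecke algebra, and in the variable `q^{1/2}` when it stands for
`∑ b_x C_x`. -/
def IsCompleted (b : W → LaurentSeries ℤ) : Prop :=
  ∀ N : ℤ, ∃ n : ℕ, ∀ x, n ≤ len x → ∀ k < N, (b x).coeff k = 0

/-- The relation `(φ ∘ j)(∑_x b_x C'_x) = ∑_z c_z t_z`. Here `j` takes `∑ b_x C'_x`, with
coefficients in `ℤ((q^{-1/2}))`, to `∑ (-1)^{ℓ(x)} \bar b_x C_x`, with coefficients in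
`ℤ((q^{1/2}))`, and the bar only renames the variable; the series
`c_z = ∑_x (-1)^{ℓ(x)} \bar b_x φ(C_x)_z` is required to converge in the Krull topology of
`ℤ((q^{1/2}))`. -/
def IsPhiJ (b c : W → LaurentSeries ℤ) : Prop :=
  ∀ (z : W) (N : ℤ), ∃ S₀ : Finset W, ∀ S : Finset W, S₀ ⊆ S → ∀ k < N,
    (∑ x ∈ S, (-1) ^ len x * b x * toSeries (phiCoeff x z)).coeff k = (c z).coeff k

/-! ### The `p`-adic group and the plane -/

section Local

open ValuativeRel

variable (F : Type*) [Field F] [ValuativeRel F]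

/-- The group `SL₂(F)`. -/
abbrev SL2 (F : Type*) [Field F] : Type _ := Matrix.SpecialLinearGroup (Fin 2) F

/-- The Iwahori subgroup: the matrices in `SL₂(𝒪)` that are upper triangular modulo the maximal
ideal. -/
def iwahori : Subgroup (SL2 F) where
  carrier := {g | (∀ i j, valuation F (g.1 i j) ≤ 1) ∧ valuation F (g.1 1 0) < 1}
  one_mem' := by
    refine ⟨fun i j => ?_, ?_⟩
    · fin_cases i <;> fin_cases j <;> simp
    · simp
  mul_mem' := by
    rintro g k ⟨hg, hg'⟩ ⟨hk, hk'⟩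
    refine ⟨fun i j => ?_, ?_⟩
    · rw [Matrix.SpecialLinearGroup.coe_mul, Matrix.mul_apply, Fin.sum_univ_two]
      refine (valuation F).map_add_le ?_ ?_ <;> rw [map_mul] <;>
        exact mul_le_one' (hg _ _) (hk _ _)
    · rw [Matrix.SpecialLinearGroup.coe_mul, Matrix.mul_apply, Fin.sum_univ_two]
      refine (valuation F).map_add_lt ?_ ?_ <;> rw [map_mul]
      · exact mul_lt_one_of_nonneg_of_lt_one_left zero_le hg' (hk _ _)
      · exact mul_lt_one_of_nonneg_of_lt_one_right (hg _ _) zero_le hk'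
  inv_mem' := by
    rintro g ⟨hg, hg'⟩
    refine ⟨fun i j => ?_, ?_⟩
    · rw [Matrix.SpecialLinearGroup.SL2_inv_expl]
      fin_cases i <;> fin_cases j <;> simp [hg]
    · rw [Matrix.SpecialLinearGroup.SL2_inv_expl]
      simpa using hg'

variable {F}

/-- `ϖ` is a uniformizer. -/
def IsUniformizer (ϖ : Fˣ) : Prop := ∃ p : 𝒪[F], Irreducible p ∧ (p : F) = ϖ

/-- The matrix `diag(ϖ^n, ϖ^{-n})`. -/
def translation (ϖ : Fˣ) (n : ℤ) : SL2 F :=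
  ⟨!![((ϖ ^ n : Fˣ) : F), 0; 0, ((ϖ ^ (-n) : Fˣ) : F)], by
    rw [Matrix.det_fin_two_of, ← Units.val_mul, ← zpow_add, add_neg_cancel]; simp⟩

/-- The matrix with rows `(0, -ϖ^{-n})` and `(ϖ^n, 0)`. -/
def reflection (ϖ : Fˣ) (n : ℤ) : SL2 F :=
  ⟨!![0, -((ϖ ^ (-n) : Fˣ) : F); ((ϖ ^ n : Fˣ) : F), 0], by
    rw [Matrix.det_fin_two_of, neg_mul, ← Units.val_mul, ← zpow_add, neg_add_cancel]; simp⟩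

/-- Representatives in `SL₂(F)` of the elements of the affine Weyl group, for a uniformizer `ϖ`. -/
def rep (ϖ : Fˣ) : W → SL2 F
  | .r n => translation ϖ n
  | .sr n => reflection ϖ n

open Classical in
/-- `T_w` as a function on `SL₂(F)`: the characteristic function of `I w I`. -/
def charFun (ϖ : Fˣ) (w : W) (g : SL2 F) : ℂ :=
  if g ∈ DoubleCoset.doubleCoset (rep ϖ w) (iwahori F) (iwahori F) then 1 else 0

variable (F) [TopologicalSpace F] [IsNonarchimedeanLocalField F]

/-- The positive square root of the cardinality of the residue field. -/
def sqrtq : ℂˣ :=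
  Units.mk0 ((Real.sqrt (Nat.card 𝓀[F]) : ℝ) : ℂ) (by
    have : 0 < Nat.card 𝓀[F] := Nat.card_pos
    exact_mod_cast (Real.sqrt_pos.2 (by exact_mod_cast this)).ne')

variable {F}

/-- The function on `I \ SL₂(F) / I` that corresponds to an element of the Hecke algebra, `v`
being specialized to the square root of the cardinality of the residue field. -/
def heckeFun (ϖ : Fˣ) (x : H) (g : SL2 F) : ℂ :=
  (basisT.repr x).sum fun w c =>
    LaurentPolynomial.eval₂ (Int.castRingHom ℂ) (sqrtq F) c * charFun ϖ w g

variable (F)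

/-- The `k`-th term of a Laurent series in `q^{-1/2}`, evaluated at the cardinality of the
residue field. -/
def valueTerm (f : LaurentSeries ℤ) (k : ℤ) : ℂ := (f.coeff k : ℂ) * ((sqrtq F : ℂ)⁻¹) ^ k

variable {F}

/-- The `x`-th term of the function on `SL₂(F)` that corresponds to an element `∑ b_x C'_x` of the
completed Hecke algebra. -/
def functionTerm (ϖ : Fˣ) (b : W → LaurentSeries ℤ) (g : SL2 F) (x : W) : ℂ :=
  (∑' k : ℤ, valueTerm F (b x) k) * heckeFun ϖ (C' x) g

variable (F)

/-- The space `C_c^∞(F²)^I` of locally constant functions with compact support on the plane that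
are invariant under the Iwahori subgroup. A function in it is determined by its restriction to
`F² ∖ {0} = G/N`. -/
def schwartz : Submodule ℂ ((Fin 2 → F) → ℂ) where
  carrier := {f | IsLocallyConstant f ∧ HasCompactSupport f ∧
    ∀ g ∈ iwahori F, ∀ x, f ((g⁻¹).1.mulVec x) = f x}
  zero_mem' := ⟨IsLocallyConstant.const 0, HasCompactSupport.zero, fun _ _ _ => rfl⟩
  add_mem' := by
    rintro f f' ⟨h1, h2, h3⟩ ⟨h1', h2', h3'⟩
    exact ⟨h1.add h1', h2.add h2', fun g hg x => congrArg₂ (· + ·) (h3 g hg x) (h3' g hg x)⟩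
  smul_mem' := by
    rintro c f ⟨h1, h2, h3⟩
    exact ⟨h1.comp (c • ·), h2.comp_left (g := (c • ·)) (smul_zero c),
      fun g hg x => congrArg (c • ·) (h3 g hg x)⟩

end Local

end AffineSL2

end

/-! The affine Weyl group is infinite dihedral: a nontrivial element is an alternating word, fixed
by its first letter `i` and its length `n`, namely `e i n`. Everything shorter than `w` lies below
`w`, so the Kazhdan-Lusztig elements are sums over balls. If `C (e i m)`, `m > 0`, is continued to
an odd family `c_{i,m}` with `m ∈ ℤ` (`anti`), then `C_{s_i} c_{i,m} = -(q^{1/2} + q^{-1/2})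
c_{i,m}` and `C_{s_i} c_{i+1,m} = c_{i,m+1} + c_{i,m-1}` (`KLop_anti_self`, `KLop_anti_succ`). The
second rule is that of tensoring with the two-dimensional representation of `SL₂`, so products are
Clebsch-Gordan sums `cg`, with an extra factor `kappa` when the two letters that meet are equal. It
follows that `a = 1` away from the identity and that `t_x t_y` (`x, y ≠ 1`) is a Clebsch-Gordan sum
if the letters that meet agree and `0` otherwise.

The matrix of `φ ∘ j` is tridiagonal on the words with a given first letter (`isPhiJ_iff`).
Inverting it means solving a three-term recursion with characteristic roots `q^{1/2}` and
`q^{-1/2}`. The completion admits only the decaying solution, whence uniqueness; a Green function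
(`green`) gives existence, and its entries are Laurent polynomials (`tau`).

On the geometric side, the Iwahori orbits of nonzero vectors are the differences `L_k ∖ L_{k+1}` of
a chain of lattices indexed by `ℤ`. Invariant functions thus become sequences that vanish near `-∞`
and are constant near `∞` (`profileEquiv`). Counting cosets shows how `T_{s_i}` acts on sequences
(`IsUniformizer.sum_residue`), and then `C'_{e i n}` acts by `pairProj i ∘ cheb n ∘ pairSum`, where
`cheb n` is a Chebyshev polynomial in the operator `spread` (`anti_KL_orbitSeq`). Now `pairSum =
(spread + x + x⁻¹) ∘ altSum` with `x = q^{-1/2}` and `altSum` the inverse of `1 + shift`. Summation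
by parts against the recursion of `tau` removes the first factor: `t_{e i n}`, `n > 0`, acts by
`(-1)^(n+1) pairProj i ∘ cheb n ∘ altSum`, and `t_1` acts by `0` (`hasSum_tau_mul`).

The space is preserved because `altSum` of an eventually constant sequence has eventual period `2`
and `pairProj i` reads only one parity. Multiplicativity holds because `altSum ∘ pairProj i` is the
restriction to one parity and the Chebyshev polynomials obey the Clebsch-Gordan rule
(`act_mulBasis`). For convergence, `tau` decays like `q^{-ℓ/2}` while the `C'_y` grow only linearly
at a given vector; as the `C'_y` are nonnegative functions, the double series over `y` and over
cosets converges absolutely (`IsUniformizer.summable_prod`) and its order may be exchanged. -/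

noncomputable section

namespace AffineSL2

section

/-! ### Alternating words -/

/-- The element with the alternating reduced expression of length `n` and first letter `i`. -/
def e (i : Fin 2) (n : ℕ) : W := ((alt i n).map s).prod

theorem fin_two_add_one_add_one (i : Fin 2) : i + 1 + 1 = i := by
  fin_cases i <;> rfl

theorem fin_two_add_one_ne (i : Fin 2) : i + 1 ≠ i := by
  fin_cases i <;> decide

theorem fin_two_eq_or (i k : Fin 2) : k = i ∨ k = i + 1 := by
  fin_cases i <;> fin_cases k <;> decide

theorem e_zero (i : Fin 2) : e i 0 = 1 := rfl

theorem e_succ (i : Fin 2) (n : ℕ) : e i (n + 1) = s i * e (i + 1) n := by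
  simp [e, alt]

theorem e_one (i : Fin 2) : e i 1 = s i := by rw [e_succ, e_zero, mul_one]

theorem s_mul_e_succ (i : Fin 2) (n : ℕ) : s i * e i (n + 1) = e (i + 1) n := by
  rw [e_succ, s_mul_cancel]

theorem len_start_e (i : Fin 2) (n : ℕ) : len (e i n) = n ∧ (n ≠ 0 → start (e i n) = i) := by
  induction n generalizing i with
  | zero => exact ⟨rfl, fun h => absurd rfl h⟩
  | succ n ih =>
    obtain ⟨h1, h2⟩ := ih (i + 1)
    rw [e_succ]
    rcases len_s_mul i (e (i + 1) n) with ⟨h, h'⟩ | ⟨h, -, h'⟩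
    · rw [h1] at h
      rw [h2 (by omega)] at h'
      exact absurd h'.symm (fin_two_add_one_ne i)
    · exact ⟨by rw [h, h1], fun _ => h'⟩

theorem len_e (i : Fin 2) (n : ℕ) : len (e i n) = n := (len_start_e i n).1

theorem start_e (i : Fin 2) {n : ℕ} (hn : n ≠ 0) : start (e i n) = i := (len_start_e i n).2 hn

theorem e_start_len (w : W) : e (start w) (len w) = w := prod_word w

theorem e_inj {i k : Fin 2} {n m : ℕ} : e i n = e k m ↔ n = m ∧ (n = 0 ∨ i = k) := by
  constructor
  · intro h
    have h1 : n = m := by rw [← len_e i n, h, len_e]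
    refine ⟨h1, ?_⟩
    by_cases hn : n = 0
    · exact Or.inl hn
    · right; rw [← start_e i hn, h, start_e k (h1 ▸ hn)]
  · rintro ⟨rfl, rfl | rfl⟩
    · rfl
    · rfl

theorem e_ne_one {i : Fin 2} {n : ℕ} (hn : n ≠ 0) : e i n ≠ 1 := by
  rw [← e_zero i, Ne, e_inj]; omega

theorem eq_one_or_eq_e (w : W) : w = 1 ∨ ∃ i n, w = e i (n + 1) := by
  by_cases h : len w = 0
  · exact Or.inl (len_eq_zero h)
  · right
    refine ⟨start w, len w - 1, ?_⟩
    rw [Nat.sub_add_cancel (Nat.one_le_iff_ne_zero.2 h), e_start_len]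

theorem s_ne_one (i : Fin 2) : s i ≠ 1 := by
  rw [← e_one]; exact e_ne_one one_ne_zero

theorem s_inj {i k : Fin 2} : s i = s k ↔ i = k := by
  rw [← e_one, ← e_one, e_inj]; simp

theorem alt_sublist_alt (i : Fin 2) {k n : ℕ} (h : k ≤ n) : (alt i k).Sublist (alt i n) := by
  induction n generalizing i k with
  | zero => rw [Nat.le_zero.1 h]
  | succ n ih =>
    cases k with
    | zero => exact List.nil_sublist _
    | succ k => exact (ih (i + 1) (by omega)).cons_cons i

/-- A shorter alternating word is a prefix of the longer one, or a prefix of what remains after its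
first letter is deleted. The Bruhat order of this group therefore only compares lengths. -/
theorem mem_lower_iff {y w : W} : y ∈ lower w ↔ y = w ∨ len y < len w := by
  refine ⟨eq_or_len_lt, ?_⟩
  rintro (rfl | h)
  · exact self_mem_lower _
  · rw [mem_lower]
    refine ⟨word y, ?_, prod_word y⟩
    rw [word, word]
    rcases fin_two_eq_or (start w) (start y) with h' | h'
    · rw [h']; exact alt_sublist_alt _ h.le
    · obtain ⟨n, hn⟩ : ∃ n, len w = n + 1 := ⟨len w - 1, by omega⟩
      rw [h', hn, alt]
      exact (alt_sublist_alt _ (by omega)).cons _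

/-- The family indexed by `ℤ` that continues `n ↦ X (e i n)`, `n > 0`, antisymmetrically. -/
def anti {M : Type*} [AddCommGroup M] (X : W → M) (i : Fin 2) (m : ℤ) : M :=
  m.sign • X (e i m.natAbs)

section Anti

variable {M : Type*} [AddCommGroup M] (X : W → M) (i : Fin 2)

theorem anti_zero : anti X i 0 = 0 := by simp [anti]

theorem anti_natCast_succ (n : ℕ) : anti X i ((n : ℤ) + 1) = X (e i (n + 1)) := by
  have h1 : ((n : ℤ) + 1).sign = 1 := Int.sign_eq_one_of_pos (by omega)
  have h2 : ((n : ℤ) + 1).natAbs = n + 1 := by omega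
  rw [anti, h1, h2, one_smul]

theorem anti_one : anti X i 1 = X (s i) := by
  have := anti_natCast_succ X i 0
  rwa [Nat.cast_zero, zero_add, zero_add, e_one] at this

theorem anti_neg (m : ℤ) : anti X i (-m) = -anti X i m := by
  rw [anti, anti, Int.sign_neg, Int.natAbs_neg, neg_smul]

theorem map_anti {N G : Type*} [AddCommGroup N] [FunLike G M N] [AddMonoidHomClass G M N] (f : G)
    (m : ℤ) : f (anti X i m) = anti (f ∘ X) i m := by
  rw [anti, map_zsmul]; rfl

/-- An identity between antisymmetric families needs to be checked only for positive indices. -/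
theorem int_antisymm_induction {P : ℤ → Prop} (h0 : P 0) (h1 : ∀ n : ℕ, P (n + 1))
    (h2 : ∀ n : ℤ, P n → P (-n)) (m : ℤ) : P m := by
  have h3 : ∀ n : ℕ, P n := by
    rintro (_ | n)
    · exact h0
    · exact_mod_cast h1 n
  obtain ⟨n, rfl | rfl⟩ := Int.eq_nat_or_neg m
  · exact h3 n
  · exact h2 _ (h3 n)

end Anti

/-! ### Kazhdan-Lusztig elements over a general ring -/

section KL

variable {R : Type*} [CommRing R] (x : Rˣ) {M : Type*} [AddCommGroup M] [Module R M]
  (X : W → M) (L : Fin 2 → M →ₗ[R] M)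

/-- The family `X` is permuted by the operators `L i` as the standard basis of a Hecke algebra with
parameter `x⁻²` is by the multiplication by the generators. -/
def IsHeckeFamily : Prop :=
  ∀ i w, L i (X w) = if len w < len (s i * w) then X (s i * w)
    else (((x⁻¹ : Rˣ) : R) ^ 2 - 1) • X w + ((x⁻¹ : Rˣ) : R) ^ 2 • X (s i * w)

/-- The Kazhdan-Lusztig family that belongs to a family `X`. -/
def KL (w : W) : M := (x : R) ^ len w • ∑ y ∈ lower w, X y

/-- The operator by which the Kazhdan-Lusztig element of a simple reflection acts. -/
def KLop (i : Fin 2) : M →ₗ[R] M := (x : R) • (1 + L i)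

variable {x X L}

theorem sum_lower_one : ∑ y ∈ lower 1, X y = X 1 := by
  have : lower 1 = {1} := by
    ext y
    simp [mem_lower_iff, len_one]
  rw [this, Finset.sum_singleton]

/-- The sum of `X y` over all `y` with `len y < n`. -/
def ballSum (X : W → M) : ℕ → M
  | 0 => 0
  | 1 => X 1
  | n + 2 => ballSum X (n + 1) + X (e 0 (n + 1)) + X (e 1 (n + 1))

theorem ballSum_succ (i : Fin 2) (n : ℕ) :
    ballSum X (n + 2) = ballSum X (n + 1) + X (e i (n + 1)) + X (e (i + 1) (n + 1)) := by
  fin_cases i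
  · rfl
  · exact add_right_comm _ _ _

/-- All elements of length less than `n` lie below `e i n`, so the interval depends on `i` only
through its top element. Differences of neighbouring intervals then consist of very few terms. -/
theorem sum_lower_e (i : Fin 2) (n : ℕ) :
    ∑ y ∈ lower (e i n), X y = ballSum X n + X (e i n) := by
  induction n generalizing i with
  | zero => rw [e_zero, sum_lower_one, ballSum, zero_add]
  | succ n ih =>
    rcases Nat.eq_zero_or_pos n with rfl | hn
    · have : lower (e i (0 + 1)) = {e i 1, 1} := by
        ext y
        rw [mem_lower_iff, len_e, Finset.mem_insert, Finset.mem_singleton, Nat.lt_one_iff]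
        refine or_congr_right ⟨len_eq_zero, ?_⟩
        rintro rfl; rfl
      rw [this, Finset.sum_pair (e_ne_one one_ne_zero), ballSum, add_comm, zero_add]
    · obtain ⟨n, rfl⟩ := Nat.exists_eq_succ_of_ne_zero hn.ne'
      have : lower (e i (n + 1 + 1)) = insert (e i (n + 1 + 1)) (insert (e (i + 1) (n + 1))
          (lower (e i (n + 1)))) := by
        ext y
        rw [mem_lower_iff, len_e, Finset.mem_insert, Finset.mem_insert, mem_lower_iff, len_e]
        refine or_congr_right ⟨fun h => ?_, ?_⟩
        · rcases Nat.lt_succ_iff_lt_or_eq.1 h with h' | h'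
          · exact Or.inr (Or.inr h')
          · rw [← e_start_len y, h', e_inj, e_inj]
            rcases fin_two_eq_or i (start y) with h2 | h2 <;> rw [h2] <;> simp
        · rintro (h | h | h)
          · rw [h, len_e]; omega
          · rw [h, len_e]; omega
          · omega
      rw [this, Finset.sum_insert, Finset.sum_insert, ih, Nat.succ_eq_add_one, ballSum_succ i]
      · abel
      · simp [mem_lower_iff, e_inj, len_e]
      · simp [mem_lower_iff, e_inj, len_e]

theorem IsHeckeFamily.up (h : IsHeckeFamily x X L) (i : Fin 2) (n : ℕ) :
    L i (X (e (i + 1) n)) = X (e i (n + 1)) := by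
  rw [h, ← e_succ, if_pos]
  rw [len_e, len_e]; omega

theorem IsHeckeFamily.down (h : IsHeckeFamily x X L) (i : Fin 2) (n : ℕ) :
    L i (X (e i (n + 1))) = (((x⁻¹ : Rˣ) : R) ^ 2 - 1) • X (e i (n + 1)) +
      ((x⁻¹ : Rˣ) : R) ^ 2 • X (e (i + 1) n) := by
  rw [h, s_mul_e_succ, if_neg]
  rw [len_e, len_e]; omega

/-- `L i` preserves the span of the pair `y`, `s i * y`, and the sum of the two is an eigenvector,
as in the trivial character of a rank-one Hecke algebra. -/
theorem IsHeckeFamily.self_add (h : IsHeckeFamily x X L) (i : Fin 2) (n : ℕ) :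
    (1 + L i) (X (e (i + 1) n) + X (e i (n + 1))) =
      (1 + ((x⁻¹ : Rˣ) : R) ^ 2) • (X (e (i + 1) n) + X (e i (n + 1))) := by
  rw [LinearMap.add_apply, Module.End.one_apply, map_add, h.up, h.down]
  module

/-- The interval below a word that starts with `i` is a disjoint union of pairs `y`, `s i * y`, to
each of which `self_add` applies. -/
theorem IsHeckeFamily.sum_lower (h : IsHeckeFamily x X L) (i : Fin 2) (n : ℕ) :
    (1 + L i) (∑ y ∈ lower (e i (n + 1)), X y) =
      (1 + ((x⁻¹ : Rˣ) : R) ^ 2) • ∑ y ∈ lower (e i (n + 1)), X y := by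
  induction n with
  | zero =>
    have := h.self_add i 0
    rwa [e_zero, add_comm (X 1), zero_add, show X 1 = ballSum X 1 from rfl, add_comm (X _),
      ← sum_lower_e] at this
  | succ n ih =>
    have : ∑ y ∈ lower (e i (n + 1 + 1)), X y = ∑ y ∈ lower (e i (n + 1)), X y +
        (X (e (i + 1) (n + 1)) + X (e i (n + 1 + 1))) := by
      rw [sum_lower_e, sum_lower_e, ballSum_succ i]; abel
    rw [this, map_add, ih, h.self_add, smul_add _ (∑ y ∈ lower _, X y)]

theorem KLop_apply (i : Fin 2) (m : M) : KLop x L i m = (x : R) • (m + L i m) := rfl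

theorem KLop_apply' (i : Fin 2) (m : M) : KLop x L i m = (x : R) • (1 + L i) m := rfl

theorem KLop_KL_one (h : IsHeckeFamily x X L) (i : Fin 2) :
    KLop x L i (KL x X 1) = KL x X (s i) := by
  have h1 := h.up i 0
  rw [e_zero, zero_add, e_one] at h1
  rw [KLop_apply, KL, KL, sum_lower_one, len_one, pow_zero, one_smul, h1, len_s, pow_one,
    ← e_one, sum_lower_e]
  rfl

theorem KLop_anti_self (h : IsHeckeFamily x X L) (i : Fin 2) (m : ℤ) :
    KLop x L i (anti (KL x X) i m) = ((x : R) + ((x⁻¹ : Rˣ) : R)) • anti (KL x X) i m := by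
  induction m using int_antisymm_induction with
  | h0 => rw [anti_zero, map_zero, smul_zero]
  | h2 n ih => rw [anti_neg, map_neg, ih, smul_neg]
  | h1 n =>
    have h1 := h.sum_lower i n
    rw [LinearMap.add_apply, Module.End.one_apply] at h1
    rw [anti_natCast_succ, KL, map_smul, KLop_apply, h1, len_e]
    simp only [smul_smul]
    congr 1
    have : (x : R) * ((x⁻¹ : Rˣ) : R) = 1 := x.mul_inv
    linear_combination (x : R) ^ (n + 1) * ((x⁻¹ : Rˣ) : R) * this

/-- The odd continuation vanishes at `0`, so the rule needs no exception at `m = 1`, where only the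
longer word occurs; for `m ≤ 0` it follows by oddness. -/
theorem KLop_anti_succ (h : IsHeckeFamily x X L) (i : Fin 2) (m : ℤ) :
    KLop x L i (anti (KL x X) (i + 1) m) =
      anti (KL x X) i (m + 1) + anti (KL x X) i (m - 1) := by
  induction m using int_antisymm_induction with
  | h0 => rw [anti_zero, map_zero, zero_add, zero_sub, anti_neg, add_neg_cancel]
  | h2 n ih =>
    rw [anti_neg, map_neg, ih, show -n + 1 = -(n - 1) by ring, show -n - 1 = -(n + 1) by ring,
      anti_neg, anti_neg]
    abel
  | h1 n =>
    have key : (1 + L i) (∑ y ∈ lower (e (i + 1) (n + 1)), X y) =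
        ∑ y ∈ lower (e i (n + 2)), X y + ((x⁻¹ : Rˣ) : R) ^ 2 •
          (∑ y ∈ lower (e i (n + 1)), X y - (X (e (i + 1) n) + X (e i (n + 1)))) := by
      -- This interval is an eigenvector of `1 + L i`, the interval below `e i (n + 1)`, with its
      -- top element exchanged.
      have h1 : ∑ y ∈ lower (e (i + 1) (n + 1)), X y = ∑ y ∈ lower (e i (n + 1)), X y +
          X (e (i + 1) (n + 1)) - X (e i (n + 1)) := by
        rw [sum_lower_e, sum_lower_e]; abel
      have h2 : ∑ y ∈ lower (e i (n + 2)), X y = ∑ y ∈ lower (e i (n + 1)), X y +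
          (X (e (i + 1) (n + 1)) + X (e i (n + 2))) := by
        rw [sum_lower_e, sum_lower_e, ballSum_succ i]; abel
      rw [h1, map_sub, map_add, h.sum_lower, h2]
      simp only [LinearMap.add_apply, Module.End.one_apply]
      rw [h.up, h.down]
      module
    have hx : (x : R) * ((x⁻¹ : Rˣ) : R) = 1 := x.mul_inv
    rw [anti_natCast_succ, KL, map_smul, KLop_apply', key, len_e, add_sub_cancel_right,
      show (n : ℤ) + 1 + 1 = ((n + 1 : ℕ) : ℤ) + 1 by push_cast; ring, anti_natCast_succ, KL, len_e]
    -- For `n = 0` the bracket in `key` is zero, in agreement with the value of the odd family at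
    -- `0`.
    cases n with
    | zero =>
      rw [sum_lower_e i (0 + 1), e_zero, Nat.cast_zero, anti_zero]
      simp only [ballSum, zero_add, sub_self, smul_zero, add_zero, smul_smul]
      congr 1
      ring
    | succ n =>
      have h3 : ∑ y ∈ lower (e i (n + 1 + 1)), X y - (X (e (i + 1) (n + 1)) + X (e i (n + 1 + 1))) =
          ∑ y ∈ lower (e i (n + 1)), X y := by
        rw [sum_lower_e, sum_lower_e, ballSum_succ i]; abel
      rw [h3, Nat.cast_succ, anti_natCast_succ, KL, len_e]
      simp only [smul_add, smul_smul]
      congr 2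
      · ring
      · linear_combination (x : R) ^ (n + 1) * ((x : R) * ((x⁻¹ : Rˣ) : R) + 1) * hx

end KL

/-! ### Three-term recursions -/

/-- A solution of a three-term recursion is determined by its first two terms. -/
theorem recursion_unique {M : Type*} [AddCommGroup M] (R : M → M) {z z' : ℕ → M}
    (h0 : z 0 = z' 0) (h1 : z 1 = z' 1) (hz : ∀ n, z (n + 2) = R (z (n + 1)) - z n)
    (hz' : ∀ n, z' (n + 2) = R (z' (n + 1)) - z' n) (n : ℕ) : z n = z' n := by
  induction n using Nat.twoStepInduction with
  | zero => exact h0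
  | one => exact h1
  | more n ih1 ih2 => rw [hz, hz', ih1, ih2]

/-- The Clebsch-Gordan sum. -/
def cg {M : Type*} [AddCommMonoid M] (c : ℤ → M) (n : ℕ) (m : ℤ) : M :=
  ∑ k ∈ Finset.range n, c (m + n - 1 - 2 * k)

/-- Applying `R` to `n + 1` terms shifts each of them up and down by one. The upward shifts and the
lowest downward shift make up the sum of `n + 2` terms; the other downward shifts make up the sum of
`n` terms. -/
theorem cg_recursion {M : Type*} [AddCommGroup M] (R : M →+ M) (c : ℤ → M)
    (hc : ∀ m, R (c m) = c (m + 1) + c (m - 1)) (n : ℕ) (m : ℤ) :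
    cg c (n + 2) m = R (cg c (n + 1) m) - cg c n m := by
  unfold cg
  rw [map_sum, Finset.sum_range_succ]
  simp only [hc, Finset.sum_add_distrib]
  rw [Finset.sum_range_succ (fun k : ℕ => c (m + ((n + 1 : ℕ) : ℤ) - 1 - 2 * k - 1))]
  have h1 : ∀ k : ℕ, m + ((n + 2 : ℕ) : ℤ) - 1 - 2 * k = m + ((n + 1 : ℕ) : ℤ) - 1 - 2 * k + 1 := by
    intro k; push_cast; ring
  have h2 : ∀ k : ℕ, m + ((n + 1 : ℕ) : ℤ) - 1 - 2 * k - 1 = m + n - 1 - 2 * k := by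
    intro k; push_cast; ring
  simp only [h1, h2]
  rw [show m + ((n + 1 : ℕ) : ℤ) - 1 - 2 * ((n + 1 : ℕ) : ℤ) + 1 = m + n - 1 - 2 * n by
    push_cast; ring]
  abel

theorem cg_zero {M : Type*} [AddCommMonoid M] (c : ℤ → M) (m : ℤ) : cg c 0 m = 0 := rfl

theorem cg_one {M : Type*} [AddCommMonoid M] (c : ℤ → M) (m : ℤ) : cg c 1 m = c m := by
  simp [cg]

/-- The solution of a three-term recursion, in terms of an eigenfamily. -/
theorem recursion_eq_cg {M : Type*} [AddCommGroup M] (R : M →+ M) (c : ℤ → M)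
    (hc : ∀ m, R (c m) = c (m + 1) + c (m - 1)) (m : ℤ) {z : ℕ → M} (h0 : z 0 = 0)
    (h1 : z 1 = c m) (hz : ∀ n, z (n + 2) = R (z (n + 1)) - z n) (n : ℕ) : z n = cg c n m :=
  recursion_unique (z' := fun n => cg c n m) R (by rw [h0, cg_zero]) (by rw [h1, cg_one]) hz
    (fun n => cg_recursion R c hc n m) n

theorem map_cg {M N G : Type*} [AddCommMonoid M] [AddCommMonoid N] [FunLike G M N]
    [AddMonoidHomClass G M N] (f : G) (c : ℤ → M) (n : ℕ) (m : ℤ) :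
    f (cg c n m) = cg (fun k => f (c k)) n m := map_sum f _ _

end

section

/-! ### Multiplication of Kazhdan-Lusztig elements -/

/-- The unit `-v`. -/
def negV : Aˣ where
  val := -v 1
  inv := -v (-1)
  val_inv := by rw [neg_mul_neg, v_mul_v]; exact v_zero
  inv_val := by rw [neg_mul_neg, v_mul_v]; exact v_zero

/-- The eigenvalue `-(v + v⁻¹)`. -/
def kappa : A := -(v 1 + v (-1))

theorem negV_add : (negV : A) + ((negV⁻¹ : Aˣ) : A) = kappa := by
  change -v 1 + -v (-1) = _
  rw [kappa]; ring

theorem v_pow (m : ℤ) (n : ℕ) : v m ^ n = v (m * n) := by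
  rw [v, LaurentPolynomial.T_pow, v, mul_comm]

/-- The renormalized standard basis. -/
def signedT (w : W) : H := ((-1) ^ len w * v (-2 * len w) : A) • T w

/-- The multiplication by the renormalized generators. -/
def signedL (i : Fin 2) : H →ₗ[A] H := LinearMap.mulLeft A (-v (-2) • T (s i))

/-- The elements `-q⁻¹ T_s` satisfy the quadratic relation with parameter `q⁻¹`. After this
rescaling the `C_w` are formed as the `C'_w` are (`KL_signedT`), so the computation over a general
ring serves both bases. -/
theorem isHeckeFamily_signedT : IsHeckeFamily negV signedT signedL := by
  intro i w
  have h2 : (((negV⁻¹ : Aˣ) : A)) ^ 2 = v (-2) := by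
    change (-v (-1)) ^ 2 = _
    rw [neg_sq, v_pow]; rfl
  rw [h2, signedL, LinearMap.mulLeft_apply, signedT, smul_mul_smul_comm, T_s_mul_T]
  rcases len_s_mul i w with ⟨h, -⟩ | ⟨h, -⟩
  · rw [if_neg (by omega), if_neg (by omega), signedT, ← h]
    simp only [smul_add, smul_smul]
    congr 2
    · rw [q]
      have : v (-2) * v 2 = 1 := by rw [v_mul_v]; exact v_zero
      linear_combination (-(-1) ^ (len (s i * w) + 1) * v (-2 * ((len (s i * w) + 1 : ℕ) : ℤ))) * this
    · rw [q]
      have : v (-2) * v 2 = 1 := by rw [v_mul_v]; exact v_zero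
      have h3 : v (-2 * ((len (s i * w) + 1 : ℕ) : ℤ)) = v (-2 * len (s i * w)) * v (-2) := by
        rw [v_mul_v]; congr 1; push_cast; ring
      rw [h3]
      linear_combination ((-1) ^ (len (s i * w)) * v (-2 * len (s i * w)) * v (-2)) * this
  · rw [if_pos (by omega), if_pos (by omega), signedT, h]
    congr 1
    have h3 : v (-2 * ((len w + 1 : ℕ) : ℤ)) = v (-2 * len w) * v (-2) := by
        rw [v_mul_v]; congr 1; push_cast; ring
    rw [h3]; ring

theorem KL_signedT : KL negV signedT = C := by
  funext w
  rw [KL, C, Finset.smul_sum]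
  refine Finset.sum_congr rfl fun y hy => ?_
  have hle : len y ≤ len w := by
    rcases eq_or_len_lt hy with h | h
    · rw [h]
    · exact h.le
  obtain ⟨k, hk⟩ := Nat.exists_eq_add_of_le hle
  rw [signedT, smul_smul]
  congr 1
  change (-v 1) ^ _ * _ = _
  have h1 : v ((len w - len y : ℤ) - len y) = v (len w) * v (-2 * len y) := by
    rw [v_mul_v]; congr 1; ring
  have h2 : v 1 ^ len w = v (len w) := by rw [v_pow, one_mul]
  have h3 : ((-1 : A)) ^ len w * (-1) ^ len y = (-1) ^ (len w - len y) := by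
    rw [← pow_add, show len w + len y = len w - len y + 2 * len y by omega, pow_add, pow_mul]
    simp
  rw [h1, neg_pow, h2, ← h3]
  ring

theorem C_one : C 1 = 1 := by
  rw [← KL_signedT, KL, sum_lower_one, len_one, pow_zero, one_smul, signedT, T_one, len_one]
  simp [v_zero]

theorem C_s_mul (i : Fin 2) (z : H) : C (s i) * z = KLop negV signedL i z := by
  have h : C (s i) = KLop negV signedL i 1 := by
    rw [← C_one, ← KL_signedT, KLop_KL_one isHeckeFamily_signedT]
  rw [h, KLop_apply, KLop_apply, signedL, LinearMap.mulLeft_apply, LinearMap.mulLeft_apply,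
    mul_one, smul_mul_assoc, add_mul, one_mul]

theorem C_s_mul_anti_self (i : Fin 2) (m : ℤ) :
    C (s i) * anti C i m = kappa • anti C i m := by
  have := KLop_anti_self isHeckeFamily_signedT i m
  rwa [KL_signedT, negV_add, ← C_s_mul] at this

theorem C_s_mul_anti_succ (i : Fin 2) (m : ℤ) :
    C (s i) * anti C (i + 1) m = anti C i (m + 1) + anti C i (m - 1) := by
  have := KLop_anti_succ isHeckeFamily_signedT i m
  rwa [KL_signedT, ← C_s_mul] at this

/-- Left multiplication by the `C (s i)`, on pairs of elements, in alternating fashion. -/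
def altMul : (Fin 2 → H) →+ (Fin 2 → H) where
  toFun z i := C (s i) * z (i + 1)
  map_zero' := by funext i; simp
  map_add' y z := by funext i; simp [mul_add]

theorem altMul_anti (m : ℤ) : altMul (fun i => anti C i m) =
    (fun i => anti C i (m + 1)) + fun i => anti C i (m - 1) :=
  funext fun i => C_s_mul_anti_succ i m

theorem anti_C_add_two (i : Fin 2) (n : ℕ) :
    anti C i (n + 2 : ℕ) = C (s i) * anti C (i + 1) (n + 1 : ℕ) - anti C i n := by
  rw [C_s_mul_anti_succ, show ((n + 1 : ℕ) : ℤ) + 1 = (n + 2 : ℕ) by push_cast; ring,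
    show ((n + 1 : ℕ) : ℤ) - 1 = n by push_cast; ring, add_sub_cancel_right]

/-- The last letter of the alternating word with `n` letters and first letter `i`. -/
def last : Fin 2 → ℕ → Fin 2
  -- The value for the empty word is chosen so that `last i (n + 2) = last i n` holds already at `n
  -- = 0`.
  | i, 0 => i + 1
  | i, n + 1 => last (i + 1) n

theorem last_add_one (i : Fin 2) (n : ℕ) : last (i + 1) n = last i (n + 1) := rfl

theorem last_add_two (i : Fin 2) (n : ℕ) : last i (n + 2) = last i n := by
  rw [← last_add_one, ← last_add_one, fin_two_add_one_add_one]

theorem last_one (i : Fin 2) : last i 1 = i := fin_two_add_one_add_one i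

/-- Lengthening a word by two letters keeps its last letter, so a right factor that depends on the
last letter only does not disturb the recursion of the left factor. -/
theorem mul_recursion (f : Fin 2 → H) (n : ℕ) :
    (fun i => anti C i (n + 2 : ℕ) * f (last i (n + 2))) =
      altMul (fun i => anti C i (n + 1 : ℕ) * f (last i (n + 1))) -
        fun i => anti C i n * f (last i n) := by
  funext i
  change _ = C (s i) * (anti C (i + 1) (n + 1 : ℕ) * f (last (i + 1) (n + 1))) -
    anti C i n * f (last i n)
  rw [anti_C_add_two, last_add_one, last_add_two, sub_mul, mul_assoc]

/-- Both sides solve the recursion of `altMul`. The factor `kappa` enters at `n = 1`, where a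
reflection meets a word with the same first letter. -/
theorem anti_C_mul_same (i : Fin 2) (n : ℕ) (m : ℤ) :
    anti C i n * anti C (last i n) m = kappa • cg (anti C i) n m := by
  have := congrFun (recursion_unique
    (z := fun n => fun i => anti C i (n : ℕ) * anti C (last i n) m)
    (z' := fun n => kappa • cg (fun m i => anti C i m) n m) altMul ?_ ?_
    (fun n => mul_recursion (fun k => anti C k m) n) ?_ n) i
  · rw [this, Pi.smul_apply]
    congr 1
    simp [cg]
  · funext i; simp [anti_zero, cg_zero]
  · funext i
    simp only [cg_one, last_one, Nat.cast_one]
    rw [anti_one, C_s_mul_anti_self]; rfl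
  · intro n
    rw [cg_recursion altMul _ altMul_anti, smul_sub]
    congr 1
    funext i
    simp [altMul]

/-- The same recursion; at `n = 1` two different letters meet, and `C_s_mul_anti_succ` yields two
neighbours in place of the factor `kappa`. -/
theorem anti_C_mul_other (i : Fin 2) (n : ℕ) (m : ℤ) :
    anti C i n * anti C (last i n + 1) m =
      cg (anti C i) n (m + 1) + cg (anti C i) n (m - 1) := by
  have := congrFun (recursion_unique
    (z := fun n => fun i => anti C i (n : ℕ) * anti C (last i n + 1) m)
    (z' := fun n => cg (fun m i => anti C i m) n (m + 1) +
      cg (fun m i => anti C i m) n (m - 1)) altMul ?_ ?_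
    (fun n => mul_recursion (fun k => anti C (k + 1) m) n) ?_ n) i
  · rw [this]
    simp [cg]
  · funext i; simp [anti_zero, cg_zero]
  · funext i
    simp only [cg_one, last_one, Nat.cast_one]
    rw [anti_one, C_s_mul_anti_succ]; rfl
  · intro n
    rw [cg_recursion altMul _ altMul_anti, cg_recursion altMul _ altMul_anti, map_add]
    abel

theorem anti_C_mul_s_same (i : Fin 2) (n : ℕ) :
    anti C i n * C (s (last i n)) = kappa • anti C i n := by
  refine congrFun (recursion_unique
    (z := fun n => fun i => anti C i (n : ℕ) * C (s (last i n)))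
    (z' := fun n i => kappa • anti C i (n : ℕ)) altMul ?_ ?_
    (fun n => mul_recursion (fun k => C (s k)) n) ?_ n) i
  · funext i; simp [anti_zero]
  · funext i
    simp only [last_one, Nat.cast_one]
    have := C_s_mul_anti_self i 1
    rwa [anti_one] at this ⊢
  · intro n
    funext i
    rw [anti_C_add_two]
    simp [altMul, smul_sub]

theorem anti_C_mul_s_other (i : Fin 2) (n : ℕ) :
    anti C i n * C (s (last i n + 1)) = anti C i (n + 1) + anti C i (n - 1) := by
  refine congrFun (recursion_unique
    (z := fun n => fun i => anti C i (n : ℕ) * C (s (last i n + 1)))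
    (z' := fun n i => anti C i ((n : ℤ) + 1) + anti C i ((n : ℤ) - 1)) altMul ?_ ?_
    (fun n => mul_recursion (fun k => C (s (k + 1))) n) ?_ n) i
  · funext i
    simp [anti_zero, anti_neg]
  · funext i
    simp only [last_one, Nat.cast_one]
    rw [anti_one, ← anti_one C (i + 1), C_s_mul_anti_succ]
  · intro n
    funext i
    change _ = C (s i) * (anti C (i + 1) (((n + 1 : ℕ) : ℤ) + 1) +
      anti C (i + 1) (((n + 1 : ℕ) : ℤ) - 1)) - (anti C i ((n : ℤ) + 1) + anti C i ((n : ℤ) - 1))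
    rw [mul_add, C_s_mul_anti_succ, C_s_mul_anti_succ]
    push_cast
    rw [show (n : ℤ) + 1 - 1 = n by ring, show (n : ℤ) + 1 + 1 = n + 2 by ring,
      show (n : ℤ) + 2 - 1 = n + 1 by ring]
    abel

end

section

/-! ### Structure constants, the `a`-function and the asymptotic algebra -/

theorem repr_C (w : W) : basisC.repr (C w) = Finsupp.single w 1 := by
  rw [← basisC_apply, Module.Basis.repr_self]

theorem repr_C_apply (w z : W) : basisC.repr (C w) z = if w = z then 1 else 0 := by
  rw [repr_C, Finsupp.single_apply]

theorem repr_smul_apply (r : A) (x : H) (z : W) :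
    basisC.repr (r • x) z = r * basisC.repr x z := by
  rw [map_smul, Finsupp.smul_apply, smul_eq_mul]

/-- The elements whose coordinates are integers. -/
def integral : AddSubgroup H where
  carrier := {x | ∀ z, ∃ k : ℤ, basisC.repr x z = k}
  zero_mem' z := ⟨0, by simp⟩
  add_mem' {x y} hx hy z := by
    obtain ⟨k, hk⟩ := hx z
    obtain ⟨l, hl⟩ := hy z
    exact ⟨k + l, by rw [map_add, Finsupp.add_apply, hk, hl, Int.cast_add]⟩
  neg_mem' {x} hx z := by
    obtain ⟨k, hk⟩ := hx z
    exact ⟨-k, by rw [map_neg, Finsupp.neg_apply, hk, Int.cast_neg]⟩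

theorem C_mem_integral (w : W) : C w ∈ integral := fun z => by
  rw [repr_C_apply]
  split_ifs
  · exact ⟨1, by simp⟩
  · exact ⟨0, by simp⟩

theorem anti_C_mem_integral (i : Fin 2) (m : ℤ) : anti C i m ∈ integral :=
  AddSubgroup.zsmul_mem _ (C_mem_integral _) _

theorem cg_mem {M : Type*} [AddCommGroup M] {S : AddSubgroup M} {c : ℤ → M} (h : ∀ m, c m ∈ S)
    (n : ℕ) (m : ℤ) : cg c n m ∈ S := AddSubgroup.sum_mem _ fun _ _ => h _

/-- The elements whose coordinate at `1` vanishes. -/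
def reduced : AddSubgroup H where
  carrier := {x | basisC.repr x 1 = 0}
  zero_mem' := by simp
  add_mem' {x y} hx hy := by
    rw [Set.mem_ofPred_eq, map_add, Finsupp.add_apply, show basisC.repr x 1 = 0 from hx,
      show basisC.repr y 1 = 0 from hy, add_zero]
  neg_mem' {x} hx := by
    rw [Set.mem_ofPred_eq, map_neg, Finsupp.neg_apply, show basisC.repr x 1 = 0 from hx, neg_zero]

theorem anti_C_mem_reduced (i : Fin 2) (m : ℤ) : anti C i m ∈ reduced := by
  rcases eq_or_ne m 0 with rfl | hm
  · rw [anti_zero]; exact zero_mem _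
  · refine AddSubgroup.zsmul_mem _ ?_ _
    change basisC.repr _ _ = 0
    rw [repr_C_apply, if_neg (e_ne_one (Int.natAbs_ne_zero.2 hm))]

theorem C_mul_C_same (i : Fin 2) (n m : ℕ) :
    C (e i (n + 1)) * C (e (last i (n + 1)) (m + 1)) =
      kappa • cg (anti C i) (n + 1) (m + 1 : ℕ) := by
  rw [← anti_natCast_succ C, ← anti_natCast_succ C, ← Nat.cast_succ, ← Nat.cast_succ, anti_C_mul_same]

theorem C_mul_C_other (i : Fin 2) (n m : ℕ) :
    C (e i (n + 1)) * C (e (last i (n + 1) + 1) (m + 1)) =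
      cg (anti C i) (n + 1) ((m + 1 : ℕ) + 1) + cg (anti C i) (n + 1) ((m + 1 : ℕ) - 1) := by
  rw [← anti_natCast_succ C, ← anti_natCast_succ C, ← Nat.cast_succ, ← Nat.cast_succ, anti_C_mul_other]

/-- A product of two elements of the Kazhdan-Lusztig basis that are different from `1`. -/
theorem C_mul_C_mem {x y : W} (hx : x ≠ 1) (hy : y ≠ 1) :
    (C x * C y ∈ integral ∧ C x * C y ∈ reduced) ∨
      ∃ z ∈ integral, z ∈ reduced ∧ C x * C y = kappa • z := by
  obtain ⟨i, n, rfl⟩ := (eq_one_or_eq_e x).resolve_left hx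
  obtain ⟨k, m, rfl⟩ := (eq_one_or_eq_e y).resolve_left hy
  rcases fin_two_eq_or (last i (n + 1)) k with rfl | rfl
  · exact Or.inr ⟨_, cg_mem (anti_C_mem_integral i) _ _, cg_mem (anti_C_mem_reduced i) _ _,
      C_mul_C_same i n m⟩
  · rw [C_mul_C_other]
    exact Or.inl ⟨add_mem (cg_mem (anti_C_mem_integral i) _ _) (cg_mem (anti_C_mem_integral i) _ _),
      add_mem (cg_mem (anti_C_mem_reduced i) _ _) (cg_mem (anti_C_mem_reduced i) _ _)⟩

theorem h_one (x y : W) : h x y 1 = if x = 1 ∧ y = 1 then 1 else 0 := by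
  by_cases hx : x = 1
  · rw [h, hx, C_one, one_mul, repr_C_apply]; simp
  · rw [if_neg (fun h => hx h.1)]
    by_cases hy : y = 1
    · rw [h, hy, C_one, mul_one, repr_C_apply, if_neg hx]
    · rcases C_mul_C_mem hx hy with h1 | ⟨z, -, h1, h2⟩
      · exact h1.2
      · rw [h, h2, repr_smul_apply, show basisC.repr z 1 = 0 from h1, mul_zero]

theorem h_eq (x y z : W) : (∃ k : ℤ, h x y z = k) ∨ ∃ k : ℤ, h x y z = kappa * k := by
  by_cases hx : x = 1
  · left; rw [h, hx, C_one, one_mul]; exact C_mem_integral _ _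
  by_cases hy : y = 1
  · left; rw [h, hy, C_one, mul_one]; exact C_mem_integral _ _
  rcases C_mul_C_mem hx hy with h1 | ⟨u, h1, -, h2⟩
  · exact Or.inl (h1.1 z)
  · obtain ⟨k, hk⟩ := h1 z
    exact Or.inr ⟨k, by rw [h, h2, repr_smul_apply, hk]⟩

theorem a_one : a 1 = 0 := by
  refine Nat.sInf_eq_zero.2 (Or.inl fun x y => ?_)
  rw [pow_zero, one_mul, h_one]
  split_ifs
  · exact ⟨1, map_one _⟩
  · exact ⟨0, map_zero _⟩

theorem h_start (w : W) (hw : w ≠ 1) : h (s (start w)) w w = kappa := by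
  obtain ⟨i, n, rfl⟩ := (eq_one_or_eq_e w).resolve_left hw
  rw [start_e i n.succ_ne_zero, h, ← anti_natCast_succ C, C_s_mul_anti_self, repr_smul_apply,
    anti_natCast_succ, repr_C_apply, if_pos rfl, mul_one]

theorem coeff_v (m k : ℤ) : (v m).coeff k = if m = k then 1 else 0 := LaurentPolynomial.T_apply _ _

theorem kappa_notMem : kappa ∉ Aplus := by
  rintro ⟨p, hp⟩
  have h1 : kappa.coeff (-1) = -1 := by
    rw [kappa]
    change -((v 1).coeff (-1) + (v (-1)).coeff (-1)) = _
    rw [coeff_v, coeff_v]; simp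
  rw [← hp, LaurentPolynomial.coeff_toLaurent] at h1
  rw [Finsupp.mapDomain_of_notMem_range] at h1
  · omega
  · rintro ⟨n, hn⟩
    simp at hn

theorem negV_mul_kappa : -v 1 * kappa = 1 + v 2 := by
  rw [kappa, neg_mul_neg, mul_add, v_mul_v, v_mul_v]
  change v 2 + v 0 = _
  rw [v_zero, add_comm]

theorem negV_mul_h_mem (x y w : W) : -v 1 * h x y w ∈ Aplus := by
  rcases h_eq x y w with ⟨k, hk⟩ | ⟨k, hk⟩
  · refine ⟨-Polynomial.X * (k : Polynomial ℤ), ?_⟩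
    rw [hk, map_mul, map_neg, Polynomial.toLaurent_X, map_intCast]; rfl
  · refine ⟨(1 + Polynomial.X ^ 2) * (k : Polynomial ℤ), ?_⟩
    rw [hk, ← mul_assoc, negV_mul_kappa, map_mul, map_add, map_one, Polynomial.toLaurent_X_pow,
      map_intCast]; rfl

/-- The bound `a ≤ 1` comes from `-v * kappa = 1 + v²`. It is attained because `C_s C_w = kappa C_w`
for the first letter `s` of `w`, and `kappa` has a pole. -/
theorem a_of_ne_one {w : W} (hw : w ≠ 1) : a w = 1 := by
  have h1 : 1 ∈ {n : ℕ | ∀ x y : W, (-v 1) ^ n * h x y w ∈ Aplus} := by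
    intro x y
    rw [pow_one]
    exact negV_mul_h_mem x y w
  refine le_antisymm (Nat.sInf_le h1) (Nat.one_le_iff_ne_zero.2 fun h0 => ?_)
  rcases Nat.sInf_eq_zero.1 h0 with h2 | h2
  · have := h2 (s (start w)) w
    rw [pow_zero, one_mul, h_start w hw] at this
    exact kappa_notMem this
  -- The convention that the infimum of the empty set is `0` plays no role, as `1` belongs to the
  -- set.
  · rw [h2] at h1
    exact h1

/-- The additive map that takes `C_x C_y` to `t_x t_y`. -/
def leading : H →+ J :=
  (Finsupp.liftAddHom (N := J) fun u : W =>
    ((smulAddHom ℤ J).flip (t u)).comp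
      (((Finsupp.applyAddHom (0 : ℤ)).comp AddMonoidAlgebra.coeffAddEquiv.toAddMonoidHom).comp
        (AddMonoidHom.mulLeft ((-v 1) ^ a u⁻¹)))).comp
  basisC.repr.toLinearMap.toAddMonoidHom

theorem leading_apply (z : H) : leading z =
    (basisC.repr z).sum fun u p => (((-v 1) ^ a u⁻¹ * p).coeff 0) • t u := rfl

theorem mulBasis_eq (x y : W) : mulBasis x y = leading (C x * C y) := by
  rw [leading_apply, mulBasis, Finsupp.sum]
  refine Finset.sum_congr rfl fun u _ => ?_
  rw [gamma, inv_inv]; rfl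

theorem leading_smul_C (r : A) (w : W) :
    leading (r • C w) = (((-v 1) ^ a w⁻¹ * r).coeff 0) • t w := by
  rw [leading_apply, map_smul, repr_C, Finsupp.smul_single, smul_eq_mul, mul_one,
    Finsupp.sum_single_index]
  rw [mul_zero, AddMonoidAlgebra.coeff_zero, Finsupp.zero_apply, zero_smul]

theorem leading_smul_anti (r : A) (i : Fin 2) (m : ℤ) :
    leading (r • anti C i m) = ((-v 1 * r).coeff 0) • anti t i m := by
  rcases eq_or_ne m 0 with rfl | hm
  · rw [anti_zero, anti_zero, smul_zero, smul_zero, map_zero]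
  · rw [anti, anti, smul_comm, map_zsmul, leading_smul_C, a_of_ne_one, pow_one, smul_comm]
    exact inv_ne_one.2 (e_ne_one (Int.natAbs_ne_zero.2 hm))

theorem leading_kappa_smul_anti (i : Fin 2) (m : ℤ) :
    leading (kappa • anti C i m) = anti t i m := by
  rw [leading_smul_anti, negV_mul_kappa, ← v_zero, AddMonoidAlgebra.coeff_add, Finsupp.add_apply,
    coeff_v, coeff_v, if_pos rfl, if_neg (by omega), add_zero, one_smul]

/-- Without a factor `kappa` there is no pole, so the factor `-v` leaves no constant term. This
makes products in `J` with different letters vanish. -/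
theorem leading_anti (i : Fin 2) (m : ℤ) : leading (anti C i m) = 0 := by
  have := leading_smul_anti 1 i m
  have h1 : (-v 1 : A).coeff 0 = 0 := by
    change -((v 1).coeff 0) = 0
    rw [coeff_v]; simp
  rwa [one_smul, mul_one, h1, zero_smul] at this

theorem mulBasis_one_one : mulBasis 1 1 = t 1 := by
  rw [mulBasis_eq]
  have := leading_smul_C 1 1
  rw [one_smul, inv_one, a_one, pow_zero, one_mul, ← v_zero, coeff_v, if_pos rfl, one_smul] at this
  rw [← this, C_one, one_mul]

theorem mulBasis_one_e (i : Fin 2) (n : ℕ) : mulBasis 1 (e i (n + 1)) = 0 := by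
  rw [mulBasis_eq, C_one, one_mul, ← anti_natCast_succ C, leading_anti]

theorem mulBasis_e_one (i : Fin 2) (n : ℕ) : mulBasis (e i (n + 1)) 1 = 0 := by
  rw [mulBasis_eq, C_one, mul_one, ← anti_natCast_succ C, leading_anti]

theorem mulBasis_same (i : Fin 2) (n m : ℕ) :
    mulBasis (e i (n + 1)) (e (last i (n + 1)) (m + 1)) = cg (anti t i) (n + 1) (m + 1 : ℕ) := by
  rw [mulBasis_eq, C_mul_C_same, cg, Finset.smul_sum, map_sum]
  exact Finset.sum_congr rfl fun k _ => leading_kappa_smul_anti _ _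

theorem mulBasis_other (i : Fin 2) (n m : ℕ) :
    mulBasis (e i (n + 1)) (e (last i (n + 1) + 1) (m + 1)) = 0 := by
  rw [mulBasis_eq, C_mul_C_other, map_add, cg, cg, map_sum, map_sum]
  simp only [leading_anti, Finset.sum_const_zero, add_zero]

/-! ### The coefficients of `φ` -/

theorem phiCoeff_one (x : W) : phiCoeff x 1 = if x = 1 then 1 else 0 := by
  have : (distinguished.filter fun d => a d = a 1) = {1} := by
    ext d
    rw [Finset.mem_filter, a_one, Finset.mem_singleton]
    constructor
    · rintro ⟨-, h⟩
      by_contra hd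
      rw [a_of_ne_one hd] at h
      omega
    · rintro rfl
      exact ⟨by simp [distinguished], a_one⟩
  rw [phiCoeff, this, Finset.sum_singleton, h_one]
  simp

theorem phiCoeff_of_ne_one (x : W) {z : W} (hz : z ≠ 1) :
    phiCoeff x z = basisC.repr (C x * C (s 0) + C x * C (s 1)) z := by
  have : (distinguished.filter fun d => a d = a z) = {s 0, s 1} := by
    ext d
    rw [Finset.mem_filter, a_of_ne_one hz, distinguished, Finset.mem_insert]
    constructor
    · rintro ⟨rfl | h, h'⟩
      · rw [a_one] at h'; omega
      · exact h
    · intro h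
      refine ⟨Or.inr h, a_of_ne_one ?_⟩
      rw [Finset.mem_insert, Finset.mem_singleton] at h
      rcases h with rfl | rfl <;> exact s_ne_one _
  rw [phiCoeff, this, Finset.sum_pair (by rw [Ne, s_inj]; decide), map_add, Finsupp.add_apply]
  rfl

theorem C_mul_add (f : Fin 2 → H) (x : H) (i : Fin 2) :
    x * f 0 + x * f 1 = x * f i + x * f (i + 1) := by
  fin_cases i
  · rfl
  · exact add_comm _ _

theorem phiCoeff_one_e (i : Fin 2) (n : ℕ) :
    phiCoeff 1 (e i (n + 1)) = if n = 0 then 1 else 0 := by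
  rw [phiCoeff_of_ne_one _ (e_ne_one n.succ_ne_zero), C_one, C_mul_add (fun k => C (s k)) 1 i,
    one_mul, one_mul, map_add, Finsupp.add_apply, repr_C_apply, repr_C_apply, ← e_one, ← e_one]
  simp only [e_inj, fin_two_add_one_ne]
  by_cases h : n = 0 <;> simp [h]

/-- Right multiplication by `C (s 0) + C (s 1)`: the reflection that equals the last letter
contributes `kappa`, the other one the two neighbouring lengths. Thus `φ` is tridiagonal on the
words with a given first letter. -/
theorem phiCoeff_e_e (i k : Fin 2) (n m : ℕ) :
    phiCoeff (e i (n + 1)) (e k (m + 1)) =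
      if i = k then (if n = m then kappa else if n = m + 1 ∨ m = n + 1 then 1 else 0) else 0 := by
  rw [phiCoeff_of_ne_one _ (e_ne_one m.succ_ne_zero),
    C_mul_add (fun k => C (s k)) _ (last i (n + 1)),
    ← anti_natCast_succ C, ← Nat.cast_succ, anti_C_mul_s_same, anti_C_mul_s_other, map_add, map_add,
    Finsupp.add_apply, Finsupp.add_apply, repr_smul_apply, anti_natCast_succ, Nat.cast_succ,
    anti_natCast_succ, add_sub_cancel_right, repr_C_apply, repr_C_apply]
  cases n with
  | zero =>
    rw [Nat.cast_zero, anti_zero, map_zero, Finsupp.zero_apply, add_zero]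
    simp only [e_inj, Nat.succ_eq_add_one, Nat.succ_ne_zero, false_or]
    by_cases hik : i = k
    · simp only [hik, and_true, if_true]
      split_ifs <;> first | omega | (simp; done) | grind
    · simp [hik]
  | succ n =>
    rw [Nat.cast_succ, anti_natCast_succ, repr_C_apply]
    simp only [e_inj, Nat.succ_eq_add_one, Nat.succ_ne_zero, false_or]
    by_cases hik : i = k
    · simp only [hik, and_true, if_true]
      split_ifs <;> first | omega | simp
    · simp [hik]

end

section

/-! ### The inverse images of the `t_w` -/

theorem coeff_toSeries (p : A) (k : ℤ) : (toSeries p).coeff k = p.coeff k := rfl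

theorem toSeries_zero : toSeries 0 = 0 := HahnSeries.ext (funext fun _ => rfl)

theorem toSeries_add (p r : A) : toSeries (p + r) = toSeries p + toSeries r :=
  HahnSeries.ext (funext fun _ => rfl)

theorem toSeries_neg (p : A) : toSeries (-p) = -toSeries p :=
  HahnSeries.ext (funext fun _ => rfl)

theorem toSeries_C_mul_T (m : ℤ) (n : ℤ) :
    toSeries (LaurentPolynomial.C m * LaurentPolynomial.T n) = HahnSeries.single n m := by
  ext k
  rw [coeff_toSeries, ← LaurentPolynomial.single_eq_C_mul_T, AddMonoidAlgebra.coeff_single,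
    Finsupp.single_apply, HahnSeries.coeff_single]
  simp only [eq_comm]

theorem toSeries_v (n : ℤ) : toSeries (v n) = HahnSeries.single n 1 := by
  rw [← toSeries_C_mul_T, map_one, one_mul]; rfl

theorem toSeries_one : toSeries 1 = 1 := by rw [← v_zero, toSeries_v]; rfl

theorem toSeries_mul (p r : A) : toSeries (p * r) = toSeries p * toSeries r := by
  induction p using LaurentPolynomial.induction_on' with
  | add p p' hp hp' => rw [add_mul, toSeries_add, toSeries_add, add_mul, hp, hp']
  | C_mul_T n a =>
    induction r using LaurentPolynomial.induction_on' with
    | add p p' hp hp' => rw [mul_add, toSeries_add, toSeries_add, mul_add, hp, hp']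
    | C_mul_T m c =>
      rw [mul_mul_mul_comm, ← map_mul, ← LaurentPolynomial.T_add, toSeries_C_mul_T,
        toSeries_C_mul_T, toSeries_C_mul_T, HahnSeries.single_mul_single]

/-- Laurent polynomials as Laurent series. -/
def toSeriesHom : A →+* LaurentSeries ℤ where
  toFun := toSeries
  map_one' := toSeries_one
  map_mul' := toSeries_mul
  map_zero' := toSeries_zero
  map_add' := toSeries_add

/-- A column of `φ` has finitely many nonzero entries, so the required Krull convergence is an
identity of finite sums. -/
theorem eventually_coeff_iff {g : W → LaurentSeries ℤ} {c : LaurentSeries ℤ} (S₁ : Finset W)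
    (h : ∀ x ∉ S₁, g x = 0) :
    (∀ N : ℤ, ∃ S₀ : Finset W, ∀ S : Finset W, S₀ ⊆ S → ∀ k < N,
      (∑ x ∈ S, g x).coeff k = c.coeff k) ↔ ∑ x ∈ S₁, g x = c := by
  have key : ∀ S, S₁ ⊆ S → ∑ x ∈ S, g x = ∑ x ∈ S₁, g x := fun S hS =>
    (Finset.sum_subset hS fun x _ hx => h x hx).symm
  constructor
  · intro H
    ext k
    obtain ⟨S₀, hS₀⟩ := H (k + 1)
    classical
    rw [← key (S₀ ∪ S₁) Finset.subset_union_right]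
    exact hS₀ _ Finset.subset_union_left k (by omega)
  · rintro rfl N
    exact ⟨S₁, fun S hS k _ => by rw [key S hS]⟩

/-- This includes the identity as `e i 0`, so the recursion in `isPhiJ_iff` has the same shape at
its boundary. -/
theorem phiCoeff_e_succ (i : Fin 2) (n : ℕ) : phiCoeff (e i n) (e i (n + 1)) = 1 := by
  cases n with
  | zero => rw [e_zero, phiCoeff_one_e, if_pos rfl]
  | succ n => rw [phiCoeff_e_e]; simp

/-- The equation `(φ ∘ j)(∑ b_x C'_x) = ∑ c_z t_z`, in coordinates. -/
theorem isPhiJ_iff (b c : W → LaurentSeries ℤ) : IsPhiJ b c ↔ b 1 = c 1 ∧ ∀ i n,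
    (-1) ^ n * b (e i n) + (-1) ^ (n + 1) * b (e i (n + 1)) * toSeries kappa +
      (-1) ^ (n + 2) * b (e i (n + 2)) = c (e i (n + 1)) := by
  have h1 : (∀ N : ℤ, ∃ S₀ : Finset W, ∀ S : Finset W, S₀ ⊆ S → ∀ k < N,
      (∑ x ∈ S, (-1) ^ len x * b x * toSeries (phiCoeff x 1)).coeff k = (c 1).coeff k) ↔
      b 1 = c 1 := by
    rw [eventually_coeff_iff {1}]
    · rw [Finset.sum_singleton, phiCoeff_one, if_pos rfl, toSeries_one, len_one, pow_zero, one_mul,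
        mul_one]
    · intro x hx
      rw [phiCoeff_one, if_neg (by simpa using hx), toSeries_zero, mul_zero]
  have h2 : ∀ i n, (∀ N : ℤ, ∃ S₀ : Finset W, ∀ S : Finset W, S₀ ⊆ S → ∀ k < N,
      (∑ x ∈ S, (-1) ^ len x * b x * toSeries (phiCoeff x (e i (n + 1)))).coeff k =
        (c (e i (n + 1))).coeff k) ↔
      (-1) ^ n * b (e i n) + (-1) ^ (n + 1) * b (e i (n + 1)) * toSeries kappa +
      (-1) ^ (n + 2) * b (e i (n + 2)) = c (e i (n + 1)) := by
    intro i n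
    rw [eventually_coeff_iff {e i n, e i (n + 1), e i (n + 2)}]
    · rw [Finset.sum_insert, Finset.sum_pair, phiCoeff_e_succ, phiCoeff_e_e, phiCoeff_e_e,
        if_pos rfl, if_pos rfl, if_pos rfl, if_neg (by omega), if_pos (by omega), toSeries_one,
        mul_one, mul_one, len_e, len_e, len_e, add_assoc]
      · rw [Ne, e_inj]; omega
      · simp only [Finset.mem_insert, Finset.mem_singleton, e_inj]; omega
    · intro x hx
      simp only [Finset.mem_insert, Finset.mem_singleton, not_or] at hx
      rcases eq_one_or_eq_e x with rfl | ⟨k, m, rfl⟩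
      · rw [phiCoeff_one_e, if_neg, toSeries_zero, mul_zero]
        rintro rfl
        exact hx.1 (e_zero i).symm
      · rw [phiCoeff_e_e]
        simp only [e_inj] at hx
        split_ifs with h3 h4 h5
        · omega
        · omega
        · rw [toSeries_zero, mul_zero]
        · rw [toSeries_zero, mul_zero]
  constructor
  · exact fun H => ⟨h1.1 (H 1), fun i n => (h2 i n).1 (H _)⟩
  · rintro ⟨H1, H2⟩ z
    rcases eq_one_or_eq_e z with rfl | ⟨i, n, rfl⟩
    · exact h1.2 H1
    · exact (h2 i n).2 (H2 i n)

/-! ### Existence and uniqueness of `(φ ∘ j)⁻¹ (t_w)`. -/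

theorem IsCompleted.sub {b b' : W → LaurentSeries ℤ} (h : IsCompleted b) (h' : IsCompleted b') :
    IsCompleted (b - b') := by
  intro N
  obtain ⟨n, hn⟩ := h N
  obtain ⟨n', hn'⟩ := h' N
  refine ⟨max n n', fun x hx k hk => ?_⟩
  rw [Pi.sub_apply, HahnSeries.coeff_sub, hn x (le_of_max_le_left hx) k hk,
    hn' x (le_of_max_le_right hx) k hk, sub_zero]

theorem coeff_neg_one_pow_mul {f : LaurentSeries ℤ} {k : ℤ} (h : f.coeff k = 0) (n : ℕ) :
    ((-1) ^ n * f).coeff k = 0 := by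
  rcases neg_one_pow_eq_or (LaurentSeries ℤ) n with h' | h' <;> rw [h'] <;> simp [h]

/-- The homogeneous recursion factors with roots `v` and `v⁻¹`. The part along `v⁻¹` has poles of
growing order and is excluded by the completion; the part along `v` is determined by its initial
value, which is `0`. -/
theorem eq_zero_of_isPhiJ {b : W → LaurentSeries ℤ} (hb : IsCompleted b) (h : IsPhiJ b 0) :
    b = 0 := by
  obtain ⟨h0, h1⟩ := (isPhiJ_iff b 0).1 h
  suffices H : ∀ i n, b (e i n) = 0 by
    funext x
    rw [← e_start_len x]
    exact H _ _
  intro i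
  have hv : toSeries (v 1) * toSeries (v (-1)) = 1 := by
    rw [← toSeries_mul, v_mul_v, ← toSeries_one, ← v_zero]; rfl
  have hK : toSeries kappa = -(toSeries (v 1) + toSeries (v (-1))) := by
    rw [kappa, toSeries_neg, toSeries_add]
  obtain ⟨β, hβ⟩ : ∃ β : ℕ → LaurentSeries ℤ, β = fun n => (-1) ^ n * b (e i n) := ⟨_, rfl⟩
  have h2 : ∀ n, β n + β (n + 1) * toSeries kappa + β (n + 2) = 0 := by
    intro n
    rw [hβ]
    exact h1 i n
  -- This combination annihilates the solution `v ^ n` and picks out the component that is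
  -- multiplied by `v⁻¹` at each step.
  obtain ⟨d, hd⟩ : ∃ d : ℕ → LaurentSeries ℤ, d = fun n => β n - toSeries (v (-1)) * β (n + 1) :=
    ⟨_, rfl⟩
  have h3 : ∀ n, d (n + 1) = toSeries (v (-1)) * d n := by
    intro n
    have := h2 n
    rw [hK] at this
    rw [hd]
    simp only
    linear_combination (-toSeries (v (-1))) * this - β (n + 1) * hv
  have h4 : ∀ n, d n = toSeries (v (-n)) * d 0 := by
    intro n
    induction n with
    | zero => rw [Nat.cast_zero, neg_zero, v_zero, toSeries_one, one_mul]
    | succ n ih =>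
      rw [h3, ih, ← mul_assoc, ← toSeries_mul, v_mul_v]
      congr 3; push_cast; ring
  have hd0 : d 0 = 0 := by
    ext k
    -- The coefficient of `d 0` at `k` is that of `d n` at `k - n`, which involves `β n` at `k - n`
    -- and `β (n + 1)` at `k - n + 1`; both exponents are below `k + 2`.
    obtain ⟨n, hn⟩ := hb (k + 2)
    have h5 : ∀ (m : ℕ) (l : ℤ), n ≤ m → l < k + 2 → (β m).coeff l = 0 := by
      intro m l hm hl
      rw [hβ]
      exact coeff_neg_one_pow_mul (hn _ (by rwa [len_e]) l hl) m
    have h6 : (d n).coeff (k - n) = 0 := by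
      rw [hd, HahnSeries.coeff_sub, h5 n _ le_rfl (by omega), toSeries_v, zero_sub, neg_eq_zero,
        show k - n = (k - n + 1) + -1 by ring, HahnSeries.coeff_single_mul_add, one_mul]
      exact h5 _ _ (by omega) (by omega)
    rwa [h4, toSeries_v, show k - n = k + -n by ring, HahnSeries.coeff_single_mul_add,
      one_mul] at h6
  have h5 : ∀ n, β (n + 1) = toSeries (v 1) * β n := by
    intro n
    have : d n = 0 := by rw [h4, hd0, mul_zero]
    rw [hd] at this
    linear_combination -toSeries (v 1) * this - β (n + 1) * hv
  have h6 : ∀ n, β n = 0 := by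
    intro n
    induction n with
    | zero => simp only [hβ, e_zero, h0, Pi.zero_apply, mul_zero]
    | succ n ih => rw [h5, ih, mul_zero]
  intro n
  have := h6 n
  rw [hβ] at this
  rcases neg_one_pow_eq_or (LaurentSeries ℤ) n with h' | h' <;> simpa [h'] using this

/-- The solution of the recursion of `isPhiJ_iff` with a source at `m`, up to sign. -/
def green (n m : ℕ) : A := cg v (min n m) (max n m : ℕ)

theorem green_of_le {n m : ℕ} (h : n ≤ m) : green n m = cg v n m := by
  rw [green, min_eq_left h, max_eq_right h]

theorem green_of_ge {n m : ℕ} (h : m ≤ n) : green n m = cg v m n := by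
  rw [green, min_eq_right h, max_eq_left h]

theorem kappa_mul_v (m : ℤ) : -kappa * v m = v (m + 1) + v (m - 1) := by
  rw [kappa, neg_neg, add_mul, v_mul_v, v_mul_v]
  congr 2 <;> ring

theorem kappa_mul_cg (n : ℕ) (m : ℤ) : -kappa * cg v n m = cg v n (m + 1) + cg v n (m - 1) := by
  rw [cg, cg, cg, Finset.mul_sum, ← Finset.sum_add_distrib]
  refine Finset.sum_congr rfl fun k _ => ?_
  rw [kappa_mul_v]
  congr 2 <;> ring

theorem green_zero_left (m : ℕ) : green 0 m = 0 := by
  rw [green_of_le (Nat.zero_le _), cg_zero]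

theorem cg_v_recursion (n : ℕ) (m : ℤ) :
    cg v (n + 2) m = -kappa * cg v (n + 1) m - cg v n m :=
  cg_recursion (AddMonoidHom.mulLeft (-kappa)) v kappa_mul_v n m

/-- Below the diagonal the number of terms varies, and `cg_v_recursion` applies; above it each term
is a power of `v` that decays with `n`. The two branches differ by one term on the diagonal, which
gives the source. -/
theorem green_recursion (n m : ℕ) : green n m + kappa * green (n + 1) m + green (n + 2) m =
    if n + 1 = m then -1 else 0 := by
  rcases lt_trichotomy (n + 1) m with h | rfl | h
  · rw [if_neg h.ne, green_of_le (by omega), green_of_le (by omega), green_of_le (by omega),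
      cg_v_recursion]
    ring
  -- Exchanging the two arguments across the diagonal adds the single term `v 0 = 1`.
  · have h1 : cg v (n + 2) (n + 1 : ℕ) = cg v (n + 1) (n + 2 : ℕ) + 1 := by
      rw [cg, cg, Finset.sum_range_succ, ← v_zero]
      congr 1
      · refine Finset.sum_congr rfl fun k _ => ?_
        congr 1; push_cast; ring
      · congr 1; push_cast; ring
    rw [if_pos rfl, green_of_le (by omega), green_of_le le_rfl, green_of_ge (by omega),
      ← sub_eq_iff_eq_add.2 h1, cg_v_recursion]
    ring
  · rw [if_neg h.ne', green_of_ge (by omega), green_of_ge (by omega), green_of_ge (by omega)]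
    have := kappa_mul_cg m (n + 1 : ℕ)
    rw [show ((n + 1 : ℕ) : ℤ) + 1 = (n + 2 : ℕ) by push_cast; ring,
      show ((n + 1 : ℕ) : ℤ) - 1 = (n : ℕ) by push_cast; ring] at this
    linear_combination -this

/-- The exponents of `v` in `green n m` are at least `|n - m| + 1`, so for fixed `m` the entries
tend to `0`. -/
theorem coeff_green {n m : ℕ} {k : ℤ} (h : k + m ≤ n) : (green n m).coeff k = 0 := by
  rw [green, cg, AddMonoidAlgebra.coeff_sum, Finsupp.finsetSum_apply]
  refine Finset.sum_eq_zero fun j hj => ?_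
  rw [Finset.mem_range] at hj
  rw [coeff_v, if_neg]
  omega

/-- The coefficients of `(φ ∘ j)⁻¹ (t_w)`; they are Laurent polynomials. -/
def tau (w x : W) : A :=
  if w = 1 then (-1) ^ len x * v (len x)
  else if start x = start w then (-1) ^ (len x + 1) * green (len x) (len w) else 0

theorem tau_one_left (x : W) : tau 1 x = (-1) ^ len x * v (len x) := if_pos rfl

theorem tau_one_right {w : W} (hw : w ≠ 1) : tau w 1 = 0 := by
  rw [tau, if_neg hw, len_one, green_zero_left, mul_zero, ite_self]

theorem tau_e (i k : Fin 2) (n m : ℕ) : tau (e i (m + 1)) (e k n) =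
    if k = i then (-1) ^ (n + 1) * green n (m + 1) else 0 := by
  rcases Nat.eq_zero_or_pos n with rfl | hn
  · rw [e_zero, tau_one_right (e_ne_one m.succ_ne_zero), green_zero_left, mul_zero, ite_self]
  · rw [tau, if_neg (e_ne_one m.succ_ne_zero), start_e _ hn.ne', start_e _ m.succ_ne_zero, len_e,
      len_e]

/-- Up to the sign `(-1) ^ n`, the solution for `w = 1` is the decaying homogeneous solution `v ^ n`
with initial value `1`. For `w ≠ 1` it is minus the Green function, supported on the words that
start like `w`. -/
theorem isPhiJ_tau (w : W) : IsPhiJ (fun x => toSeries (tau w x)) (Pi.single w 1) := by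
  have hs : ∀ n : ℕ, ((-1) ^ n : LaurentSeries ℤ) = toSeries ((-1) ^ n) := fun n => by
    rw [show toSeries ((-1) ^ n) = toSeriesHom ((-1) ^ n) from rfl, map_pow, map_neg, map_one]
  rw [isPhiJ_iff]
  simp only [hs, ← toSeries_mul, ← toSeries_add]
  have h1 : ∀ n : ℕ, ((-1 : A)) ^ n * (-1) ^ n = 1 := fun n => by rw [← mul_pow]; simp
  rcases eq_one_or_eq_e w with rfl | ⟨i, m, rfl⟩
  · refine ⟨?_, fun k n => ?_⟩
    · rw [Pi.single_eq_same, tau_one_left, len_one, pow_zero, one_mul]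
      exact toSeries_one
    · rw [Pi.single_eq_of_ne (e_ne_one n.succ_ne_zero), ← toSeries_zero]
      congr 1
      rw [tau_one_left, tau_one_left, tau_one_left, len_e, len_e, len_e, ← mul_assoc, h1,
        ← mul_assoc, h1, ← mul_assoc, h1, kappa, one_mul, one_mul, one_mul, mul_neg, mul_add,
        v_mul_v, v_mul_v]
      push_cast
      rw [show (n : ℤ) + 1 + 1 = n + 2 by ring, show (n : ℤ) + 1 + -1 = n by ring]
      ring
  · refine ⟨?_, fun k n => ?_⟩
    · rw [tau_one_right (e_ne_one m.succ_ne_zero), toSeries_zero,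
        Pi.single_eq_of_ne (e_ne_one m.succ_ne_zero).symm]
    · have h2 : (Pi.single (e i (m + 1)) 1 : W → LaurentSeries ℤ) (e k (n + 1)) =
          toSeries (if k = i ∧ n = m then 1 else 0) := by
        rw [Pi.single_apply]
        by_cases h : k = i ∧ n = m
        · rw [if_pos h, if_pos (e_inj.2 (by omega)), toSeries_one]
        · rw [if_neg h, if_neg (fun h' => h (by have := e_inj.1 h'; omega)), toSeries_zero]
      rw [h2]
      congr 1
      rw [tau_e, tau_e, tau_e]
      by_cases hk : k = i
      · simp only [hk, if_true, true_and]
        have h3 := green_recursion n (m + 1)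
        simp only [Nat.add_right_cancel_iff] at h3
        have h4 : (if n = m then (1 : A) else 0) = -(if n = m then -1 else 0) := by
          split_ifs <;> simp
        rw [h4, ← h3]
        linear_combination (-green n (m + 1)) * h1 n - (kappa * green (n + 1) (m + 1)) * h1 (n + 1) -
          (green (n + 2) (m + 1)) * h1 (n + 2)
      · simp [hk]

theorem coeff_neg_one_pow_mul' {p : A} {k : ℤ} (h : p.coeff k = 0) (n : ℕ) :
    ((-1) ^ n * p).coeff k = 0 := by
  rcases neg_one_pow_eq_or A n with h' | h' <;> rw [h']
  · rwa [one_mul]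
  · rw [neg_one_mul, AddMonoidAlgebra.coeff_neg, Finsupp.neg_apply, h, neg_zero]

theorem isCompleted_tau (w : W) : IsCompleted fun x => toSeries (tau w x) := by
  intro N
  refine ⟨(N + len w).toNat, fun x hx k hk => ?_⟩
  rw [coeff_toSeries, tau]
  split_ifs
  · refine coeff_neg_one_pow_mul' ?_ _
    rw [coeff_v, if_neg]
    omega
  · refine coeff_neg_one_pow_mul' (coeff_green ?_) _
    omega
  · rfl

theorem isCompleted_and_isPhiJ_iff (w : W) (b : W → LaurentSeries ℤ) :
    (IsCompleted b ∧ IsPhiJ b (Pi.single w 1)) ↔ b = fun x => toSeries (tau w x) := by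
  constructor
  · rintro ⟨h1, h2⟩
    refine sub_eq_zero.1 (eq_zero_of_isPhiJ (h1.sub (isCompleted_tau w)) ?_)
    rw [isPhiJ_iff] at h2 ⊢
    obtain ⟨h3, h4⟩ := h2
    obtain ⟨h5, h6⟩ := (isPhiJ_iff _ _).1 (isPhiJ_tau w)
    refine ⟨by rw [Pi.sub_apply, h3, h5, sub_self]; rfl, fun i n => ?_⟩
    have := congrArg₂ (· - ·) (h4 i n) (h6 i n)
    simp only [sub_self] at this
    rw [Pi.zero_apply, ← this]
    simp only [Pi.sub_apply]
    ring
  · rintro rfl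
    exact ⟨isCompleted_tau w, isPhiJ_tau w⟩

/-! ### Specialization -/

section Value

variable (F : Type*) [Field F] [ValuativeRel F] [TopologicalSpace F] [IsNonarchimedeanLocalField F]

/-- The specialization of `q^{-1/2}`, for Laurent polynomials in `q^{-1/2}`. -/
def specialize : A →+* ℂ := LaurentPolynomial.eval₂ (Int.castRingHom ℂ) (sqrtq F)⁻¹

theorem specialize_v (n : ℤ) : specialize F (v n) = ((sqrtq F : ℂ)⁻¹) ^ n := by
  rw [specialize, v, LaurentPolynomial.eval₂_T, Units.val_zpow_eq_zpow_val, Units.val_inv_eq_inv_val]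

theorem hasSum_valueTerm (p : A) : HasSum (valueTerm F (toSeries p)) (specialize F p) := by
  induction p using LaurentPolynomial.induction_on' with
  | add p r hp hr =>
    rw [map_add]
    convert! hp.add hr using 1
    funext k
    rw [valueTerm, valueTerm, valueTerm, toSeries_add, HahnSeries.coeff_add, Int.cast_add, add_mul]
  | C_mul_T n m =>
    have h1 : specialize F (LaurentPolynomial.C m * LaurentPolynomial.T n) =
        valueTerm F (toSeries (LaurentPolynomial.C m * LaurentPolynomial.T n)) n := by
      rw [valueTerm, toSeries_C_mul_T, HahnSeries.coeff_single_same, map_mul,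
        show (LaurentPolynomial.T n : A) = v n from rfl, specialize_v, specialize,
        LaurentPolynomial.eval₂_C]
      rfl
    rw [h1]
    refine hasSum_single n fun k hk => ?_
    rw [valueTerm, toSeries_C_mul_T, HahnSeries.coeff_single_of_ne hk, Int.cast_zero, zero_mul]

end Value

end

section

open Filter

/-! ### Operators on sequences -/

/-- The indices `k` of the parity of `i`. -/
def Par (i : Fin 2) (k : ℤ) : Prop := Even (k + (i : ℕ))

instance (i : Fin 2) (k : ℤ) : Decidable (Par i k) := inferInstanceAs (Decidable (Even _))

theorem par_add_one_left (i : Fin 2) (k : ℤ) : Par (i + 1) k ↔ ¬Par i k := by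
  unfold Par
  fin_cases i <;> simp

theorem par_add_one (i : Fin 2) (k : ℤ) : Par i (k + 1) ↔ ¬Par i k := by
  unfold Par
  rw [add_right_comm, Int.even_add_one]

theorem par_sub_one (i : Fin 2) (k : ℤ) : Par i (k - 1) ↔ ¬Par i k := by
  have := par_add_one i (k - 1)
  rw [sub_add_cancel] at this
  tauto

/-- The largest index `≤ k` of the parity of `i`. -/
def floorPar (i : Fin 2) (k : ℤ) : ℤ := if Par i k then k else k - 1

theorem floorPar_of_par {i : Fin 2} {k : ℤ} (h : Par i k) : floorPar i k = k := if_pos h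

theorem floorPar_of_not_par {i : Fin 2} {k : ℤ} (h : ¬Par i k) : floorPar i k = k - 1 := if_neg h

theorem par_floorPar (i : Fin 2) (k : ℤ) : Par i (floorPar i k) := by
  by_cases h : Par i k
  · rwa [floorPar_of_par h]
  · rw [floorPar_of_not_par h, par_sub_one]; exact h

/-- The projection to the sequences that are constant on the pairs `{k, k + 1}` with `k` of the
parity of `i`. -/
def pairProj (i : Fin 2) : (ℤ → ℂ) →ₗ[ℂ] (ℤ → ℂ) := LinearMap.funLeft ℂ ℂ (floorPar i)

theorem pairProj_apply (i : Fin 2) (φ : ℤ → ℂ) (k : ℤ) : pairProj i φ k = φ (floorPar i k) := rfl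

/-- The restriction of a sequence to the indices of the parity of `i`. -/
def parRestrict (i : Fin 2) : (ℤ → ℂ) →ₗ[ℂ] (ℤ → ℂ) where
  toFun φ k := if Par i k then φ k else 0
  map_add' φ ψ := by
    funext k; by_cases h : Par i k <;> simp [h]
  map_smul' c φ := by
    funext k; by_cases h : Par i k <;> simp [h]

theorem parRestrict_apply (i : Fin 2) (φ : ℤ → ℂ) (k : ℤ) :
    parRestrict i φ k = if Par i k then φ k else 0 := rfl

theorem pairProj_parRestrict (i : Fin 2) (φ : ℤ → ℂ) :
    pairProj i (parRestrict i φ) = pairProj i φ := by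
  funext k
  rw [pairProj_apply, parRestrict_apply, if_pos (par_floorPar i k), pairProj_apply]

theorem parRestrict_parRestrict (i k : Fin 2) (φ : ℤ → ℂ) :
    parRestrict i (parRestrict k φ) = if i = k then parRestrict i φ else 0 := by
  funext p
  rcases fin_two_eq_or k i with rfl | rfl
  · rw [if_pos rfl, parRestrict_apply, parRestrict_apply]
    split_ifs <;> rfl
  · rw [if_neg (fin_two_add_one_ne k), parRestrict_apply, parRestrict_apply]
    simp only [par_add_one_left]
    split_ifs <;> rfl

section Ops

variable (x : ℂˣ)

/-- The operator `φ ↦ x⁻¹ φ(p) + x φ(p + 1)`. -/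
def pairSum : (ℤ → ℂ) →ₗ[ℂ] (ℤ → ℂ) :=
  ((x⁻¹ : ℂˣ) : ℂ) • 1 + (x : ℂ) • LinearMap.funLeft ℂ ℂ (· + 1)

theorem pairSum_apply (φ : ℤ → ℂ) (p : ℤ) :
    pairSum x φ p = ((x⁻¹ : ℂˣ) : ℂ) * φ p + x * φ (p + 1) := rfl

/-- The operator `φ ↦ x⁻¹ φ(p - 1) + x φ(p + 1)`. -/
def spread : (ℤ → ℂ) →ₗ[ℂ] (ℤ → ℂ) :=
  ((x⁻¹ : ℂˣ) : ℂ) • LinearMap.funLeft ℂ ℂ (· - 1) + (x : ℂ) • LinearMap.funLeft ℂ ℂ (· + 1)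

theorem spread_apply (φ : ℤ → ℂ) (p : ℤ) :
    spread x φ p = ((x⁻¹ : ℂˣ) : ℂ) * φ (p - 1) + x * φ (p + 1) := rfl

/-- The action of the generators of the Hecke algebra on sequences. -/
def genSeq (i : Fin 2) : (ℤ → ℂ) →ₗ[ℂ] (ℤ → ℂ) :=
  ((x⁻¹ : ℂˣ) : ℂ) • (pairProj i ∘ₗ pairSum x) - 1

theorem genSeq_apply (i : Fin 2) (φ : ℤ → ℂ) (k : ℤ) : genSeq x i φ k =
    ((x⁻¹ : ℂˣ) : ℂ) * (((x⁻¹ : ℂˣ) : ℂ) * φ (floorPar i k) + x * φ (floorPar i k + 1)) - φ k :=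
  rfl

theorem KLop_genSeq (i : Fin 2) (φ : ℤ → ℂ) :
    KLop x (genSeq x) i φ = pairProj i (pairSum x φ) := by
  rw [KLop_apply, genSeq, LinearMap.sub_apply, Module.End.one_apply, add_sub_cancel,
    LinearMap.smul_apply, smul_smul, Units.mul_inv, one_smul, LinearMap.comp_apply]

theorem pairProj_pairSum_pairProj (i : Fin 2) (φ : ℤ → ℂ) :
    pairProj i (pairSum x (pairProj i φ)) = (((x⁻¹ : ℂˣ) : ℂ) + x) • pairProj i φ := by
  funext k
  have h := par_floorPar i k
  have h' : ¬Par i (floorPar i k + 1) := by rw [par_add_one]; exact not_not.2 h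
  rw [pairProj_apply, pairSum_apply, pairProj_apply, pairProj_apply, Pi.smul_apply,
    pairProj_apply, floorPar_of_par h, floorPar_of_not_par h', add_sub_cancel_right, smul_eq_mul,
    add_mul]

/-- At an index `p` of parity `i`, a sequence that is constant on the pairs of the other parity
takes at `p` and `p + 1` the values it has at `p - 1` and `p + 1`. The alternation of the two
reflections thus becomes the single operator `spread`. -/
theorem pairProj_pairSum_pairProj_succ (i : Fin 2) (φ : ℤ → ℂ) :
    pairProj i (pairSum x (pairProj (i + 1) φ)) = pairProj i (spread x φ) := by
  funext k
  have h := par_floorPar i k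
  have h1 : ¬Par (i + 1) (floorPar i k) := by rw [par_add_one_left]; exact not_not.2 h
  have h2 : Par (i + 1) (floorPar i k + 1) := by rw [par_add_one]; exact h1
  rw [pairProj_apply, pairSum_apply, pairProj_apply, pairProj_apply, pairProj_apply,
    floorPar_of_par h2, floorPar_of_not_par h1, spread_apply]

theorem genSeq_genSeq (i : Fin 2) (φ : ℤ → ℂ) : genSeq x i (genSeq x i φ) =
    (((x⁻¹ : ℂˣ) : ℂ) ^ 2 - 1) • genSeq x i φ + ((x⁻¹ : ℂˣ) : ℂ) ^ 2 • φ := by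
  have h : ∀ ψ, genSeq x i ψ = ((x⁻¹ : ℂˣ) : ℂ) • pairProj i (pairSum x ψ) - ψ := fun _ => rfl
  simp only [h, map_sub, map_smul, pairProj_pairSum_pairProj]
  have hx : (x : ℂ) * ((x⁻¹ : ℂˣ) : ℂ) = 1 := x.mul_inv
  have h2 : (((x⁻¹ : ℂˣ) : ℂ) + x) • pairProj i (pairSum x φ) = ((x⁻¹ : ℂˣ) : ℂ) •
      pairProj i (pairSum x φ) + (x : ℂ) • pairProj i (pairSum x φ) := add_smul _ _ _
  rw [h2]
  simp only [smul_add, smul_smul, mul_comm _ (x : ℂ), hx]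
  module

/-- The action of the standard basis of the Hecke algebra on sequences. -/
def wordSeq : Fin 2 → ℕ → (ℤ → ℂ) →ₗ[ℂ] (ℤ → ℂ)
  | _, 0 => 1
  | i, n + 1 => genSeq x i ∘ₗ wordSeq (i + 1) n

theorem wordSeq_succ (i : Fin 2) (n : ℕ) (φ : ℤ → ℂ) :
    wordSeq x i (n + 1) φ = genSeq x i (wordSeq x (i + 1) n φ) := rfl

/-- The images of a sequence under the standard basis of the Hecke algebra. -/
def orbitSeq (φ : ℤ → ℂ) (w : W) : ℤ → ℂ := wordSeq x (start w) (len w) φ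

theorem orbitSeq_e (φ : ℤ → ℂ) (i : Fin 2) (n : ℕ) : orbitSeq x φ (e i n) = wordSeq x i n φ := by
  rcases Nat.eq_zero_or_pos n with rfl | hn
  · rfl
  · rw [orbitSeq, start_e i hn.ne', len_e]

theorem isHeckeFamily_orbitSeq (φ : ℤ → ℂ) : IsHeckeFamily x (orbitSeq x φ) (genSeq x) := by
  intro i w
  obtain ⟨k, n, rfl⟩ : ∃ k n, w = e k n := ⟨_, _, (e_start_len w).symm⟩
  cases n with
  | zero =>
    rw [e_zero, mul_one, len_s, len_one, if_pos one_pos, ← e_one, orbitSeq_e, ← e_zero 0,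
      orbitSeq_e]
    rfl
  | succ n =>
    rcases fin_two_eq_or i k with rfl | rfl
    · rw [s_mul_e_succ, len_e, len_e, if_neg (by omega), orbitSeq_e, orbitSeq_e, wordSeq_succ,
        genSeq_genSeq]
    · rw [← e_succ, len_e, len_e, if_pos (by omega), orbitSeq_e, orbitSeq_e]
      rfl

/-- The Chebyshev polynomials of the operator `spread`. -/
def cheb : ℕ → (ℤ → ℂ) →ₗ[ℂ] (ℤ → ℂ)
  | 0 => 0
  | 1 => 1
  | n + 2 => spread x ∘ₗ cheb (n + 1) - cheb n

theorem cheb_add_two (n : ℕ) (φ : ℤ → ℂ) :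
    cheb x (n + 2) φ = spread x (cheb x (n + 1) φ) - cheb x n φ := rfl

theorem cheb_spread (n : ℕ) (φ : ℤ → ℂ) :
    cheb x n (spread x φ) = spread x (cheb x n φ) := by
  induction n using Nat.twoStepInduction with
  | zero => exact (map_zero (spread x)).symm
  | one => rfl
  | more n ih1 ih2 => rw [cheb_add_two, cheb_add_two, ih1, ih2, map_sub]

/-- The action of the elements `C'_x` on sequences. -/
theorem anti_KL_orbitSeq (φ : ℤ → ℂ) (i : Fin 2) (n : ℕ) :
    anti (KL x (orbitSeq x φ)) i n = pairProj i (cheb x n (pairSum x φ)) := by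
  let R : (Fin 2 → ℤ → ℂ) → (Fin 2 → ℤ → ℂ) := fun z i => pairProj i (pairSum x (z (i + 1)))
  refine congrFun (recursion_unique (z := fun n i => anti (KL x (orbitSeq x φ)) i (n : ℕ))
    (z' := fun n i => pairProj i (cheb x n (pairSum x φ))) R ?_ ?_ ?_ ?_ n) i
  · funext i
    rw [Nat.cast_zero, anti_zero]; rfl
  · funext i
    rw [Nat.cast_one, anti_one, ← KLop_KL_one (isHeckeFamily_orbitSeq x φ), KLop_genSeq, KL,
      sum_lower_one, len_one, pow_zero, one_smul]
    rfl
  · intro n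
    funext i
    have := KLop_anti_succ (isHeckeFamily_orbitSeq x φ) i (n + 1 : ℕ)
    rw [KLop_genSeq, show ((n + 1 : ℕ) : ℤ) + 1 = (n + 2 : ℕ) by push_cast; ring,
      show ((n + 1 : ℕ) : ℤ) - 1 = n by push_cast; ring] at this
    exact (sub_eq_of_eq_add this).symm
  · intro n
    funext i
    change _ = pairProj i (pairSum x (pairProj (i + 1) _)) - pairProj i _
    rw [pairProj_pairSum_pairProj_succ, cheb_add_two, map_sub]

theorem parRestrict_spread (i : Fin 2) (φ : ℤ → ℂ) :
    parRestrict i (spread x φ) = spread x (parRestrict (i + 1) φ) := by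
  funext k
  rw [parRestrict_apply, spread_apply, spread_apply, parRestrict_apply, parRestrict_apply]
  simp only [par_add_one_left, par_add_one, par_sub_one, not_not]
  split_ifs <;> simp

theorem parRestrict_cheb (i : Fin 2) (n : ℕ) (φ : ℤ → ℂ) :
    parRestrict i (cheb x n φ) = cheb x n (parRestrict (last i n) φ) := by
  induction n using Nat.twoStepInduction generalizing i with
  | zero => exact map_zero _
  | one => rw [last_one]; rfl
  | more n ih1 ih2 =>
    rw [cheb_add_two, cheb_add_two, map_sub, parRestrict_spread, ih1, ih2, last_add_one,
      last_add_two]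

/-- `spread` exchanges parities, so at the positions read by `pairProj i` the operator `cheb n` sees
only entries of the parity of `last i n`. This is the counterpart of the rule in `J` that the
letters that meet must agree. -/
theorem pairProj_cheb_parRestrict (i k : Fin 2) (n : ℕ) (φ : ℤ → ℂ) :
    pairProj i (cheb x n (parRestrict k φ)) =
      if last i n = k then pairProj i (cheb x n φ) else 0 := by
  rw [← pairProj_parRestrict, parRestrict_cheb, parRestrict_parRestrict]
  split_ifs
  · rw [← parRestrict_cheb, pairProj_parRestrict]
  · rw [map_zero, map_zero]

/-- The continuation of `cheb` to negative indices. -/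
def chebZ (m : ℤ) : (ℤ → ℂ) →ₗ[ℂ] (ℤ → ℂ) := m.sign • cheb x m.natAbs

theorem chebZ_natCast (n : ℕ) : chebZ x n = cheb x n := by
  rcases Nat.eq_zero_or_pos n with rfl | hn
  · rw [chebZ, Int.natAbs_natCast, Nat.cast_zero, Int.sign_zero, zero_smul]; rfl
  · rw [chebZ, Int.natAbs_natCast, Int.sign_eq_one_of_pos (by omega), one_smul]

theorem chebZ_neg (m : ℤ) : chebZ x (-m) = -chebZ x m := by
  rw [chebZ, chebZ, Int.sign_neg, Int.natAbs_neg, neg_smul]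

theorem spread_chebZ (φ : ℤ → ℂ) (m : ℤ) :
    spread x (chebZ x m φ) = chebZ x (m + 1) φ + chebZ x (m - 1) φ := by
  induction m using int_antisymm_induction with
  | h0 =>
    have := chebZ_natCast x 0
    rw [Nat.cast_zero] at this
    rw [zero_add, zero_sub, chebZ_neg, LinearMap.neg_apply, add_neg_cancel, this]
    exact map_zero _
  | h1 n =>
    have h2 : (n : ℤ) + 1 + 1 = (n + 2 : ℕ) := by push_cast; ring
    rw [add_sub_cancel_right, h2, ← Nat.cast_succ, chebZ_natCast, chebZ_natCast, chebZ_natCast,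
      cheb_add_two, sub_add_cancel]
  | h2 m ih =>
    rw [chebZ_neg, show -m + 1 = -(m - 1) by ring, show -m - 1 = -(m + 1) by ring, chebZ_neg,
      chebZ_neg, LinearMap.neg_apply, LinearMap.neg_apply, LinearMap.neg_apply, map_neg, ih]
    abel

theorem cheb_cheb (φ : ℤ → ℂ) (n m : ℕ) :
    cheb x n (cheb x m φ) = cg (fun r => chebZ x r φ) n m :=
  recursion_eq_cg (spread x).toAddMonoidHom (fun r => chebZ x r φ) (spread_chebZ x φ) m
    (z := fun n => cheb x n (cheb x m φ)) rfl (by rw [chebZ_natCast]; rfl) (fun _ => rfl) n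

/-- `spread` is `y + y⁻¹` for `y = x⁻¹` times the shift by one, so its Chebyshev polynomial is
`y^(n-1) + y^(n-3) + ... + y^(1-n)`. -/
theorem cheb_eq_cg (φ : ℤ → ℂ) (n : ℕ) :
    cheb x n φ = cg (fun r p => ((x⁻¹ ^ r : ℂˣ) : ℂ) * φ (p - r)) n 0 := by
  refine recursion_eq_cg (spread x).toAddMonoidHom
    (fun r p => ((x⁻¹ ^ r : ℂˣ) : ℂ) * φ (p - r)) ?_ 0 (z := fun n => cheb x n φ) rfl ?_
    (fun _ => rfl) n
  · intro m
    funext p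
    change spread x _ p = _
    rw [spread_apply, Pi.add_apply, zpow_add, zpow_sub, zpow_one, inv_inv, Units.val_mul,
      Units.val_mul, show p - (m + 1) = p - 1 - m by ring, show p - (m - 1) = p + 1 - m by ring]
    ring
  · funext p
    simp [cheb]

end Ops

/-! ### Spaces of sequences -/

/-- The sequences that vanish near `-∞`. -/
def vanishing : Submodule ℂ (ℤ → ℂ) where
  carrier := {φ | ∀ᶠ k in atBot, φ k = 0}
  zero_mem' := Eventually.of_forall fun _ => rfl
  add_mem' {φ ψ} hφ hψ := by
    filter_upwards [hφ, hψ] with k h1 h2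
    rw [Pi.add_apply, h1, h2, add_zero]
  smul_mem' c φ hφ := by
    filter_upwards [hφ] with k h1
    rw [Pi.smul_apply, h1, smul_zero]

/-- The sequences that vanish near `-∞` and have period `r` near `∞`. -/
def periodic (r : ℤ) : Submodule ℂ (ℤ → ℂ) where
  carrier := {φ | φ ∈ vanishing ∧ ∀ᶠ k in atTop, φ (k + r) = φ k}
  zero_mem' := ⟨zero_mem _, Eventually.of_forall fun _ => rfl⟩
  add_mem' {φ ψ} hφ hψ := by
    refine ⟨add_mem hφ.1 hψ.1, ?_⟩
    filter_upwards [hφ.2, hψ.2] with k h1 h2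
    rw [Pi.add_apply, Pi.add_apply, h1, h2]
  smul_mem' c φ hφ := by
    refine ⟨Submodule.smul_mem _ _ hφ.1, ?_⟩
    filter_upwards [hφ.2] with k h1
    rw [Pi.smul_apply, Pi.smul_apply, h1]

theorem tendsto_add_atTop (c : ℤ) : Tendsto (fun k : ℤ => k + c) atTop atTop :=
  tendsto_atTop_add_const_right _ _ tendsto_id

theorem tendsto_add_atBot (c : ℤ) : Tendsto (fun k : ℤ => k + c) atBot atBot :=
  tendsto_atBot_add_const_right _ _ tendsto_id

theorem shift_mem_periodic {r : ℤ} {φ : ℤ → ℂ} (h : φ ∈ periodic r) (c : ℤ) :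
    (fun k => φ (k + c)) ∈ periodic r := by
  refine ⟨(tendsto_add_atBot c).eventually h.1, ?_⟩
  filter_upwards [(tendsto_add_atTop c).eventually h.2] with k hk
  rw [add_right_comm, hk]

/-- `pairProj i` reads only one parity class, on which a sequence of eventual period `2` is
eventually constant. -/
theorem pairProj_mem_periodic {φ : ℤ → ℂ} (h : φ ∈ periodic 2) (i : Fin 2) :
    pairProj i φ ∈ periodic 1 := by
  refine ⟨?_, ?_⟩
  · filter_upwards [h.1, (tendsto_add_atBot (-1)).eventually h.1] with k h1 h2
    rw [pairProj_apply, floorPar]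
    split_ifs
    · exact h1
    · exact h2
  · filter_upwards [(tendsto_add_atTop (-1)).eventually h.2] with k h1
    rw [pairProj_apply, pairProj_apply]
    by_cases hk : Par i k
    · rw [floorPar_of_par hk, floorPar_of_not_par (by rw [par_add_one]; exact not_not.2 hk),
        add_sub_cancel_right]
    · rw [floorPar_of_not_par hk, floorPar_of_par (by rw [par_add_one]; exact hk),
        sub_eq_add_neg, ← h1]
      congr 1; ring

theorem spread_mem_periodic (x : ℂˣ) {r : ℤ} {φ : ℤ → ℂ} (h : φ ∈ periodic r) :
    spread x φ ∈ periodic r :=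
  add_mem (Submodule.smul_mem _ _ (shift_mem_periodic h (-1)))
    (Submodule.smul_mem _ _ (shift_mem_periodic h 1))

theorem pairSum_mem_periodic (x : ℂˣ) {r : ℤ} {φ : ℤ → ℂ} (h : φ ∈ periodic r) :
    pairSum x φ ∈ periodic r :=
  add_mem (Submodule.smul_mem _ _ h) (Submodule.smul_mem _ _ (shift_mem_periodic h 1))

theorem cheb_mem_periodic (x : ℂˣ) {r : ℤ} {φ : ℤ → ℂ} (h : φ ∈ periodic r) (n : ℕ) :
    cheb x n φ ∈ periodic r := by
  induction n using Nat.twoStepInduction with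
  | zero => exact zero_mem _
  | one => exact h
  | more n ih1 ih2 => exact sub_mem (spread_mem_periodic x ih2) ih1

/-- A sequence in `periodic r`, `r > 0`, takes finitely many values. -/
theorem exists_bound {r : ℤ} (hr : 0 < r) {φ : ℤ → ℂ} (h : φ ∈ periodic r) :
    ∃ M, ∀ k, ‖φ k‖ ≤ M := by
  obtain ⟨K, hK⟩ := eventually_atBot.1 h.1
  obtain ⟨N, hN⟩ := eventually_atTop.1 h.2
  obtain ⟨M, hM⟩ := ((Finset.Icc K (N + r)).image fun k => ‖φ k‖).bddAbove
  have h0 : ∀ n : ℕ, ∀ k, k ≤ N + r + n → ‖φ k‖ ≤ max M 0 := by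
    intro n
    induction n with
    | zero =>
      intro k hk
      rcases le_total k K with h1 | h1
      · rw [hK k h1, norm_zero]; exact le_max_right _ _
      · refine (hM ?_).trans (le_max_left _ _)
        simp only [Finset.coe_image, Set.mem_image, Finset.mem_coe, Finset.mem_Icc]
        exact ⟨k, ⟨h1, by simpa using hk⟩, rfl⟩
    | succ n ih =>
      intro k hk
      by_cases h1 : k ≤ N + r + n
      · exact ih k h1
      · have := hN (k - r) (by omega)
        rw [sub_add_cancel] at this
        rw [this]
        exact ih _ (by push_cast at hk; omega)
  exact ⟨max M 0, fun k => h0 (k - (N + r)).toNat k (by omega)⟩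

/-- Each of the `n` terms `x⁻ʳ φ(p - r)` is bounded independently of `n`: for `r ≤ 0` because `|x| ≤
1`, and for large `r > 0` because `φ` vanishes near `-∞`. -/
theorem cheb_bound {x : ℂˣ} (hx : ‖(x : ℂ)‖ ≤ 1) {r : ℤ} (hr : 0 < r) {φ : ℤ → ℂ}
    (h : φ ∈ periodic r) (p : ℤ) : ∃ B, ∀ n : ℕ, ‖cheb x n φ p‖ ≤ n * B := by
  obtain ⟨K, hK⟩ := eventually_atBot.1 h.1
  obtain ⟨M, hM⟩ := exists_bound hr h
  have hx0 : 0 < ‖(x : ℂ)‖ := norm_pos_iff.2 x.ne_zero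
  have hM0 : 0 ≤ M := (norm_nonneg _).trans (hM 0)
  have hx1 : 1 ≤ ‖(x : ℂ)‖⁻¹ := (one_le_inv₀ hx0).2 hx
  have key : ∀ l : ℤ, ‖((x⁻¹ ^ l : ℂˣ) : ℂ) * φ (p - l)‖ ≤ ‖(x : ℂ)‖⁻¹ ^ (p - K) * M := by
    intro l
    by_cases hl : p - l ≤ K
    · rw [hK _ hl, mul_zero, norm_zero]; positivity
    · rw [norm_mul, Units.val_zpow_eq_zpow_val, norm_zpow, Units.val_inv_eq_inv_val, norm_inv]
      exact mul_le_mul (zpow_le_zpow_right₀ hx1 (by omega)) (hM _) (norm_nonneg _) (by positivity)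
  refine ⟨‖(x : ℂ)‖⁻¹ ^ (p - K) * M, fun n => ?_⟩
  rw [cheb_eq_cg, cg, Finset.sum_apply]
  refine (norm_sum_le_of_le _ fun k _ => key _).trans ?_
  rw [Finset.sum_const, Finset.card_range, nsmul_eq_mul]

/-! ### The inverse of `1 + S⁻¹` -/

/-- The alternating sum of a sequence that vanishes near `-∞`. -/
def altSum (φ : ℤ → ℂ) (k : ℤ) : ℂ := ∑' n : ℕ, (-1) ^ n * φ (k - n)

theorem hasFiniteSupport_altSum {φ : ℤ → ℂ} (h : φ ∈ vanishing) (k : ℤ) :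
    Summable fun n : ℕ => (-1) ^ n * φ (k - n) := by
  obtain ⟨K, hK⟩ := eventually_atBot.1 h
  refine summable_of_ne_finset_zero (s := Finset.range (k - K).toNat) fun n hn => ?_
  rw [Finset.mem_range] at hn
  rw [hK _ (by omega), mul_zero]

theorem altSum_add {φ : ℤ → ℂ} (h : φ ∈ vanishing) (k : ℤ) :
    altSum φ k + altSum φ (k - 1) = φ k := by
  have h1 := (hasFiniteSupport_altSum h k).tsum_eq_zero_add
  have h2 : ∑' n : ℕ, (-1) ^ (n + 1) * φ (k - (n + 1 : ℕ)) = -altSum φ (k - 1) := by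
    rw [altSum, ← tsum_neg]
    congr 1
    funext n
    rw [show k - ((n + 1 : ℕ) : ℤ) = k - 1 - n by push_cast; ring]
    ring
  rw [h2] at h1
  rw [altSum, h1]
  simp

theorem altSum_mem_vanishing {φ : ℤ → ℂ} (h : φ ∈ vanishing) : altSum φ ∈ vanishing := by
  obtain ⟨K, hK⟩ := eventually_atBot.1 h
  refine eventually_atBot.2 ⟨K, fun k hk => ?_⟩
  rw [altSum]
  convert! tsum_zero with n
  rw [hK _ (by omega), mul_zero]

/-- Both sequences vanish near `-∞`, and the relation propagates the equality upwards one index at a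
time. -/
theorem eq_altSum {φ ψ : ℤ → ℂ} (hφ : φ ∈ vanishing) (hψ : ψ ∈ vanishing)
    (h : ∀ k, ψ k + ψ (k - 1) = φ k) : ψ = altSum φ := by
  obtain ⟨K, hK⟩ := eventually_atBot.1 (hψ.and (altSum_mem_vanishing hφ))
  have h1 : ∀ n : ℕ, ∀ k, k ≤ K + n → ψ k = altSum φ k := by
    intro n
    induction n with
    | zero =>
      intro k hk
      obtain ⟨h2, h3⟩ := hK k (by simpa using hk)
      rw [h2, h3]
    | succ n ih =>
      intro k hk
      have h2 := h k
      rw [← altSum_add hφ k, ih (k - 1) (by push_cast at hk; omega)] at h2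
      exact add_right_cancel h2
  exact funext fun k => h1 (k - K).toNat k (by omega)

/-- For `ψ = altSum φ` one has `ψ(k + 2) - ψ(k) = φ(k + 2) - φ(k + 1)`, which is eventually zero. -/
theorem altSum_mem_periodic {φ : ℤ → ℂ} (h : φ ∈ periodic 1) : altSum φ ∈ periodic 2 := by
  refine ⟨altSum_mem_vanishing h.1, ?_⟩
  filter_upwards [(tendsto_add_atTop 1).eventually h.2] with k hk
  have h1 := altSum_add h.1 (k + 1 + 1)
  have h2 := altSum_add h.1 (k + 1)
  rw [add_sub_cancel_right] at h1 h2
  rw [show k + 2 = k + 1 + 1 by ring]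
  linear_combination h1 - h2 + hk

/-- Exactly one of `k`, `k - 1` has the parity of `i`, and it is `floorPar i k`; so the restricted
sequence solves the equation that characterizes `altSum`. -/
theorem altSum_pairProj (i : Fin 2) {φ : ℤ → ℂ} (h : pairProj i φ ∈ vanishing) :
    altSum (pairProj i φ) = parRestrict i φ := by
  refine (eq_altSum h ?_ fun k => ?_).symm
  · filter_upwards [h] with k hk
    rw [parRestrict_apply]
    split_ifs with h1
    · rwa [pairProj_apply, floorPar_of_par h1] at hk
    · rfl
  · rw [parRestrict_apply, parRestrict_apply, pairProj_apply]
    simp only [par_sub_one]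
    by_cases h1 : Par i k
    · rw [if_pos h1, if_neg (not_not.2 h1), add_zero, floorPar_of_par h1]
    · rw [if_neg h1, if_pos h1, zero_add, floorPar_of_not_par h1]

/-- The factor `spread + (x + x⁻¹)` is the one on which the three-term recursion of `tau`
telescopes; what remains of `pairSum` is `altSum`. -/
theorem pairSum_eq (x : ℂˣ) {φ : ℤ → ℂ} (h : φ ∈ vanishing) : pairSum x φ =
    spread x (altSum φ) + ((x : ℂ) + ((x⁻¹ : ℂˣ) : ℂ)) • altSum φ := by
  funext k
  have h1 := altSum_add h k
  have h2 := altSum_add h (k + 1)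
  rw [add_sub_cancel_right] at h2
  rw [pairSum_apply, Pi.add_apply, spread_apply, Pi.smul_apply, smul_eq_mul, ← h1, ← h2]
  ring

end

section

open Filter

/-! ### The action of the asymptotic algebra on sequences -/

/-- The alternating sum as a linear map. -/
def altSumHom : periodic 1 →ₗ[ℂ] (ℤ → ℂ) where
  toFun φ := altSum φ.1
  map_add' φ ψ := by
    refine (eq_altSum (φ + ψ).2.1 (add_mem (altSum_mem_vanishing φ.2.1)
      (altSum_mem_vanishing ψ.2.1)) fun k => ?_).symm
    rw [Submodule.coe_add, Pi.add_apply, Pi.add_apply, Pi.add_apply, ← altSum_add φ.2.1,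
      ← altSum_add ψ.2.1]
    ring
  map_smul' c φ := by
    refine (eq_altSum (c • φ).2.1 (Submodule.smul_mem _ _ (altSum_mem_vanishing φ.2.1))
      fun k => ?_).symm
    rw [Submodule.coe_smul, Pi.smul_apply, RingHom.id_apply, Pi.smul_apply, Pi.smul_apply,
      ← altSum_add φ.2.1, smul_add]

section Action

variable (x : ℂˣ)

/-- The action of the basis elements of the asymptotic algebra on sequences. -/
def actSeq (i : Fin 2) (n : ℕ) : Module.End ℂ (periodic 1) :=
  ((-1 : ℂ) ^ (n + 1) • (pairProj i ∘ₗ cheb x n ∘ₗ altSumHom)).codRestrict (periodic 1) fun φ =>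
    Submodule.smul_mem _ _ (pairProj_mem_periodic
      (cheb_mem_periodic x (altSum_mem_periodic φ.2) n) i)

theorem actSeq_apply (i : Fin 2) (n : ℕ) (φ : periodic 1) :
    (actSeq x i n φ).1 = (-1 : ℂ) ^ (n + 1) • pairProj i (cheb x n (altSum φ.1)) := rfl

/-- The action of `t_w` on sequences. -/
def actBasis (w : W) : Module.End ℂ (periodic 1) := actSeq x (start w) (len w)

theorem actSeq_zero (i : Fin 2) : actSeq x i 0 = 0 := by
  ext φ k
  rw [actSeq_apply]
  change (-1 : ℂ) ^ (0 + 1) * 0 = 0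
  rw [mul_zero]

theorem actBasis_one : actBasis x 1 = 0 := actSeq_zero x _

theorem actBasis_e (i : Fin 2) (n : ℕ) : actBasis x (e i n) = actSeq x i n := by
  rcases Nat.eq_zero_or_pos n with rfl | hn
  · rw [e_zero, actBasis_one, actSeq_zero]
  · rw [actBasis, start_e i hn.ne', len_e]

/-- The inner `altSum ∘ pairProj` is a restriction to one parity, which the outer projection
absorbs. There remains `cheb n ∘ cheb m`, which expands as the product in `mulBasis_same` does. -/
theorem actSeq_mul_same (i : Fin 2) (n m : ℕ) :
    actSeq x i n * actSeq x (last i n) m = cg (anti (actBasis x) i) n m := by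
  refine LinearMap.ext fun φ => Subtype.ext ?_
  rw [Module.End.mul_apply, actSeq_apply, ← map_smul]
  have h := (actSeq x (last i n) m φ).2.1
  rw [actSeq_apply, ← map_smul] at h
  rw [actSeq_apply, ← map_smul (pairProj _) _ (cheb x m _)]
  rw [altSum_pairProj _ h, map_smul, pairProj_cheb_parRestrict, if_pos rfl, map_smul, map_smul, smul_smul,
    cheb_cheb]
  have h1 : (cg (anti (actBasis x) i) n m φ).1 =
      cg (fun r => (anti (actBasis x) i r φ).1) n m := by
    rw [cg, LinearMap.sum_apply, Submodule.coe_sum]; rfl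
  rw [h1, map_cg, cg, cg, Finset.smul_sum]
  refine Finset.sum_congr rfl fun k _ => ?_
  obtain ⟨r, hr⟩ : ∃ r : ℤ, r = m + n - 1 - 2 * k := ⟨_, rfl⟩
  rw [← hr]
  -- All `r` in the Clebsch-Gordan sum have the parity of `m + n - 1`, so the signs agree term by
  -- term.
  have h2 : (-1 : ℂ) ^ (n + 1) * (-1) ^ (m + 1) = (-1) ^ (r.natAbs + 1) := by
    rw [← pow_add]
    refine (neg_one_pow_congr ?_)
    rw [← Int.even_coe_nat, ← Int.even_coe_nat]
    push_cast
    rw [Int.even_add_one, even_abs, hr]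
    simp only [Int.even_add, Int.even_sub, Int.even_mul]
    simp
    rw [← Nat.not_even_iff_odd, ← Nat.not_even_iff_odd]
    tauto
  rw [h2, anti, actBasis_e, chebZ, LinearMap.smul_apply, LinearMap.smul_apply,
    Submodule.coe_smul_of_tower, actSeq_apply, map_zsmul, smul_comm]

theorem actSeq_mul_other (i : Fin 2) (n m : ℕ) :
    actSeq x i n * actSeq x (last i n + 1) m = 0 := by
  refine LinearMap.ext fun φ => Subtype.ext ?_
  rw [Module.End.mul_apply, actSeq_apply, ← map_smul]
  have h := (actSeq x (last i n + 1) m φ).2.1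
  rw [actSeq_apply, ← map_smul] at h
  rw [actSeq_apply, ← map_smul (pairProj _) _ (cheb x m _)]
  rw [altSum_pairProj _ h, map_smul, pairProj_cheb_parRestrict,
    if_neg (fin_two_add_one_ne _).symm, smul_zero]
  rfl

/-- The action of the asymptotic algebra on sequences, as an additive map. -/
def act : J →+ Module.End ℂ (periodic 1) :=
  Finsupp.liftAddHom (N := Module.End ℂ (periodic 1)) fun w => zmultiplesHom _ (actBasis x w)

theorem act_eq_sum (m : J) :
    act x m = (show W →₀ ℤ from m).sum fun w n => n • actBasis x w := rfl

theorem act_t (w : W) : act x (t w) = actBasis x w := by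
  exact (Finsupp.liftAddHom_apply_single _ _ _).trans (one_smul ℤ _)

theorem act_anti (i : Fin 2) (m : ℤ) : act x (anti t i m) = anti (actBasis x) i m := by
  rw [map_anti]
  congr 1
  funext w
  exact act_t x w

theorem act_mulBasis (y z : W) : act x (mulBasis y z) = actBasis x y * actBasis x z := by
  rcases eq_one_or_eq_e y with rfl | ⟨i, n, rfl⟩
  · rw [actBasis_one, zero_mul]
    rcases eq_one_or_eq_e z with rfl | ⟨k, m, rfl⟩
    · rw [mulBasis_one_one, act_t, actBasis_one]
    · rw [mulBasis_one_e, map_zero]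
  · rcases eq_one_or_eq_e z with rfl | ⟨k, m, rfl⟩
    · rw [mulBasis_e_one, map_zero, actBasis_one, mul_zero]
    · rw [actBasis_e, actBasis_e]
      rcases fin_two_eq_or (last i (n + 1)) k with rfl | rfl
      · rw [mulBasis_same, actSeq_mul_same, map_cg]
        simp only [act_anti]
      · rw [mulBasis_other, actSeq_mul_other, map_zero]

theorem act_mul (m n : J) : act x (m * n) = act x m * act x n := by
  change act x ((show W →₀ ℤ from m).sum fun y k => (show W →₀ ℤ from n).sum fun z l =>
    (k * l) • mulBasis y z) = _
  rw [map_finsuppSum, act_eq_sum, Finsupp.sum_mul]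
  refine Finsupp.sum_congr fun y _ => ?_
  rw [map_finsuppSum, act_eq_sum, Finsupp.mul_sum]
  refine Finsupp.sum_congr fun z _ => ?_
  rw [map_zsmul, act_mulBasis, smul_mul_smul_comm]

/-- The two values of `floorPar` are `k` and `k - 1` in some order. Hence `t (s 0)` and `t (s 1)`
act as idempotents that already add up to the identity. -/
theorem actSeq_one_add (φ : periodic 1) (i : Fin 2) (k : ℤ) :
    altSum φ.1 (floorPar i k) + altSum φ.1 (floorPar (i + 1) k) = φ.1 k := by
  rw [← altSum_add φ.2.1]
  by_cases h : Par i k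
  · rw [floorPar_of_par h, floorPar_of_not_par (by rw [par_add_one_left]; exact not_not.2 h)]
  · rw [floorPar_of_not_par h, floorPar_of_par (by rw [par_add_one_left]; exact h), add_comm]

theorem act_one : act x 1 = 1 := by
  change act x (∑ d ∈ distinguished, t d) = 1
  rw [distinguished, Finset.sum_insert, Finset.sum_pair (by rw [Ne, s_inj]; decide), map_add,
    map_add, act_t, act_t, act_t, actBasis_one, zero_add, ← e_one, ← e_one, actBasis_e, actBasis_e]
  · refine LinearMap.ext fun φ => Subtype.ext (funext fun k => ?_)
    rw [LinearMap.add_apply, Submodule.coe_add, actSeq_apply, actSeq_apply, Pi.add_apply,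
      Pi.smul_apply, Pi.smul_apply, pairProj_apply, pairProj_apply]
    simp only [one_add_one_eq_two, even_two, Even.neg_pow, one_pow, one_smul]
    exact actSeq_one_add φ 0 k
  · simp [(s_ne_one _).symm]

end Action

/-! ### Summation -/

theorem hasSum_W {M : Type*} [AddCommMonoid M] [TopologicalSpace M] [ContinuousAdd M] {f : W → M}
    {b : Fin 2 → M} (h : ∀ i, HasSum (fun n => f (e i (n + 1))) (b i)) :
    HasSum f (f 1 + b 0 + b 1) := by
  have hinj : ∀ i, Function.Injective fun n => e i (n + 1) := fun i n m hnm => by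
    have := (e_inj.1 hnm).1
    omega
  have h1 : ∀ i, HasSum (Function.extend (fun n => e i (n + 1)) (fun n => f (e i (n + 1))) 0)
      (b i) := fun i => (hasSum_extend_zero (hinj i)).2 (h i)
  have h2 : f = (fun w => (if w = 1 then f 1 else 0) +
      Function.extend (fun n => e 0 (n + 1)) (fun n => f (e 0 (n + 1))) 0 w +
      Function.extend (fun n => e 1 (n + 1)) (fun n => f (e 1 (n + 1))) 0 w) := by
    funext w
    have h3 : ∀ i, (∀ n, w ≠ e i (n + 1)) → Function.extend (fun n => e i (n + 1))
        (fun n => f (e i (n + 1))) 0 w = 0 := fun i hi =>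
      Function.extend_apply' _ _ _ (by rintro ⟨n, rfl⟩; exact hi n rfl)
    rcases eq_one_or_eq_e w with rfl | ⟨i, n, rfl⟩
    · rw [if_pos rfl, h3 0 fun n => (e_ne_one n.succ_ne_zero).symm,
        h3 1 fun n => (e_ne_one n.succ_ne_zero).symm, add_zero, add_zero]
    · rw [if_neg (e_ne_one n.succ_ne_zero), zero_add]
      rcases fin_two_eq_or 0 i with rfl | rfl
      · rw [(hinj 0).extend_apply, h3 1 fun m => by rw [Ne, e_inj]; simp, add_zero]
      · rw [h3 0 fun m => by rw [Ne, e_inj]; simp]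
        exact ((zero_add _).trans ((hinj 1).extend_apply (fun n => f (e 1 (n + 1))) 0 n)).symm
  have h3 := ((hasSum_ite_eq 1 (f 1)).add (h1 0)).add (h1 1)
  rwa [← h2] at h3

/-- Summation by parts for a three-term recursion. -/
theorem sum_by_parts {β d s : ℕ → ℂ} {c : ℂ} (h0 : d 0 = 0)
    (hβ : ∀ n, β n - c * β (n + 1) + β (n + 2) = s n) (N : ℕ) :
    ∑ n ∈ Finset.range N, (-1) ^ (n + 1) * β (n + 1) * (d (n + 2) + c * d (n + 1) + d n) =
      -∑ n ∈ Finset.range N, (-1) ^ (n + 1) * s n * d (n + 1) - β 0 * d 1 +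
        (-1) ^ N * (β N * d (N + 1) + β (N + 1) * d N) := by
  induction N with
  | zero => simp [h0]
  | succ N ih =>
    rw [Finset.sum_range_succ, Finset.sum_range_succ, ih, ← hβ N]
    ring

theorem summable_mul_of_bound {r : ℝ} (hr0 : 0 ≤ r) (hr : r < 1) {β g : ℕ → ℂ} {B C : ℝ}
    (hβ : ∀ n, ‖β n‖ ≤ C * r ^ n) (hg : ∀ n : ℕ, ‖g n‖ ≤ (n + 1) * B) :
    Summable fun n => ‖β n * g n‖ := by
  have hr' : ‖r‖ < 1 := by rwa [Real.norm_of_nonneg hr0]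
  have h := (summable_pow_mul_geometric_of_norm_lt_one 1 hr').add
    (summable_geometric_of_norm_lt_one hr')
  refine Summable.of_nonneg_of_le (fun _ => norm_nonneg _) (fun n => ?_) (h.mul_left (C * B))
  rw [norm_mul, pow_one]
  calc ‖β n‖ * ‖g n‖ ≤ (C * r ^ n) * ((n + 1) * B) :=
        mul_le_mul (hβ n) (hg n) (norm_nonneg _) ((norm_nonneg _).trans (hβ n))
    _ = C * B * (n * r ^ n + r ^ n) := by ring

/-- The geometric decay of `β` beats the linear growth of `d` and `g`, so the series converges and
the boundary term at `N` tends to `0`. -/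
theorem hasSum_by_parts {r : ℝ} (hr0 : 0 ≤ r) (hr : r < 1) {β d g s : ℕ → ℂ} {c : ℂ} {B B' C : ℝ}
    {S : ℂ} (hβ' : ∀ n, ‖β n‖ ≤ C * r ^ n) (hd : ∀ n : ℕ, ‖d n‖ ≤ n * B)
    (hg' : ∀ n : ℕ, ‖g n‖ ≤ n * B') (hg : ∀ n, g (n + 1) = d (n + 2) + c * d (n + 1) + d n)
    (hβ : ∀ n, β n - c * β (n + 1) + β (n + 2) = s n)
    (hs : HasSum (fun n => (-1) ^ (n + 1) * s n * d (n + 1)) S) :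
    HasSum (fun n => (-1) ^ (n + 1) * β (n + 1) * g (n + 1)) (-S - β 0 * d 1) := by
  have hle : ∀ {f : ℕ → ℂ} {B : ℝ}, (∀ n : ℕ, ‖f n‖ ≤ n * B) → 0 ≤ B := fun {f B} hf => by
    have := (norm_nonneg (f 1)).trans (hf 1)
    rwa [Nat.cast_one, one_mul] at this
  -- The bound `n * B` is without an additive constant, and at `n = 0` it gives the initial value
  -- that `sum_by_parts` needs.
  have h0 : d 0 = 0 := by
    have := hd 0
    rw [Nat.cast_zero, zero_mul] at this
    exact norm_le_zero_iff.1 this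
  have hβ1 : ∀ n, ‖β (n + 1)‖ ≤ C * r * r ^ n := fun n => (hβ' (n + 1)).trans_eq (by ring)
  have hd1 : ∀ n : ℕ, ‖d (n + 1)‖ ≤ (n + 1) * B := fun n => by exact_mod_cast hd (n + 1)
  have hd0 : ∀ n : ℕ, ‖d n‖ ≤ (n + 1) * B := fun n =>
    (hd n).trans (mul_le_mul_of_nonneg_right (by linarith) (hle hd))
  have hsum : Summable fun n => (-1) ^ (n + 1) * β (n + 1) * g (n + 1) := by
    refine Summable.of_norm ?_
    have := summable_mul_of_bound hr0 hr (g := fun n => g (n + 1)) (B := B') hβ1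
      fun n => by exact_mod_cast hg' (n + 1)
    refine this.congr fun n => ?_
    rw [mul_assoc, norm_mul ((-1 : ℂ) ^ (n + 1)), norm_pow, norm_neg, norm_one, one_pow, one_mul]
  rw [hsum.hasSum_iff_tendsto_nat]
  simp only [hg]
  simp only [sum_by_parts h0 hβ]
  have h1 := (summable_mul_of_bound hr0 hr hβ' hd1).tendsto_atTop_zero
  have h2 := (summable_mul_of_bound hr0 hr hβ1 hd0).tendsto_atTop_zero
  have h3 : Tendsto (fun N => (-1 : ℂ) ^ N * (β N * d (N + 1) + β (N + 1) * d N)) atTop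
      (nhds 0) := by
    have h4 := h1.add h2
    rw [add_zero] at h4
    refine squeeze_zero_norm (fun N => ?_) h4
    rw [norm_mul, norm_pow, norm_neg, norm_one, one_pow, one_mul]
    exact norm_add_le _ _
  simpa using (hs.tendsto_sum_nat.neg.sub_const (β 0 * d 1)).add h3

/-! ### The series of `t_w` as an operator on sequences. -/

section Convergence

variable {x : ℂˣ} {σ : A →+* ℂ}

/-- The relation of `isPhiJ_iff` is pulled back from series to Laurent polynomials, where it can be
specialized. -/
theorem tau_recursion (w : W) (i : Fin 2) (n : ℕ) :
    (-1) ^ n * tau w (e i n) + (-1) ^ (n + 1) * tau w (e i (n + 1)) * kappa +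
      (-1) ^ (n + 2) * tau w (e i (n + 2)) = if w = e i (n + 1) then 1 else 0 := by
  have h := ((isPhiJ_iff _ _).1 (isPhiJ_tau w)).2 i n
  have hinj : Function.Injective toSeriesHom := fun p r h => by
    refine LaurentPolynomial.ext fun k => ?_
    rw [← coeff_toSeries, ← coeff_toSeries]
    exact congrArg (fun f : LaurentSeries ℤ => f.coeff k) h
  apply hinj
  simp only [map_add, map_mul, map_pow, map_neg, map_one]
  refine h.trans ?_
  by_cases hw : w = e i (n + 1)
  · rw [if_pos hw, hw, Pi.single_eq_same, map_one]
  · rw [if_neg hw, Pi.single_eq_of_ne (Ne.symm hw), map_zero]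

/-- `green n m` has at most `m` terms, with exponents at least `n - m`; with `m = len w` this gives
the constant `len w * ‖x‖ ^ (-len w)`. -/
theorem norm_specialize_tau_le (hσ : ∀ n, σ (v n) = ((x ^ n : ℂˣ) : ℂ)) (hx : ‖(x : ℂ)‖ < 1)
    (w : W) : ∃ C, ∀ y, ‖σ (tau w y)‖ ≤ C * ‖(x : ℂ)‖ ^ len y := by
  have hx0 : 0 < ‖(x : ℂ)‖ := norm_pos_iff.2 x.ne_zero
  have hsign : ∀ (n : ℕ) (p : A), ‖σ ((-1) ^ n * p)‖ = ‖σ p‖ := fun n p => by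
    rw [map_mul, map_pow, map_neg, map_one, norm_mul, norm_pow, norm_neg, norm_one, one_pow,
      one_mul]
  have hv : ∀ n : ℤ, ‖σ (v n)‖ = ‖(x : ℂ)‖ ^ n := fun n => by
    rw [hσ, Units.val_zpow_eq_zpow_val, norm_zpow]
  by_cases hw : w = 1
  · refine ⟨1, fun y => ?_⟩
    rw [hw, tau_one_left, hsign, hv, one_mul, zpow_natCast]
  · refine ⟨len w * ‖(x : ℂ)‖ ^ (-(len w : ℤ)), fun y => ?_⟩
    rw [tau, if_neg hw]
    split_ifs with hs
    · rw [hsign, green, cg, map_sum, mul_assoc, ← zpow_natCast, ← zpow_add₀ hx0.ne']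
      refine (norm_sum_le_of_le (n := fun _ => ‖(x : ℂ)‖ ^ (-(len w : ℤ) + len y)) _
        fun k hk => ?_).trans ?_
      · rw [Finset.mem_range] at hk
        rw [hv]
        exact zpow_le_zpow_right_of_le_one₀ hx0 hx.le (by omega)
      · rw [Finset.sum_const, Finset.card_range, nsmul_eq_mul]
        exact mul_le_mul_of_nonneg_right (by exact_mod_cast min_le_right _ _) (by positivity)
    · rw [map_zero, norm_zero]; positivity

theorem KL_orbitSeq_bound (hx : ‖(x : ℂ)‖ < 1) {φ : ℤ → ℂ} (hφ : φ ∈ periodic 1) (i : Fin 2)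
    (k : ℤ) : ∃ B, ∀ n : ℕ, ‖KL x (orbitSeq x φ) (e i (n + 1)) k‖ ≤ (n + 1) * B := by
  obtain ⟨B, hB⟩ := cheb_bound hx.le one_pos (pairSum_mem_periodic x hφ) (floorPar i k)
  refine ⟨B, fun n => ?_⟩
  rw [← anti_natCast_succ (KL x _), ← Nat.cast_succ, anti_KL_orbitSeq, pairProj_apply]
  exact_mod_cast hB (n + 1)

theorem summable_norm_tau_mul (hσ : ∀ n, σ (v n) = ((x ^ n : ℂˣ) : ℂ)) (hx : ‖(x : ℂ)‖ < 1)
    (w : W) {φ : ℤ → ℂ} (hφ : φ ∈ periodic 1) (k : ℤ) :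
    Summable fun y => ‖σ (tau w y) * KL x (orbitSeq x φ) y k‖ := by
  have h : ∀ i, Summable fun n => ‖σ (tau w (e i (n + 1))) *
      KL x (orbitSeq x φ) (e i (n + 1)) k‖ := by
    intro i
    obtain ⟨C, hC⟩ := norm_specialize_tau_le hσ hx w
    obtain ⟨B, hB⟩ := KL_orbitSeq_bound hx hφ i k
    refine summable_mul_of_bound (β := fun n => σ (tau w (e i (n + 1))))
      (g := fun n => KL x (orbitSeq x φ) (e i (n + 1)) k) (C := C * ‖(x : ℂ)‖) (norm_nonneg _) hx (fun n => ?_) hB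
    refine (hC _).trans_eq ?_
    rw [len_e]; ring
  exact (hasSum_W (f := fun y => ‖σ (tau w y) * KL x (orbitSeq x φ) y k‖)
    fun i => (h i).hasSum).summable

/-- The sum of the actions of the `C'_y`, with the coefficients of `(φ ∘ j)⁻¹ (t_w)`, is the action
of `t_w`. -/
theorem hasSum_tau_mul (hσ : ∀ n, σ (v n) = ((x ^ n : ℂˣ) : ℂ)) (hx : ‖(x : ℂ)‖ < 1)
    (w : W) (φ : periodic 1) (k : ℤ) :
    HasSum (fun y => σ (tau w y) * KL x (orbitSeq x φ.1) y k) ((actBasis x w φ).1 k) := by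
  obtain ⟨C, hC⟩ := norm_specialize_tau_le hσ hx w
  have hK : σ kappa = -((x : ℂ) + ((x⁻¹ : ℂˣ) : ℂ)) := by
    rw [kappa, map_neg, map_add, hσ, hσ, zpow_one, zpow_neg_one]
  -- The words with first letter `i` are summed separately. `S` comes from the source of the
  -- recursion at `w`; the other term is the boundary term at length `0`, with the coefficient at
  -- the identity.
  have main : ∀ i S, HasSum (fun n => (-1) ^ (n + 1) * (if w = e i (n + 1) then (1 : ℂ) else 0) *
      cheb x (n + 1) (altSum φ.1) (floorPar i k)) S →
      HasSum (fun n => σ (tau w (e i (n + 1))) * KL x (orbitSeq x φ.1) (e i (n + 1)) k)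
        (-S - σ (tau w 1) * altSum φ.1 (floorPar i k)) := by
    intro i S hS
    obtain ⟨B, hB⟩ := cheb_bound hx.le two_pos (altSum_mem_periodic φ.2) (floorPar i k)
    obtain ⟨B', hB'⟩ := cheb_bound hx.le one_pos (pairSum_mem_periodic x φ.2) (floorPar i k)
    have h2 : ∀ n : ℕ, (-1 : ℂ) ^ n * (-1) ^ n = 1 := fun n => by rw [← mul_pow]; simp
    have hβ : ∀ n, ‖(-1) ^ n * σ (tau w (e i n))‖ ≤ C * ‖(x : ℂ)‖ ^ n := fun n => by
      rw [norm_mul, norm_pow, norm_neg, norm_one, one_pow, one_mul]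
      exact (hC _).trans_eq (by rw [len_e])
    have hrec : ∀ n, (-1) ^ n * σ (tau w (e i n)) - ((x : ℂ) + ((x⁻¹ : ℂˣ) : ℂ)) *
        ((-1) ^ (n + 1) * σ (tau w (e i (n + 1)))) + (-1) ^ (n + 2) * σ (tau w (e i (n + 2))) =
        if w = e i (n + 1) then (1 : ℂ) else 0 := fun n => by
      have h := congrArg σ (tau_recursion w i n)
      simp only [map_add, map_mul, map_pow, map_neg, map_one, hK] at h
      have h3 : σ (if w = e i (n + 1) then 1 else 0) = if w = e i (n + 1) then (1 : ℂ) else 0 := by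
        split_ifs
        · exact map_one σ
        · exact map_zero σ
      rw [← h3, ← h]
      ring
    -- By `pairSum_eq` the action of `C'` is the three-term expression in `cheb n (altSum φ)` that
    -- `hasSum_by_parts` expects.
    have hg : ∀ n, cheb x (n + 1) (pairSum x φ.1) (floorPar i k) =
        cheb x (n + 2) (altSum φ.1) (floorPar i k) + ((x : ℂ) + ((x⁻¹ : ℂˣ) : ℂ)) *
          cheb x (n + 1) (altSum φ.1) (floorPar i k) + cheb x n (altSum φ.1) (floorPar i k) :=
      fun n => by
        rw [pairSum_eq x φ.2.1, map_add, map_smul, cheb_spread, cheb_add_two, Pi.add_apply,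
          Pi.smul_apply, Pi.sub_apply, smul_eq_mul]
        ring
    have h1 := hasSum_by_parts (norm_nonneg _) hx hβ hB hB' hg hrec hS
    simp only [← mul_assoc, h2, pow_zero, one_mul, e_zero] at h1
    convert! h1 using 1
    funext n
    rw [← anti_natCast_succ (KL x _), ← Nat.cast_succ, anti_KL_orbitSeq, pairProj_apply]
  have hKL : KL x (orbitSeq x φ.1) 1 = φ.1 := by
    rw [KL, sum_lower_one, len_one, pow_zero, one_smul]; rfl
  rcases eq_one_or_eq_e w with rfl | ⟨j, m, rfl⟩
  -- For `w = 1` there is no source. The boundary terms of the two first letters add up to `-φ k`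
  -- and cancel the term of the identity, so `t_1` acts by `0`.
  · have hzero : ∀ i, HasSum (fun n => (-1) ^ (n + 1) *
        (if (1 : W) = e i (n + 1) then (1 : ℂ) else 0) *
        cheb x (n + 1) (altSum φ.1) (floorPar i k)) 0 := fun i => by
      convert! hasSum_zero with n
      rw [if_neg (e_ne_one n.succ_ne_zero).symm, mul_zero, zero_mul]
    convert! hasSum_W (f := fun y => σ (tau _ y) * KL x (orbitSeq x φ.1) y k) fun i => main i 0 (hzero i) using 1
    rw [tau_one_left, len_one, pow_zero, one_mul, hσ, Nat.cast_zero, zpow_zero, Units.val_one,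
      hKL, actBasis_one, one_mul, one_mul, ← actSeq_one_add φ 0 k]
    change (0 : ℂ) = _
    rw [zero_add]
    ring
  · have h0 : σ (tau (e j (m + 1)) 1) = 0 := by
      rw [tau_one_right (e_ne_one m.succ_ne_zero), map_zero]
    have hS : ∀ i, HasSum (fun n => (-1) ^ (n + 1) *
        (if e j (m + 1) = e i (n + 1) then (1 : ℂ) else 0) *
        cheb x (n + 1) (altSum φ.1) (floorPar i k))
        (if i = j then (-1) ^ (m + 1) * cheb x (m + 1) (altSum φ.1) (floorPar j k) else 0) :=
      fun i => by
        by_cases hij : i = j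
        · subst hij
          have h3 : HasSum (fun n => (-1) ^ (n + 1) *
              (if e i (m + 1) = e i (n + 1) then (1 : ℂ) else 0) *
              cheb x (n + 1) (altSum φ.1) (floorPar i k)) _ := hasSum_single m fun n hn => by
            rw [if_neg, mul_zero, zero_mul]
            rw [e_inj]; omega
          rw [if_pos rfl, mul_one] at h3
          rwa [if_pos rfl]
        · rw [if_neg hij]
          convert! hasSum_zero with n
          rw [if_neg, mul_zero, zero_mul]
          rw [e_inj]
          rintro ⟨-, h | h⟩
          · omega
          · exact hij h.symm
    convert! hasSum_W (f := fun y => σ (tau _ y) * KL x (orbitSeq x φ.1) y k) fun i => main i _ (hS i) using 1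
    rw [actBasis_e, actSeq_apply, Pi.smul_apply, pairProj_apply, smul_eq_mul, h0]
    rcases fin_two_eq_or 0 j with rfl | rfl
    · simp [pow_succ]
    · simp [pow_succ]

end Convergence

end

section

open ValuativeRel Filter

/-! ### Lattices in the plane -/

section Lattice

variable {F : Type*} [Field F] {ϖ : Fˣ}

/-- A vector of given index. -/
def stdVec (ϖ : Fˣ) (k : ℤ) : Fin 2 → F :=
  if Even k then ![0, ((ϖ ^ (k / 2) : Fˣ) : F)] else ![((ϖ ^ (k / 2) : Fˣ) : F), 0]

theorem stdVec_even (ϖ : Fˣ) (m : ℤ) : stdVec ϖ (2 * m) = ![0, ((ϖ ^ m : Fˣ) : F)] := by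
  rw [stdVec, if_pos (even_two_mul m), show 2 * m / 2 = m by omega]

theorem stdVec_odd (ϖ : Fˣ) (m : ℤ) : stdVec ϖ (2 * m + 1) = ![((ϖ ^ m : Fˣ) : F), 0] := by
  rw [stdVec, if_neg (by rw [Int.not_even_iff_odd]; exact odd_two_mul_add_one m),
    show (2 * m + 1) / 2 = m by omega]

theorem stdVec_ne_zero (k : ℤ) : stdVec ϖ k ≠ 0 := by
  obtain ⟨m, rfl | rfl⟩ : ∃ m, k = 2 * m ∨ k = 2 * m + 1 := ⟨k / 2, by omega⟩
  · rw [stdVec_even]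
    exact fun h => (ϖ ^ m).ne_zero (congrFun h 1)
  · rw [stdVec_odd]
    exact fun h => (ϖ ^ m).ne_zero (congrFun h 0)

theorem mulVec_zero_apply (g : Matrix (Fin 2) (Fin 2) F) (p : Fin 2 → F) :
    g.mulVec p 0 = g 0 0 * p 0 + g 0 1 * p 1 := by
  simp [Matrix.mulVec, dotProduct, Fin.sum_univ_two]

theorem mulVec_one_apply (g : Matrix (Fin 2) (Fin 2) F) (p : Fin 2 → F) :
    g.mulVec p 1 = g 1 0 * p 0 + g 1 1 * p 1 := by
  simp [Matrix.mulVec, dotProduct, Fin.sum_univ_two]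

theorem mulVec_mulVec_inv (g : SL2 F) (p : Fin 2 → F) :
    g.1.mulVec ((g⁻¹).1.mulVec p) = p := by
  rw [Matrix.mulVec_mulVec, ← Matrix.SpecialLinearGroup.coe_mul, mul_inv_cancel,
    Matrix.SpecialLinearGroup.coe_one, Matrix.one_mulVec]

theorem mulVec_ne_zero (g : SL2 F) {p : Fin 2 → F} (hp : p ≠ 0) : g.1.mulVec p ≠ 0 := by
  intro h
  apply hp
  have := mulVec_mulVec_inv g⁻¹ p
  rw [inv_inv, h, Matrix.mulVec_zero] at this
  exact this.symm

variable [ValuativeRel F]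

theorem isUnit_integer_iff (x : 𝒪[F]) : IsUnit x ↔ valuation F x = 1 :=
  (Valuation.integer.integers (valuation F)).isUnit_iff_valuation_eq_one

theorem residue_eq_zero_iff (x : 𝒪[F]) :
    IsLocalRing.residue 𝒪[F] x = 0 ↔ valuation F x < 1 := by
  rw [IsLocalRing.residue_eq_zero_iff, IsLocalRing.mem_maximalIdeal, mem_nonunits_iff,
    isUnit_integer_iff]
  exact ⟨fun h => lt_of_le_of_ne x.2 h, fun h => h.ne⟩

theorem valuation_unit_ne_zero (x : Fˣ) : valuation F x ≠ 0 :=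
  (valuation F).ne_zero_iff.2 x.ne_zero

theorem valuation_unit_pos (x : Fˣ) : 0 < valuation F x := zero_lt_iff.2 (valuation_unit_ne_zero x)

theorem IsUniformizer.lt_one (h : IsUniformizer ϖ) : valuation F ϖ < 1 := by
  obtain ⟨p, hp, h⟩ := h
  rw [← h]
  exact lt_of_le_of_ne p.2 fun h' => hp.not_isUnit ((isUnit_integer_iff p).2 h')

theorem IsUniformizer.zpow_le_zpow (h : IsUniformizer ϖ) {m n : ℤ} :
    valuation F ϖ ^ m ≤ valuation F ϖ ^ n ↔ n ≤ m :=
  zpow_le_zpow_iff_right_of_lt_one₀ (valuation_unit_pos ϖ) h.lt_one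

theorem zpow_valuation_pos (m : ℤ) : 0 < valuation F ϖ ^ m := zpow_pos (valuation_unit_pos ϖ) m

theorem valuation_zpow (m : ℤ) : valuation F ((ϖ ^ m : Fˣ) : F) = valuation F ϖ ^ m := by
  rw [Units.val_zpow_eq_zpow_val, map_zpow₀]

/-- The chain of the lattices in the plane that are stable under the Iwahori subgroup. -/
def lattice (ϖ : Fˣ) (k : ℤ) : Set (Fin 2 → F) :=
  Set.univ.pi fun i => {x | valuation F x ≤ valuation F ϖ ^ ((k + (i : ℕ)) / 2)}

theorem mem_lattice {k : ℤ} {p : Fin 2 → F} : p ∈ lattice ϖ k ↔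
    valuation F (p 0) ≤ valuation F ϖ ^ (k / 2) ∧
      valuation F (p 1) ≤ valuation F ϖ ^ ((k + 1) / 2) := by
  simp [lattice, Fin.forall_fin_two]

theorem IsUniformizer.lattice_anti (h : IsUniformizer ϖ) {k l : ℤ} (hkl : k ≤ l) :
    lattice ϖ l ⊆ lattice ϖ k := by
  intro p hp
  rw [mem_lattice] at hp ⊢
  exact ⟨hp.1.trans (h.zpow_le_zpow.2 (by omega)), hp.2.trans (h.zpow_le_zpow.2 (by omega))⟩

theorem zero_mem_lattice (k : ℤ) : (0 : Fin 2 → F) ∈ lattice ϖ k := by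
  rw [mem_lattice, Pi.zero_apply, Pi.zero_apply, map_zero]
  exact ⟨(zpow_valuation_pos _).le, (zpow_valuation_pos _).le⟩

open Classical in
/-- The position of a nonzero vector in the chain of lattices. -/
def index (ϖ : Fˣ) (p : Fin 2 → F) : ℤ :=
  if h : ∃ k, p ∈ lattice ϖ k ∧ p ∉ lattice ϖ (k + 1) then h.choose else 0

theorem IsUniformizer.index_eq (h : IsUniformizer ϖ) {p : Fin 2 → F} {k : ℤ}
    (hk : p ∈ lattice ϖ k) (hk' : p ∉ lattice ϖ (k + 1)) : index ϖ p = k := by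
  have h1 : ∃ k, p ∈ lattice ϖ k ∧ p ∉ lattice ϖ (k + 1) := ⟨k, hk, hk'⟩
  rw [index, dif_pos h1]
  obtain ⟨h2, h3⟩ := h1.choose_spec
  refine le_antisymm ?_ ?_
  · by_contra! hlt
    exact hk' (h.lattice_anti hlt h2)
  · by_contra! hlt
    exact h3 (h.lattice_anti hlt hk)

theorem mem_iwahori {g : SL2 F} : g ∈ iwahori F ↔
    (∀ i k, valuation F (g.1 i k) ≤ 1) ∧ valuation F (g.1 1 0) < 1 := Iff.rfl

variable [TopologicalSpace F] [IsNonarchimedeanLocalField F]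

theorem IsUniformizer.lt_one_iff (h : IsUniformizer ϖ) {x : F} :
    valuation F x < 1 ↔ valuation F x ≤ valuation F ϖ := by
  refine ⟨fun hx => ?_, fun hx => hx.trans_lt h.lt_one⟩
  obtain ⟨p, hp, hpϖ⟩ := h
  have h1 : (⟨x, hx.le⟩ : 𝒪[F]) ∈ IsLocalRing.maximalIdeal 𝒪[F] := by
    rw [← IsLocalRing.residue_eq_zero_iff, residue_eq_zero_iff]
    exact hx
  rw [(IsDiscreteValuationRing.irreducible_iff_uniformizer p).1 hp,
    Ideal.mem_span_singleton] at h1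
  obtain ⟨c, hc⟩ := h1
  have h2 : x = ϖ * c := by rw [← hpϖ]; exact congrArg Subtype.val hc
  rw [h2, map_mul]
  exact mul_le_of_le_one_right' c.2

theorem IsUniformizer.exists_zpow (h : IsUniformizer ϖ) {x : F} (hx : x ≠ 0) :
    ∃ m : ℤ, valuation F x = valuation F ϖ ^ m := by
  have key : ∀ y : F, y ≠ 0 → valuation F y ≤ 1 → ∃ m : ℤ, valuation F y = valuation F ϖ ^ m := by
    intro y hy hy1
    obtain ⟨p, hp, hpϖ⟩ := h
    obtain ⟨n, u, hu⟩ := IsDiscreteValuationRing.eq_unit_mul_pow_irreducible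
      (x := (⟨y, hy1⟩ : 𝒪[F])) (fun h => hy (congrArg Subtype.val h)) hp
    refine ⟨n, ?_⟩
    have h1 : y = (u : 𝒪[F]) * (p : F) ^ n := congrArg Subtype.val hu
    rw [h1, map_mul, map_pow, hpϖ, (isUnit_integer_iff _).1 u.isUnit, one_mul, zpow_natCast]
  rcases le_total (valuation F x) 1 with h1 | h1
  · exact key x hx h1
  · obtain ⟨m, hm⟩ := key x⁻¹ (inv_ne_zero hx) (by rw [map_inv₀]; exact inv_le_one_of_one_le₀ h1)
    refine ⟨-m, ?_⟩
    rw [zpow_neg, ← hm, map_inv₀, inv_inv]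

theorem IsUniformizer.lt_zpow_iff (h : IsUniformizer ϖ) {x : F} {m : ℤ} :
    valuation F x < valuation F ϖ ^ m ↔ valuation F x ≤ valuation F ϖ ^ (m + 1) := by
  rcases eq_or_ne x 0 with rfl | hx
  · rw [map_zero]
    exact ⟨fun _ => (zpow_valuation_pos _).le, fun _ => zpow_valuation_pos _⟩
  · obtain ⟨n, hn⟩ := h.exists_zpow hx
    rw [hn, h.zpow_le_zpow, ← not_le, h.zpow_le_zpow]
    omega

theorem IsUniformizer.eq_zpow_iff (h : IsUniformizer ϖ) {x : F} {m : ℤ} :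
    valuation F x = valuation F ϖ ^ m ↔ valuation F x ≤ valuation F ϖ ^ m ∧
      ¬valuation F x ≤ valuation F ϖ ^ (m + 1) := by
  rw [← h.lt_zpow_iff, not_lt, le_antisymm_iff]

theorem isOpen_of_forall_add {S : Set F} (m : ℤ)
    (hS : ∀ x ∈ S, ∀ y, valuation F y < valuation F ϖ ^ m → x + y ∈ S) : IsOpen S := by
  rw [isOpen_iff_mem_nhds]
  intro x hx
  rw [IsValuativeTopology.mem_nhds_iff]
  refine ⟨Units.mk0 _ (zpow_valuation_pos (ϖ := ϖ) m).ne', ?_⟩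
  rintro _ ⟨y, hy, rfl⟩
  exact hS x hx y hy

theorem isClopen_closedBall (m : ℤ) : IsClopen {x : F | valuation F x ≤ valuation F ϖ ^ m} := by
  refine ⟨⟨isOpen_of_forall_add (ϖ := ϖ) m fun x hx y hy hxy => hx ?_⟩,
    isOpen_of_forall_add (ϖ := ϖ) m fun x hx y hy => (valuation F).map_add_le hx hy.le⟩
  have := (valuation F).map_sub_le (x := x + y) (y := y) hxy hy.le
  rwa [add_sub_cancel_right] at this

theorem isClopen_lattice (ϖ : Fˣ) (k : ℤ) : IsClopen (lattice ϖ k) :=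
  ⟨isClosed_set_pi fun _ _ => (isClopen_closedBall _).1,
    isOpen_set_pi Set.finite_univ fun _ _ => (isClopen_closedBall _).2⟩

theorem isCompact_lattice (ϖ : Fˣ) (k : ℤ) : IsCompact (lattice ϖ k) :=
  isCompact_univ_pi fun _ => IsNonarchimedeanLocalField.isCompact_closedBall F _

theorem IsUniformizer.exists_mem_lattice (h : IsUniformizer ϖ) (p : Fin 2 → F) :
    ∃ k, p ∈ lattice ϖ k := by
  have h1 : ∀ x : F, ∃ m : ℤ, valuation F x ≤ valuation F ϖ ^ m := fun x => by
    rcases eq_or_ne x 0 with rfl | hx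
    · exact ⟨0, by simp⟩
    · obtain ⟨m, hm⟩ := h.exists_zpow hx
      exact ⟨m, hm.le⟩
  obtain ⟨m, hm⟩ := h1 (p 0)
  obtain ⟨n, hn⟩ := h1 (p 1)
  refine ⟨2 * min m n, mem_lattice.2 ⟨hm.trans (h.zpow_le_zpow.2 (by omega)),
    hn.trans (h.zpow_le_zpow.2 (by omega))⟩⟩

theorem IsUniformizer.exists_notMem_lattice (h : IsUniformizer ϖ) {p : Fin 2 → F} (hp : p ≠ 0) :
    ∃ k, p ∉ lattice ϖ k := by
  by_contra! H
  apply hp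
  have h1 : ∀ x : F, (∀ m : ℤ, valuation F x ≤ valuation F ϖ ^ m) → x = 0 := fun x hx => by
    by_contra hx0
    obtain ⟨m, hm⟩ := h.exists_zpow hx0
    have := hx (m + 1)
    rw [hm, h.zpow_le_zpow] at this
    omega
  funext i
  fin_cases i
  · refine h1 _ fun m => ?_
    have := (mem_lattice.1 (H (2 * m))).1
    rwa [Int.mul_ediv_cancel_left _ two_ne_zero] at this
  · refine h1 _ fun m => ?_
    have := (mem_lattice.1 (H (2 * m - 1))).2
    rwa [sub_add_cancel, Int.mul_ediv_cancel_left _ two_ne_zero] at this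

theorem IsUniformizer.exists_index (h : IsUniformizer ϖ) {p : Fin 2 → F} (hp : p ≠ 0) :
    ∃ k, p ∈ lattice ϖ k ∧ p ∉ lattice ϖ (k + 1) := by
  obtain ⟨k, hk⟩ := h.exists_mem_lattice p
  obtain ⟨l, hl⟩ := h.exists_notMem_lattice hp
  obtain ⟨m, hm, hm'⟩ := Int.exists_greatest_of_bdd (P := fun k => p ∈ lattice ϖ k)
    ⟨l, fun z hz => le_of_not_ge fun hlz => hl (h.lattice_anti hlz hz)⟩ ⟨k, hk⟩
  exact ⟨m, hm, fun hm1 => by have := hm' _ hm1; omega⟩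

theorem IsUniformizer.mem_lattice_iff (h : IsUniformizer ϖ) {p : Fin 2 → F} (hp : p ≠ 0) (k : ℤ) :
    p ∈ lattice ϖ k ↔ k ≤ index ϖ p := by
  obtain ⟨l, hl, hl'⟩ := h.exists_index hp
  rw [h.index_eq hl hl']
  refine ⟨fun hk => ?_, fun hk => h.lattice_anti hk hl⟩
  by_contra! hlt
  exact hl' (h.lattice_anti hlt hk)

theorem IsUniformizer.index_eq_even (h : IsUniformizer ϖ) {p : Fin 2 → F} {m : ℤ}
    (h1 : valuation F (p 1) = valuation F ϖ ^ m) (h0 : valuation F (p 0) ≤ valuation F ϖ ^ m) :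
    index ϖ p = 2 * m := by
  refine h.index_eq (mem_lattice.2 ⟨?_, ?_⟩) fun H => ?_
  · rwa [show 2 * m / 2 = m by omega]
  · rw [show (2 * m + 1) / 2 = m by omega, h1]
  · have := (mem_lattice.1 H).2
    rw [show (2 * m + 1 + 1) / 2 = m + 1 by omega] at this
    exact (h.eq_zpow_iff.1 h1).2 this

theorem IsUniformizer.index_eq_odd (h : IsUniformizer ϖ) {p : Fin 2 → F} {m : ℤ}
    (h0 : valuation F (p 0) = valuation F ϖ ^ m)
    (h1 : valuation F (p 1) ≤ valuation F ϖ ^ (m + 1)) : index ϖ p = 2 * m + 1 := by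
  refine h.index_eq (mem_lattice.2 ⟨?_, ?_⟩) fun H => ?_
  · rw [show (2 * m + 1) / 2 = m by omega, h0]
  · rwa [show (2 * m + 1 + 1) / 2 = m + 1 by omega]
  · have := (mem_lattice.1 H).1
    rw [show (2 * m + 1 + 1) / 2 = m + 1 by omega] at this
    exact (h.eq_zpow_iff.1 h0).2 this

theorem IsUniformizer.index_cases (h : IsUniformizer ϖ) {p : Fin 2 → F} (hp : p ≠ 0) :
    ∃ m : ℤ, (index ϖ p = 2 * m ∧ valuation F (p 1) = valuation F ϖ ^ m ∧
        valuation F (p 0) ≤ valuation F ϖ ^ m) ∨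
      (index ϖ p = 2 * m + 1 ∧ valuation F (p 0) = valuation F ϖ ^ m ∧
        valuation F (p 1) ≤ valuation F ϖ ^ (m + 1)) := by
  obtain ⟨k, hk, hk'⟩ := h.exists_index hp
  rw [h.index_eq hk hk']
  rw [mem_lattice] at hk hk'
  obtain ⟨m, rfl | rfl⟩ : ∃ m, k = 2 * m ∨ k = 2 * m + 1 := ⟨k / 2, by omega⟩
  · rw [show 2 * m / 2 = m by omega, show (2 * m + 1) / 2 = m by omega] at hk
    rw [show (2 * m + 1) / 2 = m by omega, show (2 * m + 1 + 1) / 2 = m + 1 by omega] at hk'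
    exact ⟨m, Or.inl ⟨rfl, h.eq_zpow_iff.2 ⟨hk.2, fun H => hk' ⟨hk.1, H⟩⟩, hk.1⟩⟩
  · rw [show (2 * m + 1 + 1) / 2 = m + 1 by omega, show (2 * m + 1) / 2 = m by omega] at hk
    rw [show (2 * m + 1 + 1) / 2 = m + 1 by omega, show (2 * m + 1 + 1 + 1) / 2 = m + 1 by omega]
      at hk'
    exact ⟨m, Or.inr ⟨rfl, h.eq_zpow_iff.2 ⟨hk.1, fun H => hk' ⟨H, hk.2⟩⟩, hk.2⟩⟩

theorem IsUniformizer.index_stdVec (h : IsUniformizer ϖ) (k : ℤ) :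
    index ϖ (stdVec ϖ k) = k := by
  obtain ⟨m, rfl | rfl⟩ : ∃ m, k = 2 * m ∨ k = 2 * m + 1 := ⟨k / 2, by omega⟩
  · rw [stdVec_even]
    exact h.index_eq_even (by simp) (by simp)
  · rw [stdVec_odd]
    exact h.index_eq_odd (by simp) (by simp)

theorem IsUniformizer.mulVec_mem_lattice (h : IsUniformizer ϖ) {g : SL2 F} (hg : g ∈ iwahori F)
    {k : ℤ} {p : Fin 2 → F} (hp : p ∈ lattice ϖ k) : g.1.mulVec p ∈ lattice ϖ k := by
  rw [mem_lattice] at hp ⊢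
  rw [mem_iwahori] at hg
  have h10 := h.lt_one_iff.1 hg.2
  rw [mulVec_zero_apply, mulVec_one_apply]
  refine ⟨(valuation F).map_add_le ?_ ?_, (valuation F).map_add_le ?_ ?_⟩ <;> rw [map_mul]
  · exact (mul_le_of_le_one_left' (hg.1 0 0)).trans hp.1
  · exact ((mul_le_of_le_one_left' (hg.1 0 1)).trans hp.2).trans (h.zpow_le_zpow.2 (by omega))
  · refine (mul_le_mul' h10 hp.1).trans ?_
    rw [← zpow_one_add₀ (valuation_unit_ne_zero ϖ)]
    exact h.zpow_le_zpow.2 (by omega)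
  · exact (mul_le_of_le_one_left' (hg.1 1 1)).trans hp.2

theorem IsUniformizer.index_mulVec (h : IsUniformizer ϖ) {g : SL2 F} (hg : g ∈ iwahori F)
    {p : Fin 2 → F} (hp : p ≠ 0) : index ϖ (g.1.mulVec p) = index ϖ p := by
  obtain ⟨k, hk, hk'⟩ := h.exists_index hp
  rw [h.index_eq hk hk']
  refine h.index_eq (h.mulVec_mem_lattice hg hk) fun H => hk' ?_
  have := h.mulVec_mem_lattice (inv_mem hg) H
  have h2 := mulVec_mulVec_inv g⁻¹ p
  rw [inv_inv] at h2
  rwa [h2] at this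

/-- The Iwahori subgroup permutes the nonzero vectors of a given index transitively. -/
theorem IsUniformizer.exists_mulVec_stdVec (h : IsUniformizer ϖ) {p : Fin 2 → F} (hp : p ≠ 0) :
    ∃ g ∈ iwahori F, g.1.mulVec (stdVec ϖ (index ϖ p)) = p := by
  obtain ⟨m, ⟨hm, h1, h0⟩ | ⟨hm, h0, h1⟩⟩ := h.index_cases hp
  · have hϖ : ((ϖ ^ m : Fˣ) : F) ≠ 0 := (ϖ ^ m).ne_zero
    have hb : p 1 ≠ 0 := by
      rw [← (valuation F).ne_zero_iff, h1]
      exact (zpow_valuation_pos m).ne'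
    -- An upper triangular matrix whose second column is `p / ϖ ^ m`; the first column is fixed by
    -- the determinant.
    refine ⟨⟨!![((ϖ ^ m : Fˣ) : F) / p 1, p 0 / ((ϖ ^ m : Fˣ) : F); 0,
      p 1 / ((ϖ ^ m : Fˣ) : F)], by rw [Matrix.det_fin_two_of]; field_simp; simp⟩, ⟨?_, ?_⟩, ?_⟩
    · intro i k
      fin_cases i <;> fin_cases k <;> simp only [map_div₀, valuation_zpow, h1, Matrix.of_apply,
        Matrix.cons_val', Matrix.cons_val_zero, Matrix.cons_val_one, Fin.zero_eta, Fin.mk_one,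
        Matrix.cons_val_fin_one, map_zero]
      · exact div_self_le_one _
      · exact div_le_one_of_le₀ h0 zero_le
      · exact zero_le
      · exact div_self_le_one _
    · simp
    · rw [hm, stdVec_even]
      funext i
      fin_cases i
      · simpa [mulVec_zero_apply] using div_mul_cancel₀ (p 0) hϖ
      · simpa [mulVec_one_apply] using div_mul_cancel₀ (p 1) hϖ
  · have hϖ : ((ϖ ^ m : Fˣ) : F) ≠ 0 := (ϖ ^ m).ne_zero
    have hb : p 0 ≠ 0 := by
      rw [← (valuation F).ne_zero_iff, h0]
      exact (zpow_valuation_pos m).ne'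
    have h1' := h.lt_zpow_iff.2 h1
    -- A lower triangular matrix whose first column is `p / ϖ ^ m`; at odd index `p 1 / ϖ ^ m` lies
    -- in the maximal ideal.
    refine ⟨⟨!![p 0 / ((ϖ ^ m : Fˣ) : F), 0; p 1 / ((ϖ ^ m : Fˣ) : F),
      ((ϖ ^ m : Fˣ) : F) / p 0], by rw [Matrix.det_fin_two_of]; field_simp; simp⟩, ⟨?_, ?_⟩, ?_⟩
    · intro i k
      fin_cases i <;> fin_cases k <;> simp only [map_div₀, valuation_zpow, h0, Matrix.of_apply,
        Matrix.cons_val', Matrix.cons_val_zero, Matrix.cons_val_one, Fin.zero_eta, Fin.mk_one,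
        Matrix.cons_val_fin_one, map_zero]
      · exact div_self_le_one _
      · exact zero_le
      · exact div_le_one_of_le₀ h1'.le zero_le
      · exact div_self_le_one _
    · change valuation F (p 1 / ((ϖ ^ m : Fˣ) : F)) < 1
      rw [map_div₀, valuation_zpow]
      exact (div_lt_one₀ (zpow_valuation_pos m)).2 h1'
    · rw [hm, stdVec_odd]
      funext i
      fin_cases i
      · simpa [mulVec_zero_apply] using div_mul_cancel₀ (p 0) hϖ
      · simpa [mulVec_one_apply] using div_mul_cancel₀ (p 1) hϖ

theorem IsUniformizer.exists_lattice_subset (h : IsUniformizer ϖ) {U : Set (Fin 2 → F)}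
    (hU : U ∈ nhds 0) : ∃ k, lattice ϖ k ⊆ U := by
  rw [nhds_pi, Filter.mem_pi] at hU
  obtain ⟨I, -, t, ht, hI⟩ := hU
  have h1 : ∀ i, ∃ m : ℤ, ∀ x, valuation F x ≤ valuation F ϖ ^ m → x ∈ t i := by
    intro i
    obtain ⟨c, hc, hct⟩ := (IsValuativeTopology.hasBasis_nhds_zero' F).mem_iff.1 (ht i)
    obtain ⟨y, rfl⟩ := ValuativeRel.valuation_surjective c
    obtain ⟨m, hm⟩ := h.exists_zpow ((valuation F).ne_zero_iff.1 hc)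
    refine ⟨m + 1, fun x hx => hct ?_⟩
    rw [← h.lt_zpow_iff, ← hm] at hx
    exact hx
  choose m hm using h1
  refine ⟨2 * max (m 0) (m 1), fun p hp => hI fun i _ => ?_⟩
  rw [mem_lattice] at hp
  fin_cases i
  · exact hm 0 _ (hp.1.trans (h.zpow_le_zpow.2 (by omega)))
  · exact hm 1 _ (hp.2.trans (h.zpow_le_zpow.2 (by omega)))

theorem IsUniformizer.exists_subset_lattice (h : IsUniformizer ϖ) {K : Set (Fin 2 → F)}
    (hK : IsCompact K) : ∃ k, K ⊆ lattice ϖ k := by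
  obtain ⟨s, hs⟩ := hK.elim_finite_subcover (fun k => lattice ϖ k)
    (fun k => (isClopen_lattice ϖ k).2) fun p _ => Set.mem_iUnion.2 (h.exists_mem_lattice p)
  obtain ⟨l, hl⟩ := s.bddBelow
  refine ⟨l, fun p hp => ?_⟩
  obtain ⟨k, hk, hpk⟩ := Set.mem_iUnion₂.1 (hs hp)
  exact h.lattice_anti (hl hk) hpk

end Lattice

end

section

open ValuativeRel Filter

/-! ### Invariant functions on the plane as sequences -/

section Profile

variable {F : Type*} [Field F] [ValuativeRel F] [TopologicalSpace F] [IsNonarchimedeanLocalField F]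
  {ϖ : Fˣ}

theorem eventually_const_of_mem_periodic {φ : ℤ → ℂ} (h : φ ∈ periodic 1) :
    ∃ c, ∀ᶠ k in atTop, φ k = c := by
  obtain ⟨N, hN⟩ := eventually_atTop.1 h.2
  refine ⟨φ N, eventually_atTop.2 ⟨N, fun k hk => ?_⟩⟩
  induction k, hk using Int.leInduction with
  | base => rfl
  | succ k hk ih => rw [hN k hk, ih]

theorem IsUniformizer.apply_eq (h : IsUniformizer ϖ) (f : schwartz F) {p : Fin 2 → F}
    (hp : p ≠ 0) : f.1 p = f.1 (stdVec ϖ (index ϖ p)) := by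
  obtain ⟨g, hg, hgp⟩ := h.exists_mulVec_stdVec hp
  have := f.2.2.2 g⁻¹ (inv_mem hg) (stdVec ϖ (index ϖ p))
  rwa [inv_inv, hgp] at this

theorem IsUniformizer.eventually_apply_stdVec (h : IsUniformizer ϖ) (f : schwartz F) :
    ∀ᶠ k in atTop, f.1 (stdVec ϖ k) = f.1 0 := by
  obtain ⟨K, hK⟩ := h.exists_lattice_subset (IsLocallyConstant.iff_eventually_eq f.1 |>.1 f.2.1 0)
  refine eventually_atTop.2 ⟨K, fun k hk => hK ?_⟩
  rwa [h.mem_lattice_iff (stdVec_ne_zero k), h.index_stdVec]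

theorem IsUniformizer.apply_stdVec_mem_periodic (h : IsUniformizer ϖ) (f : schwartz F) :
    (fun k => f.1 (stdVec ϖ k)) ∈ periodic 1 := by
  refine ⟨?_, ?_⟩
  · obtain ⟨K, hK⟩ := h.exists_subset_lattice (K := tsupport f.1) f.2.2.1
    refine eventually_atBot.2 ⟨K - 1, fun k hk => ?_⟩
    by_contra hne
    have h1 := hK (subset_tsupport _ hne)
    rw [h.mem_lattice_iff (stdVec_ne_zero k), h.index_stdVec] at h1
    omega
  · have h1 := h.eventually_apply_stdVec f
    filter_upwards [h1, (tendsto_add_atTop 1).eventually h1] with k hk hk'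
    rw [hk, hk']

/-- The sequence of the values of an invariant function. -/
def profile (h : IsUniformizer ϖ) : schwartz F →ₗ[ℂ] periodic 1 where
  toFun f := ⟨fun k => f.1 (stdVec ϖ k), h.apply_stdVec_mem_periodic f⟩
  map_add' _ _ := rfl
  map_smul' _ _ := rfl

theorem apply_eq_profile (h : IsUniformizer ϖ) (f : schwartz F) {p : Fin 2 → F} (hp : p ≠ 0) :
    f.1 p = (profile h f).1 (index ϖ p) := h.apply_eq f hp

theorem profile_injective (h : IsUniformizer ϖ) : Function.Injective (profile h) := by
  intro f f' hff
  refine Subtype.ext (funext fun p => ?_)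
  rcases eq_or_ne p 0 with rfl | hp
  -- The value at the origin is the limit of the sequence, by local constancy there.
  · obtain ⟨k, hk, hk'⟩ := ((h.eventually_apply_stdVec f).and (h.eventually_apply_stdVec f')).exists
    rw [← hk, ← hk']
    exact congrFun (congrArg Subtype.val hff) k
  · rw [apply_eq_profile h f hp, apply_eq_profile h f' hp, hff]

/-- The function is constant on the open sets `L_k ∖ L_{k+1}`. Giving the origin the limit of the
sequence makes it locally constant there; vanishing near `-∞` gives compact support. -/
theorem profile_surjective (h : IsUniformizer ϖ) :
    Function.Surjective (profile h) := by
  classical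
  rintro ⟨φ, hφ⟩
  obtain ⟨c, hc⟩ := eventually_const_of_mem_periodic hφ
  obtain ⟨N, hN⟩ := eventually_atTop.1 hc
  obtain ⟨M, hM⟩ := eventually_atBot.1 hφ.1
  let f : (Fin 2 → F) → ℂ := fun p => if p = 0 then c else φ (index ϖ p)
  have hf0 : f 0 = c := if_pos rfl
  have hf : ∀ p, p ≠ 0 → f p = φ (index ϖ p) := fun p hp => if_neg hp
  have h1 : IsLocallyConstant f := by
    rw [IsLocallyConstant.iff_eventually_eq]
    intro p
    rcases eq_or_ne p 0 with rfl | hp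
    · filter_upwards [(isClopen_lattice ϖ N).2.mem_nhds (zero_mem_lattice N)] with q hq
      rcases eq_or_ne q 0 with rfl | hq0
      · rfl
      · rw [hf0, hf q hq0]
        exact hN _ ((h.mem_lattice_iff hq0 N).1 hq)
    · obtain ⟨k, hk, hk'⟩ := h.exists_index hp
      filter_upwards [(isClopen_lattice ϖ k).2.mem_nhds hk,
        (isClopen_lattice ϖ (k + 1)).compl.2.mem_nhds hk'] with q hq hq'
      have hq0 : q ≠ 0 := by
        rintro rfl
        exact hq' (zero_mem_lattice _)
      rw [hf p hp, hf q hq0, h.index_eq hk hk', h.index_eq hq hq']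
  have h2 : HasCompactSupport f := by
    refine HasCompactSupport.intro' (isCompact_lattice ϖ M) (isClopen_lattice ϖ M).1 fun p hp => ?_
    have hp0 : p ≠ 0 := by
      rintro rfl
      exact hp (zero_mem_lattice _)
    rw [hf p hp0]
    rw [h.mem_lattice_iff hp0, not_le] at hp
    exact hM _ hp.le
  have h3 : ∀ g ∈ iwahori F, ∀ x, f ((g⁻¹).1.mulVec x) = f x := by
    intro g hg p
    rcases eq_or_ne p 0 with rfl | hp
    · rw [Matrix.mulVec_zero]
    · rw [hf p hp, hf _ (mulVec_ne_zero _ hp), h.index_mulVec (inv_mem hg) hp]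
  refine ⟨⟨f, h1, h2, h3⟩, Subtype.ext (funext fun k => ?_)⟩
  change f (stdVec ϖ k) = φ k
  rw [hf _ (stdVec_ne_zero k), h.index_stdVec]

/-- Invariant functions on the plane correspond to sequences that vanish near `-∞` and are constant
near `∞`. -/
def profileEquiv (h : IsUniformizer ϖ) : schwartz F ≃ₗ[ℂ] periodic 1 :=
  LinearEquiv.ofBijective (profile h) ⟨profile_injective h, profile_surjective h⟩

theorem apply_eq_profileEquiv (h : IsUniformizer ϖ) (f : schwartz F) {p : Fin 2 → F}
    (hp : p ≠ 0) : f.1 p = (profileEquiv h f).1 (index ϖ p) := h.apply_eq f hp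

end Profile

end

section

open ValuativeRel Filter

/-! ### The cosets of the Iwahori subgroup -/

section Coset

variable {F : Type*} [Field F] {ϖ : Fˣ}

/-- The two root subgroups that belong to the simple affine roots. -/
def unip (ϖ : Fˣ) (i : Fin 2) (x : F) : SL2 F :=
  if i = 0 then ⟨!![1, x; 0, 1], by simp [Matrix.det_fin_two_of]⟩
  else ⟨!![1, 0; ϖ * x, 1], by simp [Matrix.det_fin_two_of]⟩

theorem coe_unip_zero (x : F) : (unip ϖ 0 x).1 = !![1, x; 0, 1] := rfl

theorem coe_unip_one (x : F) : (unip ϖ 1 x).1 = !![1, 0; ϖ * x, 1] := rfl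

theorem coe_rep_s_zero : (rep ϖ (s 0)).1 = !![0, -1; 1, 0] := by
  change !![0, -((ϖ ^ (-0 : ℤ) : Fˣ) : F); ((ϖ ^ (0 : ℤ) : Fˣ) : F), 0] = _
  simp

theorem coe_rep_s_one : (rep ϖ (s 1)).1 = !![0, -(ϖ : F)⁻¹; (ϖ : F), 0] := by
  change !![0, -((ϖ ^ (-1 : ℤ) : Fˣ) : F); ((ϖ ^ (1 : ℤ) : Fˣ) : F), 0] = _
  simp

theorem unip_add (i : Fin 2) (x y : F) : unip ϖ i (x + y) = unip ϖ i x * unip ϖ i y := by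
  apply Subtype.ext
  rw [Matrix.SpecialLinearGroup.coe_mul]
  fin_cases i
  · simp [coe_unip_zero, add_comm]
  · simp [coe_unip_one, mul_add]

theorem unip_zero (i : Fin 2) : unip ϖ i 0 = 1 := by
  have := unip_add (ϖ := ϖ) i 0 0
  rwa [add_zero, left_eq_mul] at this

theorem unip_neg (i : Fin 2) (x : F) : unip ϖ i (-x) = (unip ϖ i x)⁻¹ := by
  rw [eq_inv_iff_mul_eq_one, ← unip_add, neg_add_cancel, unip_zero]

/-- Conjugation by `s i` carries the other simple root subgroup into that of `i`, one step deeper.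
The sign reappears in `digits`. -/
theorem rep_s_mul_unip (i : Fin 2) (x : F) :
    rep ϖ (s i) * unip ϖ (i + 1) x = unip ϖ i (-(ϖ * x)) * rep ϖ (s i) := by
  apply Subtype.ext
  rw [Matrix.SpecialLinearGroup.coe_mul, Matrix.SpecialLinearGroup.coe_mul]
  fin_cases i
  · change (rep ϖ (s 0)).1 * (unip ϖ 1 x).1 = (unip ϖ 0 (-(ϖ * x))).1 * (rep ϖ (s 0)).1
    simp [coe_unip_zero, coe_unip_one, coe_rep_s_zero]
  · change (rep ϖ (s 1)).1 * (unip ϖ 0 x).1 = (unip ϖ 1 (-(ϖ * x))).1 * (rep ϖ (s 1)).1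
    simp [coe_unip_zero, coe_unip_one, coe_rep_s_one]
    field_simp

theorem unip_mul_rep_s (i : Fin 2) (x : F) :
    unip ϖ i x * rep ϖ (s i) = rep ϖ (s i) * unip ϖ (i + 1) (-(x / ϖ)) := by
  rw [rep_s_mul_unip, mul_neg, neg_neg, mul_div_cancel₀ _ ϖ.ne_zero]

theorem inv_unip_mul_rep_s_zero (x : F) :
    ((unip ϖ 0 x * rep ϖ (s 0))⁻¹).1 = !![0, 1; -1, x] := by
  rw [Matrix.SpecialLinearGroup.coe_inv, Matrix.SpecialLinearGroup.coe_mul, coe_unip_zero,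
    coe_rep_s_zero]
  simp [Matrix.adjugate_fin_two]

theorem inv_unip_mul_rep_s_one (x : F) :
    ((unip ϖ 1 x * rep ϖ (s 1))⁻¹).1 = !![-x, (ϖ : F)⁻¹; -ϖ, 0] := by
  rw [Matrix.SpecialLinearGroup.coe_inv, Matrix.SpecialLinearGroup.coe_mul, coe_unip_one,
    coe_rep_s_one]
  simp [Matrix.adjugate_fin_two, mul_right_comm (ϖ : F) x]

variable [ValuativeRel F]

theorem IsUniformizer.unip_mem_iff [TopologicalSpace F] [IsNonarchimedeanLocalField F]
    (h : IsUniformizer ϖ) (i : Fin 2) (x : F) :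
    unip ϖ i x ∈ iwahori F ↔ valuation F x ≤ 1 := by
  rw [mem_iwahori]
  fin_cases i
  · simp [Fin.forall_fin_two, coe_unip_zero]
  · have : valuation F (ϖ * x) < 1 ↔ valuation F x ≤ 1 := by
      rw [h.lt_one_iff, map_mul, mul_le_iff_le_one_right (valuation_unit_pos ϖ)]
    constructor
    · intro H
      exact this.1 H.2
    · intro H
      refine ⟨?_, this.2 H⟩
      simpa [Fin.forall_fin_two, coe_unip_one] using (this.2 H).le

/-- A representative of the alternating product with `n` factors and first factor `s i`. -/
def wordRep (ϖ : Fˣ) : Fin 2 → ℕ → SL2 F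
  | _, 0 => 1
  | i, n + 1 => rep ϖ (s i) * wordRep ϖ (i + 1) n

/-- Each letter that is passed divides the argument by `ϖ` up to sign. The result is in the Iwahori
subgroup exactly when `x ∈ ϖ ^ n 𝒪`, which explains the residues modulo `ϖ ^ n`. -/
theorem unip_mul_wordRep (i : Fin 2) (n : ℕ) (x : F) :
    ∃ k : Fin 2, ∃ y : F, valuation F y = valuation F x / valuation F ϖ ^ n ∧
      unip ϖ i x * wordRep ϖ i n = wordRep ϖ i n * unip ϖ k y := by
  induction n generalizing i x with
  | zero => exact ⟨i, x, by simp, by simp [wordRep]⟩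
  | succ n ih =>
    obtain ⟨k, y, hy, H⟩ := ih (i + 1) (-(x / ϖ))
    refine ⟨k, y, ?_, ?_⟩
    · rw [hy, Valuation.map_neg, map_div₀, div_div, pow_succ']
    · rw [wordRep, ← mul_assoc, unip_mul_rep_s, mul_assoc, H, mul_assoc]

/-- Conjugation by `s i` exchanges the two off-diagonal corners up to scaling; once the `i`-corner
is zero, the result stays integral. The corner that vanishes afterwards is the one required for the
next letter `i + 1`. -/
theorem mul_rep_s {i : Fin 2} {g : SL2 F} (hg : g ∈ iwahori F) (hi : g.1 i (i + 1) = 0)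
    (hϖ : valuation F ϖ < 1) :
    ∃ k ∈ iwahori F, k.1 (i + 1) i = 0 ∧ g * rep ϖ (s i) = rep ϖ (s i) * k := by
  rw [mem_iwahori] at hg
  fin_cases i
  · change g.1 0 1 = 0 at hi
    have hdet := g.2
    rw [Matrix.det_fin_two, hi, zero_mul, sub_zero] at hdet
    refine ⟨⟨!![g.1 1 1, -g.1 1 0; 0, g.1 0 0],
      by rw [Matrix.det_fin_two_of, mul_zero, sub_zero, mul_comm, hdet]⟩, ⟨?_, ?_⟩, rfl, ?_⟩
    · simp [Fin.forall_fin_two, hg.1]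
    · simp
    · apply Subtype.ext
      change g.1 * (rep ϖ (s 0)).1 = (rep ϖ (s 0)).1 * !![g.1 1 1, -g.1 1 0; 0, g.1 0 0]
      rw [coe_rep_s_zero, Matrix.eta_fin_two g.1, hi]
      simp
  · change g.1 1 0 = 0 at hi
    have hdet := g.2
    rw [Matrix.det_fin_two, hi, mul_zero, sub_zero] at hdet
    have h1 : valuation F (-(ϖ * ϖ * g.1 0 1)) < 1 := by
      rw [Valuation.map_neg, map_mul, map_mul]
      exact (mul_le_of_le_one_right' (hg.1 0 1)).trans_lt
        ((mul_le_of_le_one_right' hϖ.le).trans_lt hϖ)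
    refine ⟨⟨!![g.1 1 1, 0; -(ϖ * ϖ * g.1 0 1), g.1 0 0],
      by rw [Matrix.det_fin_two_of, zero_mul, sub_zero, mul_comm, hdet]⟩, ⟨?_, h1⟩, rfl, ?_⟩
    · have := h1.le
      simp only [Fin.forall_fin_two]
      refine ⟨⟨hg.1 1 1, ?_⟩, this, hg.1 0 0⟩
      simp
    · apply Subtype.ext
      change g.1 * (rep ϖ (s 1)).1 =
        (rep ϖ (s 1)).1 * !![g.1 1 1, 0; -(ϖ * ϖ * g.1 0 1), g.1 0 0]
      rw [coe_rep_s_one, Matrix.eta_fin_two g.1, hi]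
      simp [mul_comm, mul_assoc]

theorem mul_wordRep {i : Fin 2} {g : SL2 F} (hg : g ∈ iwahori F) (hi : g.1 i (i + 1) = 0)
    (hϖ : valuation F ϖ < 1) (n : ℕ) :
    ∃ k ∈ iwahori F, g * wordRep ϖ i n = wordRep ϖ i n * k := by
  induction n generalizing i g with
  | zero => exact ⟨g, hg, by simp [wordRep]⟩
  | succ n ih =>
    obtain ⟨k, hk, hki, H⟩ := mul_rep_s hg hi hϖ
    obtain ⟨l, hl, H'⟩ := ih hk (by rwa [fin_two_add_one_add_one])
    exact ⟨l, hl, by rw [wordRep, ← mul_assoc, H, mul_assoc, H', mul_assoc]⟩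

/-- The determinant is `1` and the lower left entry lies in the maximal ideal, so the diagonal
entries are units. One row operation with integral `x` then clears the chosen entry. -/
theorem IsUniformizer.exists_unip_mul [TopologicalSpace F] [IsNonarchimedeanLocalField F]
    (h : IsUniformizer ϖ) (i : Fin 2) {g : SL2 F} (hg : g ∈ iwahori F) :
    ∃ x : F, valuation F x ≤ 1 ∧ ∃ k ∈ iwahori F, k.1 i (i + 1) = 0 ∧ g = unip ϖ i x * k := by
  suffices H : ∃ x : F, valuation F x ≤ 1 ∧ (unip ϖ i (-x) * g).1 i (i + 1) = 0 by
    obtain ⟨x, hx, H⟩ := H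
    refine ⟨x, hx, _, mul_mem ?_ hg, H, ?_⟩
    · rwa [h.unip_mem_iff, Valuation.map_neg]
    · rw [unip_neg, mul_inv_cancel_left]
  rw [mem_iwahori] at hg
  have hdet := g.2
  rw [Matrix.det_fin_two] at hdet
  have h1 : valuation F (g.1 0 0 * g.1 1 1) = 1 := by
    rw [sub_eq_iff_eq_add.1 hdet]
    refine (valuation F).map_one_add_of_lt ?_
    rw [map_mul]
    exact (mul_le_of_le_one_left' (hg.1 0 1)).trans_lt hg.2
  rw [map_mul] at h1
  have ha : valuation F (g.1 0 0) = 1 :=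
    le_antisymm (hg.1 0 0) (h1 ▸ mul_le_of_le_one_right' (hg.1 1 1))
  have hd : valuation F (g.1 1 1) = 1 := by rwa [ha, one_mul] at h1
  fin_cases i
  · refine ⟨g.1 0 1 / g.1 1 1, by rw [map_div₀, hd, div_one]; exact hg.1 0 1, ?_⟩
    have : g.1 1 1 ≠ 0 := by rw [← (valuation F).ne_zero_iff, hd]; exact one_ne_zero
    change ((unip ϖ 0 _).1 * g.1) 0 1 = 0
    rw [coe_unip_zero, Matrix.mul_apply, Fin.sum_univ_two]
    change 1 * g.1 0 1 + -(g.1 0 1 / g.1 1 1) * g.1 1 1 = 0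
    field_simp
    ring
  · refine ⟨g.1 1 0 / (ϖ * g.1 0 0), ?_, ?_⟩
    · rw [map_div₀, map_mul, ha, mul_one]
      exact div_le_one_of_le₀ (h.lt_one_iff.1 hg.2) zero_le
    have : g.1 0 0 ≠ 0 := by rw [← (valuation F).ne_zero_iff, ha]; exact one_ne_zero
    have hϖ := ϖ.ne_zero
    change ((unip ϖ 1 _).1 * g.1) 1 0 = 0
    rw [coe_unip_one, Matrix.mul_apply, Fin.sum_univ_two]
    change (ϖ * -(g.1 1 0 / (ϖ * g.1 0 0))) * g.1 0 0 + 1 * g.1 1 0 = 0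
    field_simp
    ring

/-- Multiplication in the affine Weyl group and multiplication of representatives agree up to a
sign. -/
theorem rep_s_mul (i : Fin 2) (w : W) :
    ∃ k ∈ iwahori F, rep ϖ (s i * w) = rep ϖ (s i) * rep ϖ w * k := by
  have hneg : ∃ k ∈ iwahori F, k.1 = -1 := by
    refine ⟨⟨-1, by simp [Matrix.det_neg]⟩, mem_iwahori.2 ?_, rfl⟩
    simp [Fin.forall_fin_two]
  rcases w with (n | n)
  · change ℤ at n
    refine ⟨1, one_mem _, ?_⟩
    change rep ϖ (s i * (.r n : W)) = _
    rw [s_mul_r, mul_one]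
    apply Subtype.ext
    rw [Matrix.SpecialLinearGroup.coe_mul]
    fin_cases i
    · change !![0, -((ϖ ^ (-n) : Fˣ) : F); ((ϖ ^ n : Fˣ) : F), 0] = (rep ϖ (s 0)).1 *
        !![((ϖ ^ n : Fˣ) : F), 0; 0, ((ϖ ^ (-n) : Fˣ) : F)]
      simp [coe_rep_s_zero]
    · change !![0, -((ϖ ^ (-(1 + n)) : Fˣ) : F); ((ϖ ^ (1 + n) : Fˣ) : F), 0] = (rep ϖ (s 1)).1 *
        !![((ϖ ^ n : Fˣ) : F), 0; 0, ((ϖ ^ (-n) : Fˣ) : F)]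
      simp [coe_rep_s_one, zpow_add, mul_comm]
  · change ℤ at n
    obtain ⟨k, hk, hk1⟩ := hneg
    refine ⟨k, hk, ?_⟩
    change rep ϖ (s i * (.sr n : W)) = _
    rw [s_mul_sr]
    apply Subtype.ext
    rw [Matrix.SpecialLinearGroup.coe_mul, Matrix.SpecialLinearGroup.coe_mul, hk1]
    fin_cases i
    · change !![((ϖ ^ n : Fˣ) : F), 0; 0, ((ϖ ^ (-n) : Fˣ) : F)] = (rep ϖ (s 0)).1 *
        !![0, -((ϖ ^ (-n) : Fˣ) : F); ((ϖ ^ n : Fˣ) : F), 0] * -1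
      simp [coe_rep_s_zero]
    · change !![((ϖ ^ (n - 1) : Fˣ) : F), 0; 0, ((ϖ ^ (-(n - 1)) : Fˣ) : F)] = (rep ϖ (s 1)).1 *
        !![0, -((ϖ ^ (-n) : Fˣ) : F); ((ϖ ^ n : Fˣ) : F), 0] * -1
      simp [coe_rep_s_one, zpow_sub, mul_comm]

theorem rep_e (i : Fin 2) (n : ℕ) : ∃ k ∈ iwahori F, rep ϖ (e i n) = wordRep ϖ i n * k := by
  induction n generalizing i with
  | zero =>
    refine ⟨1, one_mem _, ?_⟩
    rw [e_zero, wordRep, one_mul]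
    apply Subtype.ext
    change !![((ϖ ^ (0 : ℤ) : Fˣ) : F), 0; 0, ((ϖ ^ (-0 : ℤ) : Fˣ) : F)] = 1
    simp [Matrix.one_fin_two]
  | succ n ih =>
    obtain ⟨k, hk, H⟩ := rep_s_mul (ϖ := ϖ) i (e (i + 1) n)
    obtain ⟨l, hl, H'⟩ := ih (i + 1)
    exact ⟨l * k, mul_mem hl hk, by rw [e_succ, H, H', wordRep]; group⟩

end Coset

end

section

open ValuativeRel Filter

/-! ### Sums over the cosets in a double coset -/

section Digits

variable {F : Type*} [Field F] [ValuativeRel F] {ϖ : Fˣ}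

/-- A representative of a residue class in the ring of integers. -/
def liftInt (κ : 𝓀[F]) : 𝒪[F] :=
  Function.surjInv (IsLocalRing.residue_surjective (R := 𝒪[F])) κ

/-- A representative of a residue class. -/
def lift (κ : 𝓀[F]) : F := liftInt κ

theorem residue_liftInt (κ : 𝓀[F]) : IsLocalRing.residue 𝒪[F] (liftInt κ) = κ :=
  Function.surjInv_eq _ κ

theorem valuation_lift_le (κ : 𝓀[F]) : valuation F (lift κ) ≤ 1 := (liftInt κ).2

theorem valuation_lift_sub_lt_iff (κ : 𝓀[F]) (x : 𝒪[F]) :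
    valuation F (lift κ - x) < 1 ↔ κ = IsLocalRing.residue 𝒪[F] x := by
  have h1 := residue_eq_zero_iff (liftInt κ - x)
  rw [map_sub, residue_liftInt, sub_eq_zero] at h1
  exact h1.symm

theorem valuation_lift_sub_le (κ : 𝓀[F]) (x : 𝒪[F]) : valuation F (lift κ - x) ≤ 1 :=
  (valuation F).map_sub_le (valuation_lift_le κ) x.2

theorem eq_of_valuation_lift_sub_lt {κ κ' : 𝓀[F]} (h : valuation F (lift κ - lift κ') < 1) :
    κ = κ' := by
  have := (valuation_lift_sub_lt_iff κ (liftInt κ')).1 h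
  rwa [residue_liftInt] at this

/-- Representatives of the residue classes modulo `ϖ ^ n`. -/
def digits (ϖ : Fˣ) : (n : ℕ) → (Fin n → 𝓀[F]) → F
  | 0, _ => 0
  -- The minus sign is that of `rep_s_mul_unip`, so that `cosetRep_succ` is an exact equality of
  -- matrices.
  | n + 1, d => lift (d 0) - ϖ * digits ϖ n (Fin.tail d)

variable [TopologicalSpace F] [IsNonarchimedeanLocalField F]

theorem IsUniformizer.valuation_digits_le (h : IsUniformizer ϖ) (n : ℕ) (d : Fin n → 𝓀[F]) :
    valuation F (digits ϖ n d) ≤ 1 := by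
  induction n with
  | zero => rw [digits, map_zero]; exact zero_le
  | succ n ih =>
    refine (valuation F).map_sub_le (valuation_lift_le _) ?_
    rw [map_mul]
    exact mul_le_one' h.lt_one.le (ih _)

theorem IsUniformizer.digits_injective (h : IsUniformizer ϖ) (n : ℕ) {d d' : Fin n → 𝓀[F]}
    (hd : valuation F (digits ϖ n d - digits ϖ n d') ≤ valuation F ϖ ^ n) : d = d' := by
  induction n with
  | zero => exact Subsingleton.elim _ _
  | succ n ih =>
    have h1 : d 0 = d' 0 := by
      refine eq_of_valuation_lift_sub_lt ?_
      have e : lift (d 0) - lift (d' 0) = (digits ϖ (n + 1) d - digits ϖ (n + 1) d') +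
          (ϖ * digits ϖ n (Fin.tail d) - ϖ * digits ϖ n (Fin.tail d')) := by
        rw [digits, digits]; ring
      have h2 : ∀ c : Fin n → 𝓀[F], valuation F (ϖ * digits ϖ n c) < 1 := fun c => by
        rw [map_mul]
        exact (mul_le_of_le_one_right' (h.valuation_digits_le n c)).trans_lt h.lt_one
      rw [e]
      exact (valuation F).map_add_lt (hd.trans_lt (pow_lt_one₀ zero_le h.lt_one n.succ_ne_zero))
        ((valuation F).map_sub_lt (h2 _) (h2 _))
    have h2 : Fin.tail d = Fin.tail d' := by
      refine ih ?_
      rw [digits, digits, h1, sub_sub_sub_cancel_left, ← mul_sub, map_mul, pow_succ',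
        (valuation F).map_sub_swap] at hd
      exact (mul_le_mul_iff_right₀ (valuation_unit_pos ϖ)).1 hd
    rw [← Fin.cons_self_tail d, ← Fin.cons_self_tail d', h1, h2]

theorem IsUniformizer.exists_digits (h : IsUniformizer ϖ) (n : ℕ) {x : F}
    (hx : valuation F x ≤ 1) :
    ∃ d : Fin n → 𝓀[F], valuation F (x - digits ϖ n d) ≤ valuation F ϖ ^ n := by
  induction n generalizing x with
  | zero => exact ⟨Fin.elim0, by simpa [digits] using hx⟩
  | succ n ih =>
    have h1 := (valuation_lift_sub_lt_iff (IsLocalRing.residue 𝒪[F] ⟨x, hx⟩) ⟨x, hx⟩).2 rfl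
    obtain ⟨d, hd⟩ := ih (x := (lift (IsLocalRing.residue 𝒪[F] ⟨x, hx⟩) - x) / ϖ) (by
      rw [map_div₀]
      exact div_le_one_of_le₀ (h.lt_one_iff.1 h1) zero_le)
    refine ⟨Fin.cons (IsLocalRing.residue 𝒪[F] ⟨x, hx⟩) d, ?_⟩
    have e : x - digits ϖ (n + 1) (Fin.cons (IsLocalRing.residue 𝒪[F] ⟨x, hx⟩) d) =
        -(ϖ * ((lift (IsLocalRing.residue 𝒪[F] ⟨x, hx⟩) - x) / ϖ - digits ϖ n d)) := by
      rw [digits, Fin.cons_zero, Fin.tail_cons, mul_sub, mul_div_cancel₀ _ ϖ.ne_zero]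
      ring
    rw [e, Valuation.map_neg, map_mul, pow_succ']
    exact mul_le_mul_right hd _

/-- The representative of a coset in the double coset of `e i n`. -/
def cosetRep (ϖ : Fˣ) (i : Fin 2) (n : ℕ) (d : Fin n → 𝓀[F]) : SL2 F :=
  unip ϖ i (digits ϖ n d) * wordRep ϖ i n

/-- A coset representative is a product with one digit per letter; sums over a double coset can
therefore be computed letter by letter. -/
theorem cosetRep_succ (i : Fin 2) (n : ℕ) (d : Fin (n + 1) → 𝓀[F]) :
    cosetRep ϖ i (n + 1) d =
      unip ϖ i (lift (d 0)) * rep ϖ (s i) * cosetRep ϖ (i + 1) n (Fin.tail d) := by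
  rw [cosetRep, cosetRep, digits, wordRep, sub_eq_add_neg, unip_add, mul_assoc, mul_assoc,
    ← mul_assoc (rep ϖ (s i)), rep_s_mul_unip, mul_assoc]

/-- An Iwahori element is `unip ϖ i z` times a factor that passes through the word (`mul_wordRep`),
and `z` matters only modulo `ϖ ^ n` (`unip_mul_wordRep`). -/
theorem IsUniformizer.mem_doubleCoset_iff (h : IsUniformizer ϖ) (i : Fin 2) (n : ℕ) (g : SL2 F) :
    g ∈ DoubleCoset.doubleCoset (rep ϖ (e i n)) (iwahori F) (iwahori F) ↔
      ∃ d, (cosetRep ϖ i n d)⁻¹ * g ∈ iwahori F := by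
  obtain ⟨k, hk, hrep⟩ := rep_e (ϖ := ϖ) i n
  rw [DoubleCoset.mem_doubleCoset, hrep]
  constructor
  · rintro ⟨x, hx, y, hy, rfl⟩
    obtain ⟨z, hz, x', hx', hx'0, rfl⟩ := h.exists_unip_mul i hx
    obtain ⟨l, hl, hxl⟩ := mul_wordRep hx' hx'0 h.lt_one n
    obtain ⟨d, hd⟩ := h.exists_digits n hz
    obtain ⟨m, u, hu, hzu⟩ := unip_mul_wordRep (ϖ := ϖ) i n (z - digits ϖ n d)
    refine ⟨d, ?_⟩
    have e1 : (cosetRep ϖ i n d)⁻¹ * (unip ϖ i z * x' * (wordRep ϖ i n * k) * y) =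
        unip ϖ m u * (l * k * y) := by
      have e2 : unip ϖ i z = unip ϖ i (digits ϖ n d) * unip ϖ i (z - digits ϖ n d) := by
        rw [← unip_add, add_sub_cancel]
      rw [inv_mul_eq_iff_eq_mul, cosetRep, mul_assoc _ (wordRep ϖ i n), ← mul_assoc (wordRep ϖ i n),
        ← hzu, e2]
      simp only [mul_assoc]
      rw [← mul_assoc x', hxl]
      simp only [mul_assoc]
    rw [e1]
    refine mul_mem ((h.unip_mem_iff m u).2 ?_) (mul_mem (mul_mem hl hk) hy)
    rw [hu]
    exact div_le_one_of_le₀ hd zero_le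
  · rintro ⟨d, hd⟩
    refine ⟨unip ϖ i (digits ϖ n d), (h.unip_mem_iff i _).2 (h.valuation_digits_le n d), _,
      mul_mem (inv_mem hk) hd, ?_⟩
    rw [cosetRep]
    group

theorem IsUniformizer.cosetRep_injective (h : IsUniformizer ϖ) (i : Fin 2) (n : ℕ) :
    Function.Injective fun d => (QuotientGroup.mk (cosetRep ϖ i n d) : SL2 F ⧸ iwahori F) := by
  intro d d' hd
  rw [QuotientGroup.eq] at hd
  obtain ⟨m, u, hu, H⟩ := unip_mul_wordRep (ϖ := ϖ) i n (-digits ϖ n d + digits ϖ n d')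
  have e1 : (cosetRep ϖ i n d)⁻¹ * cosetRep ϖ i n d' = unip ϖ m u := by
    rw [cosetRep, cosetRep, mul_inv_rev, mul_assoc, inv_mul_eq_iff_eq_mul, ← H, unip_add, unip_neg,
      mul_assoc]
  rw [e1, h.unip_mem_iff, hu, div_le_one₀ (pow_pos (valuation_unit_pos ϖ) n), neg_add_eq_sub] at hd
  exact (h.digits_injective n hd).symm

theorem IsUniformizer.charFun_eq (h : IsUniformizer ϖ) (i : Fin 2) (n : ℕ) (d : Fin n → 𝓀[F])
    {g : SL2 F} (hg : (cosetRep ϖ i n d)⁻¹ * g ∈ iwahori F) : charFun ϖ (e i n) g = 1 :=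
  if_pos ((h.mem_doubleCoset_iff i n g).2 ⟨d, hg⟩)

theorem IsUniformizer.index_inv_mulVec (h : IsUniformizer ϖ) {g k : SL2 F}
    (hgk : g⁻¹ * k ∈ iwahori F) {p : Fin 2 → F} (hp : p ≠ 0) :
    index ϖ ((k⁻¹).1.mulVec p) = index ϖ ((g⁻¹).1.mulVec p) := by
  have e1 : (k⁻¹).1.mulVec p = ((g⁻¹ * k)⁻¹).1.mulVec ((g⁻¹).1.mulVec p) := by
    rw [Matrix.mulVec_mulVec, ← Matrix.SpecialLinearGroup.coe_mul, mul_inv_rev, inv_inv,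
      mul_inv_cancel_right]
  rw [e1, h.index_mulVec (inv_mem hgk) (mulVec_ne_zero _ hp)]

/-- The sum over the cosets in a double coset. -/
theorem IsUniformizer.hasSum_charFun_mul [Fintype 𝓀[F]] (h : IsUniformizer ϖ) (i : Fin 2) (n : ℕ)
    (ψ : ℤ → ℂ) {p : Fin 2 → F} (hp : p ≠ 0) :
    HasSum (fun c : SL2 F ⧸ iwahori F =>
        charFun ϖ (e i n) c.out * ψ (index ϖ ((c.out⁻¹).1.mulVec p)))
      (∑ d, ψ (index ϖ (((cosetRep ϖ i n d)⁻¹).1.mulVec p))) := by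
  rw [← (h.cosetRep_injective i n).hasSum_iff]
  · convert hasSum_fintype fun d => ψ (index ϖ (((cosetRep ϖ i n d)⁻¹).1.mulVec p)) using 1
    funext d
    have hd : (cosetRep ϖ i n d)⁻¹ *
        (QuotientGroup.mk (cosetRep ϖ i n d) : SL2 F ⧸ iwahori F).out ∈ iwahori F :=
      QuotientGroup.eq.1 (QuotientGroup.out_eq' _).symm
    change charFun ϖ (e i n) (QuotientGroup.mk (cosetRep ϖ i n d) : SL2 F ⧸ iwahori F).out * _ = _
    rw [h.charFun_eq i n d hd, one_mul, h.index_inv_mulVec hd hp]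
  · intro c hc
    rw [charFun, if_neg, zero_mul]
    rw [h.mem_doubleCoset_iff]
    rintro ⟨d, hd⟩
    refine hc ⟨d, ?_⟩
    rw [← QuotientGroup.out_eq' c]
    exact QuotientGroup.eq.2 hd

/-- Among the residue classes exactly one lowers the absolute value of `κ b - a`. -/
theorem exists_valuation_lift_mul_sub_lt {a b : F} (hb : b ≠ 0)
    (hab : valuation F a ≤ valuation F b) :
    ∃ κ₀ : 𝓀[F], valuation F (lift κ₀ * b - a) < valuation F b ∧
      ∀ κ, κ ≠ κ₀ → valuation F (lift κ * b - a) = valuation F b := by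
  have hb' : valuation F b ≠ 0 := (valuation F).ne_zero_iff.2 hb
  have hx : valuation F (a / b) ≤ 1 := by
    rw [map_div₀]
    exact div_le_one_of_le₀ hab zero_le
  have e1 : ∀ κ : 𝓀[F], valuation F (lift κ * b - a) =
      valuation F (lift κ - a / b) * valuation F b := fun κ => by
    rw [← map_mul, sub_mul, div_mul_cancel₀ _ hb]
  refine ⟨IsLocalRing.residue 𝒪[F] ⟨a / b, hx⟩, ?_, fun κ hκ => ?_⟩
  · rw [e1]
    have := (valuation_lift_sub_lt_iff _ ⟨a / b, hx⟩).2 rfl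
    exact mul_lt_of_lt_one_left (zero_lt_iff.2 hb') this
  · rw [e1]
    have h1 : valuation F (lift κ - a / b) = 1 :=
      le_antisymm (valuation_lift_sub_le κ ⟨a / b, hx⟩)
        (not_lt.1 fun H => hκ ((valuation_lift_sub_lt_iff κ ⟨a / b, hx⟩).1 H))
    rw [h1, one_mul]

/-- One new coordinate is, up to sign, `κ b - a` with `b` the coordinate that determines the index
and `a` no larger. One residue class cancels the leading term and raises the index by one. -/
theorem IsUniformizer.index_of_par (h : IsUniformizer ϖ) {i : Fin 2} {p : Fin 2 → F} (hp : p ≠ 0)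
    (hi : Par i (index ϖ p)) : ∃ κ₀ : 𝓀[F],
      index ϖ (((unip ϖ i (lift κ₀) * rep ϖ (s i))⁻¹).1.mulVec p) = index ϖ p + 1 ∧
      ∀ κ, κ ≠ κ₀ → index ϖ (((unip ϖ i (lift κ) * rep ϖ (s i))⁻¹).1.mulVec p) = index ϖ p := by
  obtain ⟨m, ⟨hm, h1, h0⟩ | ⟨hm, h0, h1⟩⟩ := h.index_cases hp
  · rw [hm] at hi ⊢
    obtain rfl : i = 0 := by
      rcases fin_two_eq_or 0 i with rfl | rfl
      · rfl
      · obtain ⟨r, hr⟩ := hi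
        change 2 * m + 1 = r + r at hr
        omega
    simp only [inv_unip_mul_rep_s_zero]
    have hb : p 1 ≠ 0 := by
      rw [← (valuation F).ne_zero_iff, h1]
      exact (zpow_valuation_pos m).ne'
    obtain ⟨κ₀, hκ, H⟩ := exists_valuation_lift_mul_sub_lt hb (h0.trans h1.ge)
    have e0 : ∀ x : F, (!![0, 1; -1, x] : Matrix _ _ F).mulVec p 0 = p 1 := fun x => by
      simp [mulVec_zero_apply]
    have e1 : ∀ x : F, (!![0, 1; -1, x] : Matrix _ _ F).mulVec p 1 = x * p 1 - p 0 := fun x => by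
      simp [mulVec_one_apply, neg_add_eq_sub]
    refine ⟨κ₀, h.index_eq_odd ?_ ?_, fun κ hκκ => h.index_eq_even ?_ ?_⟩
    · rw [e0, h1]
    · rwa [e1, ← h.lt_zpow_iff, ← h1]
    · rw [e1, H κ hκκ, h1]
    · rw [e0, h1]
  · rw [hm] at hi ⊢
    obtain rfl : i = 1 := by
      rcases fin_two_eq_or 1 i with rfl | rfl
      · rfl
      · obtain ⟨r, hr⟩ := hi
        change 2 * m + 1 + 0 = r + r at hr
        omega
    simp only [inv_unip_mul_rep_s_one]
    have ha : p 0 ≠ 0 := by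
      rw [← (valuation F).ne_zero_iff, h0]
      exact (zpow_valuation_pos m).ne'
    have h1' : valuation F (p 1 / ϖ) ≤ valuation F (p 0) := by
      rw [h0, map_div₀, div_le_iff₀ (valuation_unit_pos ϖ),
        ← zpow_add_one₀ (valuation_unit_ne_zero ϖ)]
      exact h1
    obtain ⟨κ₀, hκ, H⟩ := exists_valuation_lift_mul_sub_lt ha h1'
    have e0 : ∀ x : F, valuation F ((!![-x, (ϖ : F)⁻¹; -ϖ, 0] : Matrix _ _ F).mulVec p 0) =
        valuation F (x * p 0 - p 1 / ϖ) := fun x => by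
      rw [mulVec_zero_apply, (valuation F).map_sub_swap, div_eq_inv_mul, sub_eq_neg_add,
        ← neg_mul]
      rfl
    have e1 : ∀ x : F, valuation F ((!![-x, (ϖ : F)⁻¹; -ϖ, 0] : Matrix _ _ F).mulVec p 1) =
        valuation F ϖ ^ (m + 1) := fun x => by
      rw [zpow_add_one₀ (valuation_unit_ne_zero ϖ), ← h0, ← map_mul, ← Valuation.map_neg]
      congr 1
      simp [mulVec_one_apply, mul_comm]
    refine ⟨κ₀, ?_, fun κ hκκ => h.index_eq_odd ?_ ?_⟩
    · rw [show 2 * m + 1 + 1 = 2 * (m + 1) by ring]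
      refine h.index_eq_even (e1 _) ?_
      rwa [e0, ← h.lt_zpow_iff, ← h0]
    · rw [e0, H κ hκκ, h0]
    · rw [e1]

/-- Here the old dominant coordinate is strictly larger than the multiple of `lift κ` that is added
to it, so no residue class cancels it. -/
theorem IsUniformizer.index_of_not_par (h : IsUniformizer ϖ) {i : Fin 2} {p : Fin 2 → F}
    (hp : p ≠ 0) (hi : ¬Par i (index ϖ p)) (κ : 𝓀[F]) :
    index ϖ (((unip ϖ i (lift κ) * rep ϖ (s i))⁻¹).1.mulVec p) = index ϖ p - 1 := by
  have hκ := valuation_lift_le κ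
  obtain ⟨m, ⟨hm, h1, h0⟩ | ⟨hm, h0, h1⟩⟩ := h.index_cases hp
  · rw [hm] at hi ⊢
    obtain rfl : i = 1 := by
      rcases fin_two_eq_or 1 i with rfl | rfl
      · rfl
      · simp [Par] at hi
    rw [inv_unip_mul_rep_s_one, show 2 * m - 1 = 2 * (m - 1) + 1 by ring]
    refine h.index_eq_odd ?_ ?_
    · have e1 : valuation F ((ϖ : F)⁻¹ * p 1) = valuation F ϖ ^ (m - 1) := by
        rw [map_mul, map_inv₀, h1, zpow_sub_one₀ (valuation_unit_ne_zero ϖ), mul_comm]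
      rw [mulVec_zero_apply]
      refine ((valuation F).map_add_eq_of_lt_right ?_).trans e1
      refine lt_of_lt_of_eq (b := valuation F ϖ ^ (m - 1)) (h.lt_zpow_iff.2 ?_) e1.symm
      · change valuation F (-lift κ * p 0) ≤ _
        rw [sub_add_cancel, map_mul, Valuation.map_neg]
        exact (mul_le_of_le_one_left' hκ).trans h0
    · rw [mulVec_one_apply, sub_add_cancel]
      change valuation F (-ϖ * p 0 + 0 * p 1) ≤ _
      rw [zero_mul, add_zero, map_mul, Valuation.map_neg]
      exact (mul_le_of_le_one_left' h.lt_one.le).trans h0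
  · rw [hm] at hi ⊢
    obtain rfl : i = 0 := by
      rcases fin_two_eq_or 0 i with rfl | rfl
      · rfl
      · simp [Par] at hi
    rw [inv_unip_mul_rep_s_zero, add_sub_cancel_right]
    have h1' : valuation F (lift κ * p 1) < valuation F ϖ ^ m := by
      rw [h.lt_zpow_iff, map_mul]
      exact (mul_le_of_le_one_left' hκ).trans h1
    refine h.index_eq_even ?_ ?_
    · have e1 : valuation F (-1 * p 0) = valuation F ϖ ^ m := by
        rw [neg_one_mul, Valuation.map_neg, h0]
      rw [mulVec_one_apply]
      exact ((valuation F).map_add_eq_of_lt_left (h1'.trans_eq e1.symm)).trans e1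
    · rw [mulVec_zero_apply]
      change valuation F (0 * p 0 + 1 * p 1) ≤ _
      rw [zero_mul, zero_add, one_mul]
      exact h1.trans (h.zpow_le_zpow.2 (by omega))

/-- With `q` residue classes and index `k`, the sum is `(q - 1) ψ(k) + ψ(k + 1)` if `k` has the
parity of `i`, and `q ψ(k - 1)` otherwise. Both equal `q ψ(l) + ψ(l + 1) - ψ(k)` for `l = floorPar i
k`. -/
theorem IsUniformizer.sum_residue [Fintype 𝓀[F]] (h : IsUniformizer ϖ) {u : ℂˣ}
    (hu : (u : ℂ)⁻¹ * (u : ℂ)⁻¹ = Fintype.card 𝓀[F]) (i : Fin 2) (ψ : ℤ → ℂ) {p : Fin 2 → F}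
    (hp : p ≠ 0) :
    ∑ κ : 𝓀[F], ψ (index ϖ (((unip ϖ i (lift κ) * rep ϖ (s i))⁻¹).1.mulVec p)) =
      genSeq u i ψ (index ϖ p) := by
  rw [genSeq_apply, Units.val_inv_eq_inv_val, mul_add, ← mul_assoc, ← mul_assoc, hu,
    inv_mul_cancel₀ u.ne_zero, one_mul]
  by_cases hi : Par i (index ϖ p)
  · classical
    obtain ⟨κ₀, h1, h2⟩ := h.index_of_par hp hi
    rw [floorPar_of_par hi, ← Finset.add_sum_erase _ _ (Finset.mem_univ κ₀), h1,
      Finset.sum_congr rfl fun κ hκ => by rw [h2 κ (Finset.ne_of_mem_erase hκ)],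
      Finset.sum_const, Finset.card_erase_of_mem (Finset.mem_univ _), Finset.card_univ,
      nsmul_eq_mul, Nat.cast_sub Fintype.card_pos, Nat.cast_one]
    ring
  · rw [floorPar_of_not_par hi, Finset.sum_congr rfl fun κ _ => by rw [h.index_of_not_par hp hi κ],
      Finset.sum_const, Finset.card_univ, nsmul_eq_mul, sub_add_cancel, add_sub_cancel_right]

theorem IsUniformizer.sum_cosetRep [Fintype 𝓀[F]] (h : IsUniformizer ϖ) {u : ℂˣ}
    (hu : (u : ℂ)⁻¹ * (u : ℂ)⁻¹ = Fintype.card 𝓀[F]) (i : Fin 2) (n : ℕ) (ψ : ℤ → ℂ)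
    {p : Fin 2 → F} (hp : p ≠ 0) :
    ∑ d, ψ (index ϖ (((cosetRep ϖ i n d)⁻¹).1.mulVec p)) = wordSeq u i n ψ (index ϖ p) := by
  induction n generalizing i p with
  | zero =>
    rw [Fintype.sum_unique, cosetRep, digits, unip_zero, wordRep, one_mul, inv_one,
      Matrix.SpecialLinearGroup.coe_one, Matrix.one_mulVec]
    rfl
  | succ n ih =>
    rw [wordSeq_succ, ← h.sum_residue hu i _ hp, ← (Fin.consEquiv fun _ => 𝓀[F]).sum_comp,
      Fintype.sum_prod_type]
    refine Finset.sum_congr rfl fun κ _ => ?_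
    rw [← ih (i + 1) (mulVec_ne_zero _ hp)]
    refine Finset.sum_congr rfl fun d _ => ?_
    rw [cosetRep_succ, mul_inv_rev, Matrix.SpecialLinearGroup.coe_mul, ← Matrix.mulVec_mulVec]
    rfl

/-- The characteristic functions of the double cosets act through the operators on sequences. -/
theorem IsUniformizer.hasSum_charFun_mul_eq [Fintype 𝓀[F]] (h : IsUniformizer ϖ) {u : ℂˣ}
    (hu : (u : ℂ)⁻¹ * (u : ℂ)⁻¹ = Fintype.card 𝓀[F]) (w : W) (ψ : ℤ → ℂ) {p : Fin 2 → F}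
    (hp : p ≠ 0) :
    HasSum (fun c : SL2 F ⧸ iwahori F =>
        charFun ϖ w c.out * ψ (index ϖ ((c.out⁻¹).1.mulVec p))) (orbitSeq u ψ w (index ϖ p)) := by
  obtain ⟨i, n, rfl⟩ : ∃ i n, w = e i n := by
    rcases eq_one_or_eq_e w with rfl | ⟨i, n, rfl⟩
    · exact ⟨0, 0, rfl⟩
    · exact ⟨i, _, rfl⟩
  rw [orbitSeq_e, ← h.sum_cosetRep hu i n ψ hp]
  exact h.hasSum_charFun_mul i n ψ hp

end Digits

end

section

open ValuativeRel Filter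

/-! ### Convolution -/

section Convolution

/-- The absolute value of a sequence stays in the space, so the operators can be applied to it as a
majorant. -/
theorem norm_mem_periodic {φ : ℤ → ℂ} (h : φ ∈ periodic 1) :
    (fun k => ((‖φ k‖ : ℝ) : ℂ)) ∈ periodic 1 := by
  refine ⟨?_, ?_⟩
  · filter_upwards [h.1] with k hk
    rw [hk, norm_zero, Complex.ofReal_zero]
  · filter_upwards [h.2] with k hk
    rw [hk]

theorem single_mem_periodic (k : ℤ) : (Pi.single k 1 : ℤ → ℂ) ∈ periodic 1 := by
  refine ⟨?_, ?_⟩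
  · filter_upwards [eventually_lt_atBot k] with l hl
    exact Pi.single_eq_of_ne hl.ne _
  · filter_upwards [eventually_gt_atTop k] with l hl
    rw [Pi.single_eq_of_ne hl.ne', Pi.single_eq_of_ne (by omega)]

section

variable {F : Type*} [Field F] [ValuativeRel F] {ϖ : Fˣ}

theorem charFun_mul (w : W) (g : SL2 F) {k : SL2 F} (hk : k ∈ iwahori F) :
    charFun ϖ w (g * k) = charFun ϖ w g := by
  have key : ∀ (g : SL2 F) {k : SL2 F}, k ∈ iwahori F →
      g ∈ DoubleCoset.doubleCoset (rep ϖ w) (iwahori F) (iwahori F) →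
      g * k ∈ DoubleCoset.doubleCoset (rep ϖ w) (iwahori F) (iwahori F) := by
    intro g k hk hg
    rw [DoubleCoset.mem_doubleCoset] at hg ⊢
    obtain ⟨a, ha, b, hb, rfl⟩ := hg
    exact ⟨a, ha, b * k, mul_mem hb hk, by group⟩
  have h1 : g * k ∈ DoubleCoset.doubleCoset (rep ϖ w) (iwahori F) (iwahori F) ↔
      g ∈ DoubleCoset.doubleCoset (rep ϖ w) (iwahori F) (iwahori F) := by
    refine ⟨fun h => ?_, key g hk⟩
    have := key _ (inv_mem hk) h
    rwa [mul_inv_cancel_right] at this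
  unfold charFun
  by_cases hg : g ∈ DoubleCoset.doubleCoset (rep ϖ w) (iwahori F) (iwahori F)
  · rw [if_pos hg, if_pos (h1.2 hg)]
  · rw [if_neg hg, if_neg (mt h1.1 hg)]

theorem norm_charFun (w : W) (g : SL2 F) : ((‖charFun ϖ w g‖ : ℝ) : ℂ) = charFun ϖ w g := by
  unfold charFun
  split_ifs <;> simp

end

variable (F : Type*) [Field F] [ValuativeRel F] [TopologicalSpace F] [IsNonarchimedeanLocalField F]

theorem sqrtq_mul_sqrtq : (sqrtq F : ℂ) * sqrtq F = Nat.card 𝓀[F] := by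
  change ((Real.sqrt (Nat.card 𝓀[F]) : ℝ) : ℂ) * ((Real.sqrt (Nat.card 𝓀[F]) : ℝ) : ℂ) = _
  rw [← Complex.ofReal_mul, Real.mul_self_sqrt (Nat.cast_nonneg _), Complex.ofReal_natCast]

theorem norm_sqrtq : ‖(sqrtq F : ℂ)‖ = Real.sqrt (Nat.card 𝓀[F]) := by
  change ‖((Real.sqrt (Nat.card 𝓀[F]) : ℝ) : ℂ)‖ = _
  rw [Complex.norm_real, Real.norm_of_nonneg (Real.sqrt_nonneg _)]

theorem norm_inv_sqrtq_lt_one : ‖(((sqrtq F)⁻¹ : ℂˣ) : ℂ)‖ < 1 := by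
  rw [Units.val_inv_eq_inv_val, norm_inv, norm_sqrtq]
  refine inv_lt_one_of_one_lt₀ (Real.lt_sqrt_of_sq_lt ?_)
  rw [one_pow]
  exact_mod_cast Finite.one_lt_card (α := 𝓀[F])

theorem specialize_v_eq (n : ℤ) : specialize F (v n) = (((sqrtq F)⁻¹ ^ n : ℂˣ) : ℂ) := by
  rw [specialize_v, Units.val_zpow_eq_zpow_val, Units.val_inv_eq_inv_val]

variable {F} {ϖ : Fˣ}

theorem heckeFun_C' (w : W) (g : SL2 F) : heckeFun ϖ (C' w) g =
    (((sqrtq F)⁻¹ : ℂˣ) : ℂ) ^ len w * ∑ y ∈ lower w, charFun ϖ y g := by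
  have h1 : basisT.repr (C' w) = ∑ y ∈ lower w, Finsupp.single y (v (-len w)) := by
    rw [C', map_sum]
    refine Finset.sum_congr rfl fun y _ => ?_
    rw [← basisT_apply, map_smul, Module.Basis.repr_self, Finsupp.smul_single, smul_eq_mul, mul_one]
  have h2 : LaurentPolynomial.eval₂ (Int.castRingHom ℂ) (sqrtq F) (v (-len w)) =
      (((sqrtq F)⁻¹ : ℂˣ) : ℂ) ^ len w := by
    rw [v, LaurentPolynomial.eval₂_T, zpow_neg, zpow_natCast, ← inv_pow, Units.val_pow_eq_pow_val]
  rw [heckeFun, h1, ← Finsupp.sum_finsetSum_index, Finset.mul_sum]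
  · refine Finset.sum_congr rfl fun y _ => ?_
    rw [Finsupp.sum_single_index (by rw [map_zero, zero_mul]), h2]
  · intro y
    rw [map_zero, zero_mul]
  · intro y a b
    rw [map_add, add_mul]

/-- `C'_w` is a nonnegative function. The sum of absolute values in a convolution with it is thus
its action on `|φ|`, which is known exactly. -/
theorem norm_heckeFun_C' (w : W) (g : SL2 F) :
    ((‖heckeFun ϖ (C' w) g‖ : ℝ) : ℂ) = heckeFun ϖ (C' w) g := by
  have h1 : ∀ y, charFun ϖ y g = ((‖charFun ϖ y g‖ : ℝ) : ℂ) := fun y => (norm_charFun y g).symm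
  have h2 : (((sqrtq F)⁻¹ : ℂˣ) : ℂ) = (((Real.sqrt (Nat.card 𝓀[F]))⁻¹ : ℝ) : ℂ) := by
    rw [Units.val_inv_eq_inv_val, Complex.ofReal_inv]
    rfl
  rw [heckeFun_C', h2, Finset.sum_congr rfl fun y _ => h1 y, ← Complex.ofReal_sum,
    ← Complex.ofReal_pow, ← Complex.ofReal_mul, Complex.norm_real, Real.norm_of_nonneg]
  positivity

theorem IsUniformizer.hasSum_heckeFun_mul (h : IsUniformizer ϖ) (w : W) (φ : ℤ → ℂ)
    {p : Fin 2 → F} (hp : p ≠ 0) :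
    HasSum (fun c : SL2 F ⧸ iwahori F =>
        heckeFun ϖ (C' w) c.out * φ (index ϖ ((c.out⁻¹).1.mulVec p)))
      (KL (sqrtq F)⁻¹ (orbitSeq (sqrtq F)⁻¹ φ) w (index ϖ p)) := by
  have := Fintype.ofFinite 𝓀[F]
  have hu : ((((sqrtq F)⁻¹ : ℂˣ) : ℂ))⁻¹ * ((((sqrtq F)⁻¹ : ℂˣ) : ℂ))⁻¹ = Fintype.card 𝓀[F] := by
    rw [Units.val_inv_eq_inv_val, inv_inv, sqrtq_mul_sqrtq, Nat.card_eq_fintype_card]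
  have h1 := (hasSum_sum fun y (_ : y ∈ lower w) => h.hasSum_charFun_mul_eq hu y φ hp).mul_left
    ((((sqrtq F)⁻¹ : ℂˣ) : ℂ) ^ len w)
  convert! h1 using 1
  · funext c
    rw [heckeFun_C', mul_assoc, Finset.sum_mul]
  · unfold KL
    rw [Pi.smul_apply, Finset.sum_apply, smul_eq_mul]

/-- The double series for the convolution with `t_w` converges absolutely. -/
theorem IsUniformizer.summable_prod (h : IsUniformizer ϖ) (w : W) {φ : ℤ → ℂ}
    (hφ : φ ∈ periodic 1) {p : Fin 2 → F} (hp : p ≠ 0) :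
    Summable fun a : W × (SL2 F ⧸ iwahori F) => specialize F (tau w a.1) *
      (heckeFun ϖ (C' a.1) a.2.out * φ (index ϖ ((a.2.out⁻¹).1.mulVec p))) := by
  have h1 : ∀ y, HasSum (fun c : SL2 F ⧸ iwahori F => ‖specialize F (tau w y) *
      (heckeFun ϖ (C' y) c.out * φ (index ϖ ((c.out⁻¹).1.mulVec p)))‖)
      ‖specialize F (tau w y) * KL (sqrtq F)⁻¹
        (orbitSeq (sqrtq F)⁻¹ fun k => ((‖φ k‖ : ℝ) : ℂ)) y (index ϖ p)‖ := by
    intro y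
    have h2 := h.hasSum_heckeFun_mul y (fun k => ((‖φ k‖ : ℝ) : ℂ)) hp
    have h3 : ∀ c : SL2 F ⧸ iwahori F, heckeFun ϖ (C' y) c.out *
        ((‖φ (index ϖ ((c.out⁻¹).1.mulVec p))‖ : ℝ) : ℂ) =
        ((‖heckeFun ϖ (C' y) c.out * φ (index ϖ ((c.out⁻¹).1.mulVec p))‖ : ℝ) : ℂ) := fun c => by
      rw [norm_mul, Complex.ofReal_mul, norm_heckeFun_C']
    simp only [h3] at h2
    have h4 : Summable fun c : SL2 F ⧸ iwahori F =>
        ‖heckeFun ϖ (C' y) c.out * φ (index ϖ ((c.out⁻¹).1.mulVec p))‖ :=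
      Complex.summable_ofReal.1 h2.summable
    have h5 := h2.unique (Complex.hasSum_ofReal.2 h4.hasSum)
    rw [h5, norm_mul, Complex.norm_real,
      Real.norm_of_nonneg (tsum_nonneg fun c => norm_nonneg _)]
    simp only [norm_mul (specialize F (tau w y))]
    exact h4.hasSum.mul_left _
  refine Summable.of_norm ((summable_prod_of_nonneg fun _ => norm_nonneg _).2
    ⟨fun y => (h1 y).summable, ?_⟩)
  simp only [(h1 _).tsum_eq]
  exact summable_norm_tau_mul (specialize_v_eq F) (norm_inv_sqrtq_lt_one F) w
    (norm_mem_periodic hφ) _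

theorem functionTerm_tau (w : W) (g : SL2 F) (y : W) :
    functionTerm ϖ (fun x => toSeries (tau w x)) g y =
      specialize F (tau w y) * heckeFun ϖ (C' y) g := by
  rw [functionTerm, (hasSum_valueTerm F _).tsum_eq]

/-- The double series is tested on the sequence supported at index `0`, at the vector `g • stdVec ϖ
0`: in the fibre over the coset of `g` the factor is `1`, and what remains is the series at `g`. -/
theorem IsUniformizer.summable_functionTerm_tau (h : IsUniformizer ϖ) (w : W) (g : SL2 F) :
    Summable (functionTerm ϖ (fun x => toSeries (tau w x)) g) := by
  have hp := mulVec_ne_zero g (stdVec_ne_zero (ϖ := ϖ) 0)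
  have h1 := (Equiv.prodComm _ _).summable_iff.2 (h.summable_prod w (single_mem_periodic 0) hp)
  have h2 : Summable fun y => specialize F (tau w y) *
      (heckeFun ϖ (C' y) (QuotientGroup.mk g : SL2 F ⧸ iwahori F).out *
        (Pi.single 0 1 : ℤ → ℂ) (index ϖ (((QuotientGroup.mk g : SL2 F ⧸ iwahori F).out⁻¹).1.mulVec
          (g.1.mulVec (stdVec ϖ 0))))) := h1.prod_factor (QuotientGroup.mk g)
  obtain ⟨⟨k, hk⟩, hgk⟩ := QuotientGroup.mk_out_eq_mul (iwahori F) g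
  have h3 : index ϖ (((QuotientGroup.mk g : SL2 F ⧸ iwahori F).out⁻¹).1.mulVec
      (g.1.mulVec (stdVec ϖ 0))) = 0 := by
    have e1 := mulVec_mulVec_inv g⁻¹ (stdVec ϖ 0)
    rw [inv_inv] at e1
    rw [h.index_inv_mulVec (g := g) (by rw [hgk, inv_mul_cancel_left]; exact hk) hp, e1,
      h.index_stdVec]
  convert! h2 using 1
  funext y
  have e2 : heckeFun ϖ (C' y) (QuotientGroup.mk g : SL2 F ⧸ iwahori F).out =
      heckeFun ϖ (C' y) g := by
    rw [hgk, heckeFun_C', heckeFun_C']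
    simp only [charFun_mul _ g hk]
  rw [functionTerm_tau, h3, Pi.single_eq_same, mul_one, e2]

/-- Summed over cosets first, the double series is the one evaluated by `hasSum_tau_mul`; summed
over the Weyl group first, it is the convolution. Absolute convergence identifies the two. -/
theorem IsUniformizer.hasSum_convolution (h : IsUniformizer ϖ) (w : W) (φ : periodic 1)
    {p : Fin 2 → F} (hp : p ≠ 0) :
    HasSum (fun c : SL2 F ⧸ iwahori F =>
        (∑' y, functionTerm ϖ (fun x => toSeries (tau w x)) c.out y) *
          φ.1 (index ϖ ((c.out⁻¹).1.mulVec p)))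
      ((actBasis (sqrtq F)⁻¹ w φ).1 (index ϖ p)) := by
  have h1 := (h.summable_prod w φ.2 hp).hasSum
  have h2 := h1.prod_fiberwise fun y => (h.hasSum_heckeFun_mul y φ.1 hp).mul_left
    (specialize F (tau w y))
  rw [h2.unique (hasSum_tau_mul (specialize_v_eq F) (norm_inv_sqrtq_lt_one F) w φ _)] at h1
  have h3 := (Equiv.prodComm (SL2 F ⧸ iwahori F) W).hasSum_iff.2 h1
  refine h3.prod_fiberwise fun c => ?_
  convert! ((h.summable_functionTerm_tau w c.out).hasSum.mul_right
    (φ.1 (index ϖ ((c.out⁻¹).1.mulVec p)))) using 1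
  funext y
  change specialize F (tau w y) * (heckeFun ϖ (C' y) c.out * _) = _
  rw [functionTerm_tau, mul_assoc]
  rfl

end Convolution

/-- The action of the asymptotic algebra on the invariant functions on the plane. -/
def actSchwartz {F : Type*} [Field F] [ValuativeRel F] [TopologicalSpace F]
    [IsNonarchimedeanLocalField F] {ϖ : Fˣ} (h : IsUniformizer ϖ) :
    J →+ Module.End ℂ (schwartz F) :=
  (profileEquiv h).symm.conjRingEquiv.toAddMonoidHom.comp (act (sqrtq F)⁻¹)

end

end AffineSL2

end

/-! ### The action on the invariant functions on the plane. -/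

theorem theoremJ (F : Type*) [Field F] [ValuativeRel F] [TopologicalSpace F]
    [IsNonarchimedeanLocalField F] (ϖ : Fˣ) (hϖ : AffineSL2.IsUniformizer ϖ) :
    -- `τ w` is the element `(φ ∘ j)⁻¹ (t_w) = ∑ τ_{w,x} C'_x` of the completed Hecke algebra
    ∃ τ : AffineSL2.W → AffineSL2.W → LaurentSeries ℤ,
      (∀ (w : AffineSL2.W) (b : AffineSL2.W → LaurentSeries ℤ),
        (AffineSL2.IsCompleted b ∧ AffineSL2.IsPhiJ b (Pi.single w 1)) ↔ b = τ w) ∧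
      -- it defines a function on `SL₂(F)`
      (∀ w x, Summable (AffineSL2.valueTerm F (τ w x))) ∧
      (∀ w (g : AffineSL2.SL2 F), Summable (AffineSL2.functionTerm ϖ (τ w) g)) ∧
      -- convolution with these functions is an action of the algebra `J`
      ∃ ρ : AffineSL2.J →+ Module.End ℂ (AffineSL2.schwartz F),
        (∀ (w : AffineSL2.W) (f : AffineSL2.schwartz F) (x : Fin 2 → F), x ≠ 0 →
          HasSum (fun c : AffineSL2.SL2 F ⧸ AffineSL2.iwahori F =>
            (∑' y, AffineSL2.functionTerm ϖ (τ w) c.out y) * f.1 ((c.out⁻¹).1.mulVec x))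
            ((ρ (AffineSL2.t w) f).1 x)) ∧
        ρ 1 = 1 ∧ ∀ m n : AffineSL2.J, ρ (m * n) = ρ m * ρ n := by
  refine ⟨fun w x => AffineSL2.toSeries (AffineSL2.tau w x), AffineSL2.isCompleted_and_isPhiJ_iff,
    fun w x => (AffineSL2.hasSum_valueTerm F _).summable, hϖ.summable_functionTerm_tau,
    AffineSL2.actSchwartz hϖ, fun w f x hx => ?_, ?_, fun m n => ?_⟩
  -- Away from the origin everything is read through the index; the value of `t_w ⋆ f` at the origin
  -- is supplied by `profileEquiv` as the limit of its sequence.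
  · have h1 := hϖ.hasSum_convolution w (AffineSL2.profileEquiv hϖ f) hx
    rw [AffineSL2.apply_eq_profileEquiv hϖ _ hx]
    convert h1 using 1
    · funext c
      rw [AffineSL2.apply_eq_profileEquiv hϖ f (AffineSL2.mulVec_ne_zero _ hx)]
    · rw [← AffineSL2.act_t]
      change ((AffineSL2.profileEquiv hϖ) ((AffineSL2.profileEquiv hϖ).symm
        (AffineSL2.act _ (AffineSL2.t w) (AffineSL2.profileEquiv hϖ f)))).1 _ = _
      rw [LinearEquiv.apply_symm_apply]
  · rw [AffineSL2.actSchwartz]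
    change (AffineSL2.profileEquiv hϖ).symm.conjRingEquiv (AffineSL2.act _ 1) = 1
    rw [AffineSL2.act_one, map_one]
  · change (AffineSL2.profileEquiv hϖ).symm.conjRingEquiv (AffineSL2.act _ (m * n)) = _
    rw [AffineSL2.act_mul, map_mul]
    rfl
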